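/- **Setting.** Let $\mathbf T^2=\mathbf R^2/\mathbf Z^2$, let $B\in C^\infty(\mathbf T^2,\mathbf R)$ with flux $\widehat B_0=\int_{\mathbf T^2}B\,dx\in 2\pi\mathbf Z$, and write $x\wedge y=x_1y_2-x_2y_1$, $y^\perp=(-y_2,y_1)$, $\langle\xi\rangle=(1+|\xi|^2)^{1/2}$. Let $C^\infty(\mathbf T^2,L)$ be the space of $u\in C^\infty(\mathbf R^2,\mathbf C)$ with $$u(x_1,x_2)=e^{-\frac{i\widehat B_0}{2}x_1}u(x_1,x_2-1)=e^{\frac{i\widehat B_0}{2}x_2}u(x_1-1,x_2).$$ For $m\in\mathbf R$ let $S^m$ be the set of $a\in C^\infty(\mathbf T^2\times\mathbf R^2,\mathbf C)$ such that for all $\alpha,\beta\in\mathbf N_0^2$ there is $C_{\alpha\beta}$ with $|\partial_x^\alpha\partial_\xi^\beta a(x,\xi)|\le C_{\alpha\beta}\langle\xi\rangle^m$. For a family $(r_h)$ of smooth functions on $\mathbf T^2\times\mathbf R^2$, $r_h=\mathcal O_{S^m}(h^N)$ means that for all $\alpha,\beta$ there is $C$ with $|\partial_x^\alpha\partial_\xi^\beta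 r_h(x,\xi)|\le C h^N\langle\xi\rangle^m$ for all $0<h\le1$ and all $(x,\xi)$. For $h>0$, $\eta\in2\pi\mathbf Z^2$, $\zeta\in\mathbf R^2$ put $$W_h^B(\eta,\zeta)u(x)=e^{\frac{ih\widehat B_0}{2}\zeta\wedge x}e^{i\eta\cdot(x+\frac{h\zeta}2)}u(x+h\zeta),\qquad \mathcal F(a)(\eta,\zeta)=\int_{\mathbf T^2\times\mathbf R^2}a(x,\xi)e^{-i\eta\cdot x-i\zeta\cdot\xi}\,dx\,d\xi,$$ $$\mathrm{Op}_h^B(a)=\frac1{(2\pi)^2}\sum_{\eta\in2\pi\mathbf Z^2}\int_{\mathbf R^2}\mathcal F(a)(\eta,\zeta)\,W_h^B(\eta,\zeta)\,d\zeta .$$ For $a\in S^m$ and $u\in C^\infty(\mathbf T^2,L)$, $\mathrm{Op}_h^B(a)u$ is read as an oscillatory integral: it is the pointwise limit, as $\varepsilon\to0^+$, of $\mathrm{Op}_h^B(\chi(\varepsilon\xi)a(x,\xi))u$, the same for every Schwartz function $\chi$ on $\mathbf R^2$ with $\chi(0)=1$. Finally let $$\Omega_{hB}(\eta,\zeta;\eta',\zeta')=\eta'\cdot\zeta-\eta\cdot\zeta'+h\widehat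 B_0\,\zeta'\wedge\zeta,\qquad D=-i\partial,\qquad \{a,b\}=\partial_\xi a\cdot\partial_xb-\partial_xa\cdot\partial_\xi b .$$ **Theorem.** Let $m_1,m_2\in\mathbf R$, $a\in S^{m_1}$, $b\in S^{m_2}$. 1. For every $h>0$ there is an $h$-dependent symbol $a\star b\in S^{m_1+m_2}$ such that $\mathrm{Op}_h^B(a)\circ\mathrm{Op}_h^B(b)=\mathrm{Op}_h^B(a\star b)$ on $C^\infty(\mathbf T^2,L)$ (all three operators being well defined from this space to itself). 2. The symbol $a\star b$ is explicitly given by the oscillatory integral $$a\star b(x,\xi)=\sum_{\eta,\eta'\in2\pi\mathbf Z^2}\int_{\mathbf T^4}e^{i(\eta\cdot y+\eta'\cdot y'+2\widehat B_0\,y\wedge y')}\,a\Big(x-y,\xi+\tfrac{h\eta'}2+h\widehat B_0y^\perp\Big)\,b\Big(x-y',\xi-\tfrac{h\eta}2+h\widehat B_0y'^\perp\Big)\,dy\,dy'.$$ Here the series of smooth functions of $(y,y')\in\mathbf R^4$ is summed in the sense of distributions; its sum is $\mathbf Z^4$-periodic, and $\int_{\mathbf T^4}$ is the pairing of this periodic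 distribution with the constant $1$. That is, for every $\chi\in C_c^\infty(\mathbf R^4)$ whose $\mathbf Z^4$-translates sum to $1$, inserting $\chi(y,y')$ and integrating over $\mathbf R^4$ gives a series in $(\eta,\eta')$ that converges absolutely to $a\star b(x,\xi)$. 3. For all $N\ge1$, $$a\star b(x,\xi)=\sum_{n=0}^{N-1}\frac1{n!}\Big(\frac{ih}2\Big)^n\Omega_{hB}(D_x,D_\xi;D_{x'},D_{\xi'})^n\,\big(a(x,\xi)b(x',\xi')\big)\Big|_{(x',\xi')=(x,\xi)}+\mathcal O_{S^{m_1+m_2}}(h^N).$$ 4. In particular, $a\star b=ab+\mathcal O_{S^{m_1+m_2}}(h)$ and $$a\star b-b\star a=\frac hi\{a,b\}+\frac{\widehat B_0h^2}{i}\big(\partial_{\xi_2}a\,\partial_{\xi_1}b-\partial_{\xi_1}a\,\partial_{\xi_2}b\big)+\mathcal O_{S^{m_1+m_2}}(h^3).$$ -/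

import Mathlib

open scoped ContDiff Topology SchwartzMap
open MeasureTheory Filter

namespace MagneticWeyl

/-- The Euclidean plane `ℝ²`. -/
abbrev Plane : Type := EuclideanSpace ℝ (Fin 2)

/-- The phase space `ℝ² × ℝ²` of points `(x, ξ)`. Functions on `T*𝕋² = 𝕋² × ℝ²` are functions on
`Plane × Plane` that are `ℤ²`-periodic in `x`. -/
abbrev Phase : Type := Plane × Plane

/-- The vector of `ℤ² ⊆ ℝ²` with coordinates `k`. -/
noncomputable def latticeVec (k : Fin 2 → ℤ) : Plane := !₂[(k 0 : ℝ), (k 1 : ℝ)]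

/-- The frequency `2πk ∈ 2πℤ²`. -/
noncomputable def freq (k : Fin 2 → ℤ) : Plane := (2 * Real.pi) • latticeVec k

/-- `x ∧ y = x₁ y₂ - x₂ y₁`. -/
def wedge (x y : Plane) : ℝ := x 0 * y 1 - x 1 * y 0

/-- `y^⊥ = (-y₂, y₁)`. -/
noncomputable def perp (y : Plane) : Plane := !₂[-(y 1), y 0]

/-- The Japanese bracket `⟨ξ⟩ = (1 + |ξ|²)^{1/2}`. -/
noncomputable def japanese (ξ : Plane) : ℝ := Real.sqrt (1 + ‖ξ‖ ^ 2)

/-- The fundamental domain `[0,1]²` of `𝕋² = ℝ²/ℤ²`. -/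
def unitCell : Set Plane := {x | ∀ i, x i ∈ Set.Icc (0 : ℝ) 1}

/-- The total flux `B̂₀ = ∫_{𝕋²} B`. -/
noncomputable def flux (B : Plane → ℝ) : ℝ := ∫ x in unitCell, B x

/-! ### Symbol classes -/

/-- The `j`-th vector of the standard basis of the plane. -/
noncomputable def basisVec (j : Fin 2) : Plane := EuclideanSpace.single j 1

/-- `∂_{x_j} a`. -/
noncomputable def dX (j : Fin 2) (a : Phase → ℂ) : Phase → ℂ :=
  fun z => fderiv ℝ a z (basisVec j, 0)

/-- `∂_{ξ_j} a`. -/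
noncomputable def dXi (j : Fin 2) (a : Phase → ℂ) : Phase → ℂ :=
  fun z => fderiv ℝ a z (0, basisVec j)

/-- `∂_x^α ∂_ξ^β a` for multi-indices `α, β ∈ ℕ²`. -/
noncomputable def multiDeriv (α β : Fin 2 → ℕ) (a : Phase → ℂ) : Phase → ℂ :=
  (dX 0)^[α 0] ((dX 1)^[α 1] ((dXi 0)^[β 0] ((dXi 1)^[β 1] a)))

/-- `a ∈ C^∞(𝕋² × ℝ², ℂ)`. -/
def IsSmoothPeriodic (a : Phase → ℂ) : Prop :=
  ContDiff ℝ ∞ a ∧ ∀ (k : Fin 2 → ℤ) (x ξ : Plane), a (x + latticeVec k, ξ) = a (x, ξ)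

/-- The symbol class `S^m`. -/
def symbolClass (m : ℝ) : Set (Phase → ℂ) :=
  {a | IsSmoothPeriodic a ∧ ∀ α β : Fin 2 → ℕ, ∃ C : ℝ, ∀ x ξ : Plane,
    ‖multiDeriv α β a (x, ξ)‖ ≤ C * japanese ξ ^ m}

/-- `r_h = O_{S^m}(h^N)`: every seminorm of `r_h` in `S^m` is `O(h^N)`, uniformly for
`0 < h ≤ 1`. -/
def IsBigOSymbol (m : ℝ) (N : ℕ) (r : ℝ → Phase → ℂ) : Prop :=
  (∀ h ∈ Set.Ioc (0 : ℝ) 1, IsSmoothPeriodic (r h)) ∧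
  ∀ α β : Fin 2 → ℕ, ∃ C : ℝ, ∀ h ∈ Set.Ioc (0 : ℝ) 1, ∀ x ξ : Plane,
    ‖multiDeriv α β (r h) (x, ξ)‖ ≤ C * h ^ N * japanese ξ ^ m

/-- The Poisson bracket `{a,b} = ∂_ξ a · ∂_x b - ∂_x a · ∂_ξ b`. -/
noncomputable def poisson (a b : Phase → ℂ) : Phase → ℂ :=
  fun z => ∑ j, (dXi j a z * dX j b z - dX j a z * dXi j b z)

/-! ### Magnetic translations and sections -/

/-- The magnetic translation `𝒯_m u (x) = e^{(i b / 2) m ∧ x} u(x - m)`, where `b` is the flux. -/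
noncomputable def magTranslate (b : ℝ) (m : Plane) (u : Plane → ℂ) : Plane → ℂ :=
  fun x => Complex.exp (Complex.I * ((b / 2 * wedge m x : ℝ) : ℂ)) * u (x - m)

/-- `C^∞(𝕋², L)`: the smooth functions that are invariant under the magnetic translations by the
two generators of `ℤ²`,
`u(x₁, x₂) = e^{-(i b/2) x₁} u(x₁, x₂ - 1) = e^{(i b/2) x₂} u(x₁ - 1, x₂)`. -/
def smoothSections (b : ℝ) : Set (Plane → ℂ) :=
  {u | ContDiff ℝ ∞ u ∧ ∀ j : Fin 2, magTranslate b (basisVec j) u = u}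

/-! ### Magnetic Weyl quantization -/

/-- The magnetic Weyl operator
`W_h(η, ζ) u (x) = e^{(i h b / 2) ζ ∧ x} e^{i η · (x + h ζ / 2)} u(x + h ζ)`. -/
noncomputable def weylOp (h b : ℝ) (η ζ : Plane) (u : Plane → ℂ) : Plane → ℂ :=
  fun x => Complex.exp (Complex.I * ((h * b / 2 * wedge ζ x : ℝ) : ℂ)) *
    Complex.exp (Complex.I * ((inner ℝ η (x + (h / 2) • ζ) : ℝ) : ℂ)) * u (x + h • ζ)

/-- `ℱ(a)(η, ζ) = ∫_{𝕋² × ℝ²} a(x, ξ) e^{-i η · x} e^{-i ζ · ξ} dx dξ`. -/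
noncomputable def symbolFourier (a : Phase → ℂ) (η ζ : Plane) : ℂ :=
  ∫ z in unitCell ×ˢ (Set.univ : Set Plane),
    a z * Complex.exp (-(Complex.I * ((inner ℝ η z.1 : ℝ) : ℂ))) *
      Complex.exp (-(Complex.I * ((inner ℝ ζ z.2 : ℝ) : ℂ)))

/-- `(2π)^{-2} ∑_{η ∈ 2πℤ²} ∫_{ℝ²} ℱ(a)(η, ζ) W_h(η, ζ) u(x) dζ`. Everything converges absolutely
when `a` is smooth and periodic in `x`, and Schwartz in `ξ` uniformly in `x`. -/
noncomputable def weylSum (h b : ℝ) (a : Phase → ℂ) (u : Plane → ℂ) (x : Plane) : ℂ :=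
  (1 / (2 * (Real.pi : ℂ)) ^ 2) *
    ∑' k : Fin 2 → ℤ, ∫ ζ : Plane, symbolFourier a (freq k) ζ * weylOp h b (freq k) ζ u x

/-- `v = Op_h(a) u`, where for a general symbol the formula that defines the quantization is read
as an oscillatory integral: the symbol `a(x, ξ)` is replaced by `χ(ε ξ) a(x, ξ)`, with `χ` Schwartz
and `χ(0) = 1`, and `ε → 0⁺`; the limit has to exist and be the same for every `χ`. -/
def IsOp (h b : ℝ) (a : Phase → ℂ) (u v : Plane → ℂ) : Prop :=
  ∀ χ : 𝓢(Plane, ℂ), χ 0 = 1 → ∀ x : Plane,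
    Tendsto (fun ε : ℝ => weylSum h b (fun z => χ (ε • z.2) * a z) u x) (𝓝[>] 0) (𝓝 (v x))

/-! ### The product of symbols -/

/-- `e^{i(η·y + η'·y' + 2β y∧y')} a(x - y, ξ + hη'/2 + hβ y^⊥) b(x - y', ξ - hη/2 + hβ y'^⊥)`
as a function of `p = (y, y')`, where `β` is the flux. -/
noncomputable def starIntegrand (h β : ℝ) (a b : Phase → ℂ) (x ξ η η' : Plane)
    (p : Plane × Plane) : ℂ :=
  Complex.exp (Complex.I *
      ((inner ℝ η p.1 + inner ℝ η' p.2 + 2 * β * wedge p.1 p.2 : ℝ) : ℂ)) *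
    a (x - p.1, ξ + (h / 2) • η' + (h * β) • perp p.1) *
    b (x - p.2, ξ - (h / 2) • η + (h * β) • perp p.2)

/-- `χ ∈ C_c^∞(ℝ⁴)` and the translates of `χ` by `ℤ⁴` add up to `1`. For a `ℤ⁴`-periodic function
(or distribution) `T` one has `∫_{𝕋⁴} T = ∫_{ℝ⁴} χ T`. -/
def IsLatticeCutoff (χ : Plane × Plane → ℝ) : Prop :=
  ContDiff ℝ ∞ χ ∧ HasCompactSupport χ ∧
  ∀ y y' : Plane, HasSum
    (fun k : (Fin 2 → ℤ) × (Fin 2 → ℤ) => χ (y - latticeVec k.1, y' - latticeVec k.2)) 1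

/-- `c(x, ξ) = ∑_{η, η' ∈ 2πℤ²} ∫_{𝕋⁴} (starIntegrand)(y, y') dy dy'` as an oscillatory integral.
When `β ∈ 2πℤ`, the translations of `ℤ⁴` in `(y, y')` permute the terms of the series, so that its
sum in the sense of distributions is `ℤ⁴`-periodic; its integral over `𝕋⁴` is its pairing with any
lattice cutoff. -/
def IsStarIntegral (h β : ℝ) (a b c : Phase → ℂ) : Prop :=
  ∀ χ : Plane × Plane → ℝ, IsLatticeCutoff χ → ∀ x ξ : Plane,
    HasSum (fun k : (Fin 2 → ℤ) × (Fin 2 → ℤ) =>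
      ∫ p : Plane × Plane, (χ p : ℂ) * starIntegrand h β a b x ξ (freq k.1) (freq k.2) p)
      (c (x, ξ))

/-! ### The bidifferential operator -/

/-- `D_v F = -i ∂_v F` for functions of the doubled variables `((x, ξ), (x', ξ'))`. -/
noncomputable def dirD (v : Phase × Phase) (F : Phase × Phase → ℂ) : Phase × Phase → ℂ :=
  fun q => -Complex.I * fderiv ℝ F q v

/-- `D_{x_j}`. -/
noncomputable def Dx (j : Fin 2) := dirD ((basisVec j, 0), 0)

/-- `D_{ξ_j}`. -/
noncomputable def Dξ (j : Fin 2) := dirD ((0, basisVec j), 0)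

/-- `D_{x'_j}`. -/
noncomputable def Dx' (j : Fin 2) := dirD (0, (basisVec j, 0))

/-- `D_{ξ'_j}`. -/
noncomputable def Dξ' (j : Fin 2) := dirD (0, (0, basisVec j))

/-- `Ω_{hB}(D_x, D_ξ, D_{x'}, D_{ξ'})` for
`Ω_{hB}(η, ζ; η', ζ') = η' · ζ - η · ζ' + h β ζ' ∧ ζ`. -/
noncomputable def omegaD (h β : ℝ) (F : Phase × Phase → ℂ) : Phase × Phase → ℂ :=
  fun q => (∑ j, Dx' j (Dξ j F) q) - (∑ j, Dx j (Dξ' j F) q) +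
    ((h * β : ℝ) : ℂ) * (Dξ' 0 (Dξ 1 F) q - Dξ' 1 (Dξ 0 F) q)

/-- `Ω_{hB}(D_x, D_ξ, D_{x'}, D_{ξ'})^n a(x, ξ) b(x', ξ')` at `(x', ξ') = (x, ξ)`. -/
noncomputable def omegaTerm (h β : ℝ) (n : ℕ) (a b : Phase → ℂ) : Phase → ℂ :=
  fun z => (omegaD h β)^[n] (fun q => a q.1 * b q.2) (z, z)

end MagneticWeyl

open MagneticWeyl

set_option linter.unusedSectionVars false

/-! The quantization and the star product are both series over a lattice of integrals `∫ e^{iφ_k} g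
f_k` with linear phases `φ_k`, a fixed compactly supported `g`, and amplitudes `f_k(y) = F(z + M y +
c_k)`. By Peetre's inequality these amplitudes grow at most like a power `q` of `1 + |k|`.
Integrating by parts `q + 8` times leaves `(1 + |k|)^{-8}` (`norm_oscTerm_le`), which is summable
over both `ℤ²` and `ℤ⁴`. The series therefore converge absolutely, and they may be differentiated,
integrated and passed to the limit in parameters. As `z` enters by translation only, derivatives in
`z` fall on `F`, and the series inherits the weight that bounds `F` (`dirDeriv_shearSum`,
`ModerateWeight.exists_symbolBound_shearSum`).

The star product is obtained from an operator `starSum` on bisymbols `F((x, ξ), (x', ξ'))`, applied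
to `a ⊗ b` and restricted to the diagonal. Since the flux `β` lies in `2πℤ`, translating `(y, y')`
by `ℤ⁴` permutes the terms of the series. Hence a cutoff whose translates sum to zero gives zero
(`starSum_eq_zero`). This yields independence of the cutoff, and it also allows integration by parts
without a contribution from the derivative of the cutoff (`hasSum_starKernel_mul`).

The expansion comes from a differential equation in `h` rather than from Taylor's formula under the
integral. The argument of `F` is affine in `h`, and its velocity is half the gradient of the phase
(`starSlope_add_unitShift`). Integration by parts then gives `d/dh starSum_h F = starSum_h (G_h F)`,
where `G_h` is the derivative of `(ih/2) Ω_{hB}` (`hasDerivAt_starSum`). At `h = 0` Poisson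
summation gives `starSum_0 F = F`, so formally `starSum_h = exp((ih/2) Ω_{hB})`. The remainder after
`N + 1` terms vanishes at `h = 0`, and its derivative is the remainder after `N` terms applied to
`G_h F`. An induction with the mean value inequality bounds it by `h^{N+1}`
(`exists_norm_starRemainder_le`). All derivatives of the remainder are remainders of other
bisymbols, so sup bounds control every seminorm. The commutator follows because `Ω_{hB}` is odd
under exchange of the two factors.

For the composition, characters `e^{i(η·x + ζ·ξ)}` are the model case. Poisson summation shows that
the series `opSum` sends a character to the Weyl operator `W_h(η, ζ)` (`opSum_character`), and that
the star product of two characters is their product times the same unimodular factor as in the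
product of the Weyl operators (`starSum_character`, `weylOp_weylOp`). Symbols that decay rapidly in
`ξ` are absolutely convergent superpositions of characters, by Fourier inversion, so on them `opSum`
agrees with the defining formula and the composition formula holds. General symbols are limits of
regularizations `χ(εξ) a` with uniform seminorms, along which both sides converge (`isOp_opSum`,
`opSum_opSum`). -/

namespace MagneticWeyl

/-! ### Oscillatory integrals with linear phase -/

section OscillatoryIntegral

variable {V : Type*} [NormedAddCommGroup V] [NormedSpace ℝ V]
  {E : Type*} [NormedAddCommGroup E] [NormedSpace ℝ E] [NormedSpace ℂ E] [IsScalarTower ℝ ℂ E]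

/-- The unimodular function `e^{iφ}`. -/
noncomputable def phase (φ : V →L[ℝ] ℝ) (y : V) : ℂ := Complex.exp (Complex.I * (φ y : ℂ))

lemma norm_phase (φ : V →L[ℝ] ℝ) (y : V) : ‖phase φ y‖ = 1 := by
  rw [phase, mul_comm]; exact Complex.norm_exp_ofReal_mul_I _

lemma hasFDerivAt_phase (φ : V →L[ℝ] ℝ) (y : V) :
    HasFDerivAt (phase φ) (phase φ y • (Complex.I • Complex.ofRealCLM.comp φ)) y := by
  have h : HasFDerivAt (fun y => Complex.I * (φ y : ℂ)) (Complex.I • Complex.ofRealCLM.comp φ) y :=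
    ((Complex.ofRealCLM.comp φ).hasFDerivAt (x := y)).const_mul Complex.I
  exact h.cexp

lemma contDiff_phase (φ : V →L[ℝ] ℝ) {n : ℕ∞ω} : ContDiff ℝ n (phase φ) := by
  unfold phase
  exact (contDiff_const.mul ((Complex.ofRealCLM.comp φ).contDiff)).cexp

lemma fderiv_phase_apply (φ : V →L[ℝ] ℝ) (y v : V) :
    fderiv ℝ (phase φ) y v = Complex.I * φ v * phase φ y := by
  rw [(hasFDerivAt_phase φ y).fderiv]; simp; ring

lemma continuous_phase (φ : V →L[ℝ] ℝ) : Continuous (phase φ) :=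
  (contDiff_phase φ (n := 0)).continuous

variable [FiniteDimensional ℝ V] [MeasureSpace V] [BorelSpace V]

lemma integrable_phase_smul (φ : V →L[ℝ] ℝ) {G : V → E} (hG : Integrable G) :
    Integrable (fun y => phase φ y • G y) := by
  exact hG.bdd_smul 1 (continuous_phase φ).aestronglyMeasurable
    (Eventually.of_forall fun y => (norm_phase φ y).le)

lemma norm_integral_phase_smul_le (φ : V →L[ℝ] ℝ) (G : V → E) :
    ‖∫ y, phase φ y • G y‖ ≤ ∫ y, ‖G y‖ := by
  refine (norm_integral_le_integral_norm _).trans_eq ?_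
  simp [norm_smul, norm_phase]

variable [(volume : Measure V).IsAddHaarMeasure]

lemma integral_phase_smul_fderiv (φ : V →L[ℝ] ℝ) {G : V → E} (hG : ContDiff ℝ ∞ G)
    (h0 : Integrable G) (v : V) (h1 : Integrable (fun y => fderiv ℝ G y v)) :
    ∫ y, phase φ y • fderiv ℝ G y v = -((Complex.I * φ v) • ∫ y, phase φ y • G y) := by
  have e : ∀ y, fderiv ℝ (phase φ) y v • G y = (Complex.I * φ v) • (phase φ y • G y) := by
    intro y; rw [fderiv_phase_apply, mul_smul]
  rw [integral_smul_fderiv_eq_neg_fderiv_smul_of_integrable]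
  · simp_rw [e]; rw [integral_smul]
  · simp_rw [e]; exact (integrable_phase_smul φ h0).smul _
  · exact integrable_phase_smul φ h1
  · exact integrable_phase_smul φ h0
  · exact fun x _ => (hasFDerivAt_phase φ x).differentiableAt
  · exact fun x _ => (hG.differentiable (by simp)) x

lemma contDiff_fderiv_apply {V : Type*} [NormedAddCommGroup V] [NormedSpace ℝ V]
    {E : Type*} [NormedAddCommGroup E] [NormedSpace ℝ E] {G : V → E}
    (hG : ContDiff ℝ ∞ G) (v : V) : ContDiff ℝ ∞ (fun y => fderiv ℝ G y v) :=
  (hG.fderiv_right (m := ∞) (by simp)).clm_apply contDiff_const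

lemma norm_iteratedFDeriv_fderiv_apply_le {V : Type*} [NormedAddCommGroup V] [NormedSpace ℝ V]
    {E : Type*} [NormedAddCommGroup E] [NormedSpace ℝ E] {G : V → E}
    (hG : ContDiff ℝ ∞ G) (v : V) (n : ℕ) (y : V) :
    ‖iteratedFDeriv ℝ n (fun y => fderiv ℝ G y v) y‖ ≤ ‖v‖ * ‖iteratedFDeriv ℝ (n + 1) G y‖ := by
  have := norm_iteratedFDeriv_clm_apply_const (𝕜 := ℝ) (f := fderiv ℝ G) (c := v) (x := y)
    (N := ∞) (n := n) ((hG.fderiv_right (m := ∞) (by simp)).contDiffAt) (by exact_mod_cast le_top)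
  rwa [norm_iteratedFDeriv_fderiv] at this

/-- One integration by parts in the direction `v` trades a factor `i φ(v)` for a derivative of the
amplitude. The induction is applied to `∂_v G`, so `G` has to vary. -/
lemma abs_pow_mul_norm_integral_phase_le (φ : V →L[ℝ] ℝ) (v : V) (n : ℕ) :
    ∀ G : V → E, ContDiff ℝ ∞ G → (∀ i ≤ n, Integrable (fun y => ‖iteratedFDeriv ℝ i G y‖)) →
    |φ v| ^ n * ‖∫ y, phase φ y • G y‖ ≤ ‖v‖ ^ n * ∫ y, ‖iteratedFDeriv ℝ n G y‖ := by
  induction n with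
  | zero =>
    intro G _ _
    simpa using norm_integral_phase_smul_le φ G
  | succ n ih =>
    intro G hG hi
    have hint : ∀ i ≤ n, Integrable
        (fun y => ‖iteratedFDeriv ℝ i (fun y => fderiv ℝ G y v) y‖) := fun i h => by
      refine ((hi (i + 1) (by omega)).const_mul ‖v‖).mono'
        (((contDiff_fderiv_apply hG v).continuous_iteratedFDeriv
          (by exact_mod_cast le_top)).norm.aestronglyMeasurable) ?_
      refine Eventually.of_forall fun y => ?_
      simpa using norm_iteratedFDeriv_fderiv_apply_le hG v i y
    have h0 : Integrable G :=
      (integrable_norm_iff hG.continuous.aestronglyMeasurable).1 (by simpa using hi 0 (by omega))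
    have h1 : Integrable (fun y => fderiv ℝ G y v) :=
      (integrable_norm_iff (contDiff_fderiv_apply hG v).continuous.aestronglyMeasurable).1
        (by simpa using hint 0 (by omega))
    have key := ih _ (contDiff_fderiv_apply hG v) hint
    rw [integral_phase_smul_fderiv φ hG h0 v h1, norm_neg, norm_smul] at key
    have e : ‖Complex.I * (φ v : ℂ)‖ = |φ v| := by simp
    rw [e] at key
    calc |φ v| ^ (n + 1) * ‖∫ y, phase φ y • G y‖
        = |φ v| ^ n * (|φ v| * ‖∫ y, phase φ y • G y‖) := by ring
      _ ≤ _ := key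
      _ ≤ ‖v‖ ^ n * ∫ y, ‖v‖ * ‖iteratedFDeriv ℝ (n + 1) G y‖ := by
          gcongr
          · exact hint n le_rfl
          · exact (hi (n + 1) le_rfl).const_mul _
          · exact fun y => norm_iteratedFDeriv_fderiv_apply_le hG v n y
      _ = _ := by rw [integral_const_mul]; ring

/-- The `n`-fold integration by parts is useless where `φ(v)` is small, so it is combined with the
trivial bound by means of `(1 + |φ v|)^n ≤ 2^n (1 + |φ v|^n)`. -/
lemma pow_mul_norm_integral_phase_le (φ : V →L[ℝ] ℝ) {v : V} (hv : ‖v‖ ≤ 1) {t : ℝ} (ht0 : 0 ≤ t)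
    (ht : t ≤ 1 + |φ v|) (n : ℕ) {G : V → E} (hG : ContDiff ℝ ∞ G)
    (hi : ∀ i ≤ n, Integrable (fun y => ‖iteratedFDeriv ℝ i G y‖)) :
    t ^ n * ‖∫ y, phase φ y • G y‖ ≤
      2 ^ n * ((∫ y, ‖G y‖) + ∫ y, ‖iteratedFDeriv ℝ n G y‖) := by
  have h1 := abs_pow_mul_norm_integral_phase_le φ v n G hG hi
  have h2 := norm_integral_phase_smul_le φ G
  have h3 : t ^ n ≤ 2 ^ n * (1 + |φ v| ^ n) := by
    calc t ^ n ≤ (1 + |φ v|) ^ n := by gcongr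
      _ ≤ 2 ^ (n - 1) * (1 ^ n + |φ v| ^ n) := add_pow_le zero_le_one (abs_nonneg _) n
      _ ≤ _ := by
        rw [one_pow]; gcongr
        · norm_num
        · omega
  have h4 : ‖v‖ ^ n * ∫ y, ‖iteratedFDeriv ℝ n G y‖ ≤ ∫ y, ‖iteratedFDeriv ℝ n G y‖ :=
    mul_le_of_le_one_left (integral_nonneg fun _ => norm_nonneg _) (pow_le_one₀ (norm_nonneg _) hv)
  calc _ ≤ 2 ^ n * (1 + |φ v| ^ n) * ‖∫ y, phase φ y • G y‖ := by gcongr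
    _ = 2 ^ n * (‖∫ y, phase φ y • G y‖ + |φ v| ^ n * ‖∫ y, phase φ y • G y‖) := by ring
    _ ≤ _ := by gcongr; exact h1.trans h4

end OscillatoryIntegral

/-! ### Oscillatory series -/

section OscillatorySeries

/-- A family of linear phases indexed by `K` whose size is measured by `ν`. -/
structure PhaseFamily {V K : Type*} [NormedAddCommGroup V] [NormedSpace ℝ V]
    (φ : K → V →L[ℝ] ℝ) (ν : K → ℝ) : Prop where
  countable : Countable K
  one_le : ∀ k, 1 ≤ ν k
  exists_dir : ∀ k, ∃ v : V, ‖v‖ ≤ 1 ∧ ν k ≤ 1 + |φ k v|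
  summable : Summable fun k => (ν k ^ 8)⁻¹

/-- Amplitudes whose derivatives grow at most like `B ν^q` on the support of the cutoff. -/
structure OscBounded {V K E : Type*} [NormedAddCommGroup V] [NormedSpace ℝ V]
    [NormedAddCommGroup E] [NormedSpace ℝ E] (g : V → ℂ) (ν : K → ℝ) (q : ℕ) (B : ℝ)
    (f : K → V → E) : Prop where
  smooth : ∀ k, ContDiff ℝ ∞ (f k)
  bound : ∀ k, ∀ n ≤ q + 8, ∀ y ∈ tsupport g, ‖iteratedFDeriv ℝ n (f k) y‖ ≤ B * ν k ^ q

variable {V : Type*} [NormedAddCommGroup V] [NormedSpace ℝ V] {K : Type*}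
  {E : Type*} [NormedAddCommGroup E] [NormedSpace ℝ E] [NormedSpace ℂ E] [IsScalarTower ℝ ℂ E]

/-- The term `∫ e^{iφ} g f` of an oscillatory series. -/
noncomputable def oscTerm [MeasureSpace V] (φ : V →L[ℝ] ℝ) (g : V → ℂ) (f : V → E) : E :=
  ∫ y, phase φ y • (g y • f y)

/-- The oscillatory series `∑_k ∫ e^{iφ_k} g f_k`. -/
noncomputable def oscSum [MeasureSpace V] (φ : K → V →L[ℝ] ℝ) (g : V → ℂ) (f : K → V → E) : E :=
  ∑' k, oscTerm (φ k) g (f k)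

/-- The Leibniz majorant of the `n`-th derivative of a product with `g`. -/
noncomputable def leibnizNorm (g : V → ℂ) (n : ℕ) (y : V) : ℝ :=
  ∑ i ∈ Finset.range (n + 1), (n.choose i : ℝ) * ‖iteratedFDeriv ℝ i g y‖

lemma leibnizNorm_zero (g : V → ℂ) (y : V) : leibnizNorm g 0 y = ‖g y‖ := by
  simp [leibnizNorm]

lemma norm_iteratedFDeriv_smul_le_leibnizNorm {g : V → ℂ} (hg : ContDiff ℝ ∞ g) {f : V → E}
    (hf : ContDiff ℝ ∞ f) {B : ℝ} {N : ℕ}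
    (h : ∀ n ≤ N, ∀ y ∈ tsupport g, ‖iteratedFDeriv ℝ n f y‖ ≤ B) {n : ℕ} (hn : n ≤ N) (y : V) :
    ‖iteratedFDeriv ℝ n (fun y => g y • f y) y‖ ≤ B * leibnizNorm g n y := by
  refine (norm_iteratedFDeriv_smul_le hg hf y (n := n) (by exact_mod_cast le_top)).trans ?_
  rw [leibnizNorm, Finset.mul_sum]
  refine Finset.sum_le_sum fun i hi => ?_
  by_cases hy : y ∈ tsupport g
  · have := h (n - i) (by omega) y hy
    calc _ ≤ (n.choose i : ℝ) * ‖iteratedFDeriv ℝ i g y‖ * B := by gcongr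
      _ = _ := by ring
  · have : iteratedFDeriv ℝ i g y = 0 :=
      image_eq_zero_of_notMem_tsupport fun h => hy (tsupport_iteratedFDeriv_subset i h)
    simp [this]

variable [FiniteDimensional ℝ V] [MeasureSpace V] [BorelSpace V]
  [(volume : Measure V).IsAddHaarMeasure]

lemma integrable_norm_cutoff {g : V → ℂ} (hg : ContDiff ℝ ∞ g) (hc : HasCompactSupport g) :
    Integrable fun y => ‖g y‖ :=
  (hg.continuous.integrable_of_hasCompactSupport hc).norm

lemma integrable_leibnizNorm {g : V → ℂ} (hg : ContDiff ℝ ∞ g) (hc : HasCompactSupport g) (n : ℕ) :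
    Integrable (leibnizNorm g n) := by
  refine integrable_finsetSum _ fun i _ => Integrable.const_mul ?_ _
  exact ((hg.continuous_iteratedFDeriv (by exact_mod_cast le_top)).norm).integrable_of_hasCompactSupport
    (hc.iteratedFDeriv i).norm

/-- The constant in the bound of the terms of an oscillatory series. -/
noncomputable def oscConst (g : V → ℂ) (q : ℕ) : ℝ :=
  2 ^ (q + 8) * ((∫ y, ‖g y‖) + ∫ y, leibnizNorm g (q + 8) y)

variable {φ : K → V →L[ℝ] ℝ} {ν : K → ℝ} {g : V → ℂ} {q : ℕ} {B : ℝ}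

/-- Of the `q + 8` integrations by parts, `q` pay for the growth of the amplitude and `8` give a
summable majorant. The bound is linear in `B` and depends on the amplitudes through `B` only; all
later uniformity comes from this. -/
theorem norm_oscTerm_le (hφ : PhaseFamily φ ν) (hg : ContDiff ℝ ∞ g) (hc : HasCompactSupport g)
    {f : K → V → E} (hf : OscBounded g ν q B f) (k : K) :
    ‖oscTerm (φ k) g (f k)‖ ≤ oscConst g q * B * (ν k ^ 8)⁻¹ := by
  obtain ⟨v, hv, hk⟩ := hφ.exists_dir k
  have hν : 0 < ν k := zero_lt_one.trans_le (hφ.one_le k)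
  have hG : ContDiff ℝ ∞ (fun y => g y • f k y) := hg.smul (hf.smooth k)
  have hle : ∀ n ≤ q + 8, ∀ y, ‖iteratedFDeriv ℝ n (fun y => g y • f k y) y‖ ≤
      B * ν k ^ q * leibnizNorm g n y := fun n hn y =>
    norm_iteratedFDeriv_smul_le_leibnizNorm hg (hf.smooth k) (hf.bound k) hn y
  have hint : ∀ i ≤ q + 8, Integrable (fun y => ‖iteratedFDeriv ℝ i (fun y => g y • f k y) y‖) := by
    intro i hi
    refine ((integrable_leibnizNorm hg hc i).const_mul (B * ν k ^ q)).mono'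
      (hG.continuous_iteratedFDeriv (by exact_mod_cast le_top)).norm.aestronglyMeasurable ?_
    exact Eventually.of_forall fun y => by simpa using hle i hi y
  have key := pow_mul_norm_integral_phase_le (φ k) hv hν.le hk (q + 8) hG hint
  have b0 : ∫ y, ‖g y • f k y‖ ≤ B * ν k ^ q * ∫ y, ‖g y‖ := by
    rw [← integral_const_mul]
    refine integral_mono (by simpa using hint 0 (by omega))
      ((integrable_norm_cutoff hg hc).const_mul _) fun y => ?_
    simpa [leibnizNorm_zero] using hle 0 (by omega) y
  have b1 : ∫ y, ‖iteratedFDeriv ℝ (q + 8) (fun y => g y • f k y) y‖ ≤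
      B * ν k ^ q * ∫ y, leibnizNorm g (q + 8) y := by
    rw [← integral_const_mul]
    exact integral_mono (hint _ le_rfl) ((integrable_leibnizNorm hg hc _).const_mul _)
      fun y => hle _ le_rfl y
  have h3 : ν k ^ q * (ν k ^ 8 * ‖oscTerm (φ k) g (f k)‖) ≤ ν k ^ q * (oscConst g q * B) := by
    calc _ = ν k ^ (q + 8) * ‖oscTerm (φ k) g (f k)‖ := by ring
      _ ≤ _ := key
      _ ≤ 2 ^ (q + 8) * (B * ν k ^ q * (∫ y, ‖g y‖) + B * ν k ^ q * ∫ y, leibnizNorm g (q + 8) y) := by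
        gcongr
      _ = _ := by rw [oscConst]; ring
  have h4 := le_of_mul_le_mul_left h3 (pow_pos hν q)
  rw [← div_eq_mul_inv, le_div_iff₀ (pow_pos hν 8)]
  linarith

lemma summable_oscTerm (hφ : PhaseFamily φ ν) (hg : ContDiff ℝ ∞ g) (hc : HasCompactSupport g)
    [CompleteSpace E] {f : K → V → E} (hf : OscBounded g ν q B f) :
    Summable fun k => oscTerm (φ k) g (f k) :=
  .of_norm_bounded (hφ.summable.mul_left _) (norm_oscTerm_le hφ hg hc hf)

theorem norm_oscSum_le (hφ : PhaseFamily φ ν) (hg : ContDiff ℝ ∞ g) (hc : HasCompactSupport g)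
    {f : K → V → E} (hf : OscBounded g ν q B f) :
    ‖oscSum φ g f‖ ≤ oscConst g q * B * ∑' k, (ν k ^ 8)⁻¹ := by
  rw [← tsum_mul_left]
  exact tsum_of_norm_bounded (hφ.summable.mul_left _).hasSum (norm_oscTerm_le hφ hg hc hf)

lemma aestronglyMeasurable_oscIntegrand (φ : V →L[ℝ] ℝ) (hg : Continuous g) {f : V → E}
    (hf : Continuous f) : AEStronglyMeasurable (fun y => phase φ y • (g y • f y)) volume :=
  ((continuous_phase φ).smul (hg.smul hf)).aestronglyMeasurable

lemma norm_oscIntegrand_le {f : K → V → E} (hf : OscBounded g ν q B f) (k : K) (y : V) :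
    ‖phase (φ k) y • (g y • f k y)‖ ≤ ‖g y‖ * (B * ν k ^ q) := by
  rw [norm_smul, norm_phase, one_mul, norm_smul]
  by_cases hy : y ∈ tsupport g
  · have := hf.bound k 0 (by omega) y hy
    rw [norm_iteratedFDeriv_zero] at this
    gcongr
  · simp [image_eq_zero_of_notMem_tsupport hy]

lemma integrable_oscIntegrand (hg : ContDiff ℝ ∞ g) (hc : HasCompactSupport g) (φ : V →L[ℝ] ℝ)
    {f : V → E} (hf : Continuous f) : Integrable (fun y => phase φ y • (g y • f y)) := by
  refine ((continuous_phase φ).smul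
    (hg.continuous.smul hf)).integrable_of_hasCompactSupport ?_
  exact (hc.smul_right (f' := f)).smul_left (f := phase φ)

/-- Dominated convergence is used twice, in `y` for a fixed term and then in `k`, with the common
constant `B` providing both majorants. No regularity of the limit amplitudes is needed. -/
theorem tendsto_oscSum (hφ : PhaseFamily φ ν) (hg : ContDiff ℝ ∞ g) (hc : HasCompactSupport g)
    [CompleteSpace E]
    {ι : Type*} {l : Filter ι} [l.IsCountablyGenerated] {f : ι → K → V → E} {f₀ : K → V → E}
    (hf : ∀ᶠ i in l, OscBounded g ν q B (f i))
    (hlim : ∀ k, ∀ y ∈ tsupport g, Tendsto (fun i => f i k y) l (𝓝 (f₀ k y))) :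
    Tendsto (fun i => oscSum φ g (f i)) l (𝓝 (oscSum φ g f₀)) := by
  refine tendsto_tsum_of_dominated_convergence (hφ.summable.mul_left (oscConst g q * B))
    (fun k => ?_) (hf.mono fun i hi k => norm_oscTerm_le hφ hg hc hi k)
  refine tendsto_integral_filter_of_dominated_convergence (fun y => ‖g y‖ * (B * ν k ^ q))
    (hf.mono fun i hi => aestronglyMeasurable_oscIntegrand _ hg.continuous (hi.smooth k).continuous)
    (hf.mono fun i hi => Eventually.of_forall fun y => norm_oscIntegrand_le hi k y)
    ((integrable_norm_cutoff hg hc).mul_const _) (Eventually.of_forall fun y => ?_)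
  by_cases hy : y ∈ tsupport g
  · exact ((hlim k y hy).const_smul _).const_smul _
  · simp only [image_eq_zero_of_notMem_tsupport hy, zero_smul, smul_zero]
    exact tendsto_const_nhds

/-- The bound on the differentiated amplitudes is uniform on a ball of parameters, which justifies
differentiating under each integral and then term by term. -/
theorem hasFDerivAt_oscSum (hφ : PhaseFamily φ ν) (hg : ContDiff ℝ ∞ g) (hc : HasCompactSupport g)
    [CompleteSpace E] {Z : Type*} [NormedAddCommGroup Z] [NormedSpace ℝ Z]
    {f : Z → K → V → E} {f' : Z → K → V → Z →L[ℝ] E} {B' : ℝ} {z₀ : Z} {r : ℝ} (hr : 0 < r)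
    (hf : ∀ z ∈ Metric.ball z₀ r, OscBounded g ν q B (f z))
    (hf' : ∀ z ∈ Metric.ball z₀ r, OscBounded g ν q B' (f' z))
    (hd : ∀ z ∈ Metric.ball z₀ r, ∀ k, ∀ y ∈ tsupport g,
      HasFDerivAt (fun z => f z k y) (f' z k y) z) :
    HasFDerivAt (fun z => oscSum φ g (f z)) (oscSum φ g (f' z₀)) z₀ := by
  have hz₀ : z₀ ∈ Metric.ball z₀ r := Metric.mem_ball_self hr
  refine hasFDerivAt_tsum_of_isPreconnected (f := fun k z => oscTerm (φ k) g (f z k))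
    (f' := fun k z => oscTerm (φ k) g (f' z k)) (hφ.summable.mul_left (oscConst g q * B'))
    Metric.isOpen_ball
    (convex_ball z₀ r).isPreconnected (fun k z hz => ?_)
    (fun k z hz => norm_oscTerm_le hφ hg hc (hf' z hz) k) hz₀
    (summable_oscTerm hφ hg hc (hf z₀ hz₀)) hz₀
  refine hasFDerivAt_integral_of_dominated_of_fderiv_le (Metric.isOpen_ball.mem_nhds hz)
    ?_ ?_ ?_ (Eventually.of_forall fun y w hw => norm_oscIntegrand_le (hf' w hw) k y)
    ((integrable_norm_cutoff hg hc).mul_const _) (Eventually.of_forall fun y w hw => ?_)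
  · filter_upwards [Metric.isOpen_ball.mem_nhds hz] with w hw
    exact aestronglyMeasurable_oscIntegrand _ hg.continuous ((hf w hw).smooth k).continuous
  · exact integrable_oscIntegrand hg hc _ ((hf z hz).smooth k).continuous
  · exact aestronglyMeasurable_oscIntegrand _ hg.continuous ((hf' z hz).smooth k).continuous
  · by_cases hy : y ∈ tsupport g
    · exact ((hd w hw k y hy).const_smul (g y)).const_smul (phase (φ k) y)
    · simpa [image_eq_zero_of_notMem_tsupport hy] using hasFDerivAt_const (0 : E) w

/-- Fubini inside each term, followed by the exchange of sum and integral. Both are justified by the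
integrability of the amplitude bound `b` in the parameter. -/
theorem integral_oscSum (hφ : PhaseFamily φ ν) (hg : ContDiff ℝ ∞ g) (hc : HasCompactSupport g)
    [CompleteSpace E] {Y : Type*} [MeasurableSpace Y] {μ : Measure Y} [SFinite μ]
    {f : Y → K → V → E} {b : Y → ℝ} (hb : Integrable b μ)
    (hf : ∀ s, OscBounded g ν q (b s) (f s))
    (hm : ∀ k, AEStronglyMeasurable (fun p : Y × V => f p.1 k p.2) (μ.prod volume)) :
    Integrable (fun s => oscSum φ g (f s)) μ ∧
      ∫ s, oscSum φ g (f s) ∂μ = oscSum φ g (fun k y => ∫ s, f s k y ∂μ) := by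
  have := hφ.countable
  have hI : ∀ k, Integrable (fun p : Y × V => phase (φ k) p.2 • (g p.2 • f p.1 k p.2))
      (μ.prod volume) := fun k => by
    refine (hb.mul_prod ((integrable_norm_cutoff hg hc).mul_const (ν k ^ q))).mono'
      (((continuous_phase (φ k)).aestronglyMeasurable.comp_snd).smul
        (hg.continuous.aestronglyMeasurable.comp_snd.smul (hm k))) ?_
    refine Eventually.of_forall fun p => ?_
    refine (norm_oscIntegrand_le (hf p.1) k p.2).trans_eq ?_
    ring
  have hterm : ∀ k, Integrable (fun s => oscTerm (φ k) g (f s k)) μ := fun k =>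
    (hI k).integral_prod_left
  have hsum : Summable fun k => ∫ s, ‖oscTerm (φ k) g (f s k)‖ ∂μ := by
    refine .of_nonneg_of_le (fun k => integral_nonneg fun _ => norm_nonneg _) (fun k => ?_)
      ((hφ.summable.mul_left (oscConst g q * ∫ s, b s ∂μ)))
    calc ∫ s, ‖oscTerm (φ k) g (f s k)‖ ∂μ ≤ ∫ s, oscConst g q * b s * (ν k ^ 8)⁻¹ ∂μ :=
          integral_mono (hterm k).norm ((hb.const_mul _).mul_const _)
            fun s => norm_oscTerm_le hφ hg hc (hf s) k
      _ = _ := by rw [integral_mul_const, integral_const_mul]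
  constructor
  · refine ((hb.const_mul (oscConst g q)).mul_const (∑' k, (ν k ^ 8)⁻¹)).mono' ?_
      (Eventually.of_forall fun s => norm_oscSum_le hφ hg hc (hf s))
    have hfin : ∀ t : Finset K, AEStronglyMeasurable
        (fun s => ∑ k ∈ t, oscTerm (φ k) g (f s k)) μ := fun t =>
      Finset.aestronglyMeasurable_fun_sum t fun k _ => (hterm k).aestronglyMeasurable
    exact aestronglyMeasurable_of_tendsto_ae atTop hfin (Eventually.of_forall fun s =>
      (summable_oscTerm hφ hg hc (hf s)).hasSum)
  · rw [oscSum, show (fun s => oscSum φ g (f s)) =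
      fun s => ∑' k, oscTerm (φ k) g (f s k) from rfl,
      ← integral_tsum_of_summable_integral_norm hterm hsum]
    refine tsum_congr fun k => ?_
    simp only [oscTerm]
    rw [integral_integral_swap (hI k)]
    refine integral_congr_ae (Eventually.of_forall fun y => ?_)
    simp only [integral_smul]

end OscillatorySeries

/-! ### Unfolding and Poisson summation -/

section Poisson

variable {d : Type*} [Fintype d]

/-- The half-open unit cube. -/
def iocCube (d : Type*) : Set (d → ℝ) := {x | ∀ i, x i ∈ Set.Ioc (0 : ℝ) (0 + 1)}

/-- The vector of `ℤᵈ ⊆ ℝᵈ` with coordinates `l`. -/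
def intVec (l : d → ℤ) : d → ℝ := fun i => l i

lemma intVec_add (l m : d → ℤ) : intVec (l + m) = intVec l + intVec m := by
  ext i; simp [intVec]

lemma iUnion_preimage_iocCube :
    ⋃ l : d → ℤ, (fun x => x + intVec l) ⁻¹' iocCube d = Set.univ := by
  -- The cube is `(0, 1]` in each coordinate, so the representative of `x` is `x + 1 - ⌈x⌉`.
  refine Set.eq_univ_of_forall fun x => Set.mem_iUnion.2 ⟨fun i => 1 - ⌈x i⌉, fun i => ?_⟩
  have h1 := Int.le_ceil (x i)
  have h2 := Int.ceil_lt_add_one (x i)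
  simp only [intVec, Pi.add_apply, Int.cast_sub, Int.cast_one, Set.mem_Ioc]
  constructor <;> linarith

lemma pairwise_disjoint_preimage_iocCube :
    Pairwise (Function.onFun Disjoint fun l : d → ℤ => (fun x => x + intVec l) ⁻¹' iocCube d) := by
  intro l m hlm
  refine Set.disjoint_left.2 fun x hx hy => hlm ?_
  ext i
  have h1 := hx i
  have h2 := hy i
  simp only [intVec, Pi.add_apply, Set.mem_Ioc] at h1 h2
  have h3 : (l i : ℝ) < m i + 1 := by linarith [h1.2, h2.1]
  have h4 : (m i : ℝ) < l i + 1 := by linarith [h2.2, h1.1]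
  have h5 : l i < m i + 1 := by exact_mod_cast h3
  have h6 : m i < l i + 1 := by exact_mod_cast h4
  omega

lemma measurableSet_iocCube : MeasurableSet (iocCube d) :=
  MeasurableSet.univ_pi' (fun _ => measurableSet_Ioc)

lemma setIntegral_preimage_add {E : Type*} [NormedAddCommGroup E] [NormedSpace ℝ E]
    (g : (d → ℝ) → E) (v : d → ℝ) :
    ∫ x in (fun x => x + v) ⁻¹' iocCube d, g x = ∫ x in iocCube d, g (x - v) := by
  have := (measurePreserving_add_right (volume : Measure (d → ℝ)) v).setIntegral_preimage_emb
    (measurableEmbedding_addRight v) (fun x => g (x - v)) (iocCube d)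
  simpa using this

lemma hasSum_setIntegral_iocCube {E : Type*} [NormedAddCommGroup E] [NormedSpace ℝ E]
    {f : (d → ℝ) → E} (hf : Integrable f) :
    HasSum (fun l : d → ℤ => ∫ x in iocCube d, f (x + intVec l)) (∫ x, f x) := by
  have h := hasSum_integral_iUnion (μ := volume) (f := f)
    (fun l : d → ℤ => (measurable_add_const (intVec l)) measurableSet_iocCube)
    pairwise_disjoint_preimage_iocCube hf.integrableOn
  rw [iUnion_preimage_iocCube, setIntegral_univ] at h
  simp_rw [setIntegral_preimage_add] at h
  -- The preimage of the cube under translation by `l` produces `f (x - l)`; the reindexing restores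
  -- the sign.
  have h' := (Equiv.neg (d → ℤ)).hasSum_iff.2 h
  refine h'.congr_fun fun l => ?_
  simp only [Function.comp, Equiv.neg_apply]
  refine integral_congr_ae (Eventually.of_forall fun x => ?_)
  simp only
  congr 1; ext i; simp [intVec]

theorem integral_eq_setIntegral_tsum {E : Type*} [NormedAddCommGroup E] [NormedSpace ℝ E]
    {g : (d → ℝ) → E} (hg : Integrable g) :
    ∫ x, g x = ∫ x in iocCube d, ∑' l : d → ℤ, g (x + intVec l) := by
  rw [← (hasSum_setIntegral_iocCube hg).tsum_eq]
  refine integral_tsum_of_summable_integral_norm (fun l => ?_)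
    (hasSum_setIntegral_iocCube hg.norm).summable
  exact ((measurePreserving_add_right (volume : Measure (d → ℝ))
    (intVec l)).integrable_comp_of_integrable hg).integrableOn

lemma mFourier_coe (n : d → ℤ) (x : d → ℝ) :
    UnitAddTorus.mFourier n (fun i => (x i : UnitAddCircle)) =
      Complex.exp (Complex.I * ((2 * Real.pi * ∑ i, (n i : ℝ) * x i : ℝ) : ℂ)) := by
  simp only [UnitAddTorus.mFourier, ContinuousMap.coe_mk, fourier_coe_apply]
  rw [← Complex.exp_sum]
  congr 1
  push_cast
  rw [Finset.mul_sum, Finset.mul_sum]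
  refine Finset.sum_congr rfl fun i _ => ?_
  ring

lemma finite_setOf_norm_intVec_le (R : ℝ) : {l : d → ℤ | ‖intVec l‖ ≤ R}.Finite := by
  classical
  refine (Set.finite_Icc (fun _ : d => -⌈R⌉) (fun _ => ⌈R⌉)).subset fun l hl => ?_
  have h : ∀ i, |(l i : ℝ)| ≤ R := fun i => (norm_le_pi_norm (intVec l) i).trans hl
  constructor <;> intro i
  · have := (neg_le_of_abs_le (h i)); have h2 := Int.le_ceil R
    have : (-⌈R⌉ : ℝ) ≤ l i := by linarith
    exact_mod_cast this
  · have := (le_of_abs_le (h i)); have h2 := Int.le_ceil R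
    have : (l i : ℝ) ≤ ⌈R⌉ := by linarith
    exact_mod_cast this

/-- A continuous periodic function descends to a continuous function on the torus, because the
projection is an open quotient map. With summable coefficients the Fourier series on the torus
converges pointwise. -/
theorem hasSum_fourier_of_periodic {f : (d → ℝ) → ℂ} (hf : Continuous f)
    (hp : ∀ (l : d → ℤ) x, f (x + intVec l) = f x) (c : (d → ℤ) → ℂ)
    (hc : ∀ n, c n = ∫ x in iocCube d,
      Complex.exp (-(Complex.I * ((2 * Real.pi * ∑ i, (n i : ℝ) * x i : ℝ) : ℂ))) * f x)
    (hs : Summable c) (x : d → ℝ) :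
    HasSum (fun n => c n * Complex.exp (Complex.I * ((2 * Real.pi * ∑ i, (n i : ℝ) * x i : ℝ) : ℂ)))
      (f x) := by
  let π : (d → ℝ) → UnitAddTorus d := fun x i => (x i : UnitAddCircle)
  have hq : IsOpenQuotientMap π :=
    IsOpenQuotientMap.piMap fun _ : d => QuotientAddGroup.isOpenQuotientMap_mk
  have hfib : ∀ x y, π x = π y → f x = f y := by
    intro x y hxy
    have h : ∀ i, ∃ n : ℤ, (y i : ℝ) + n = x i := fun i => by
      have h1 : ((x i : ℝ) : UnitAddCircle) = (y i : ℝ) := congrFun hxy i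
      obtain ⟨n, hn⟩ := AddSubgroup.mem_zmultiples_iff.1 (QuotientAddGroup.eq.1 h1.symm)
      exact ⟨n, by have : (n : ℝ) = -y i + x i := by simpa using hn
                   linarith⟩
    choose n hn using h
    rw [← hp n y]; congr 1; ext i; simp [intVec, hn]
  let F : UnitAddTorus d → ℂ := f ∘ Function.surjInv hq.surjective
  have hF : ∀ x, F (π x) = f x := fun x => hfib _ _ (Function.surjInv_eq hq.surjective (π x))
  have hFc : Continuous F := by
    rw [hq.isQuotientMap.continuous_iff]
    convert hf using 1
    exact funext hF
  have hcoef : ∀ n, UnitAddTorus.mFourierCoeff F n = c n := fun n => by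
    rw [UnitAddTorus.mFourierCoeff_eq_integral F n 0, hc]
    refine setIntegral_congr_fun measurableSet_iocCube fun x _ => ?_
    simp only [smul_eq_mul]
    rw [mFourier_coe, show F (fun i => (x i : UnitAddCircle)) = f x from hF x]
    congr 2
    simp only [Pi.neg_apply, Int.cast_neg, neg_mul, Finset.sum_neg_distrib, mul_neg,
      Complex.ofReal_neg]
  have h := UnitAddTorus.hasSum_mFourier_series_apply_of_summable (f := ⟨F, hFc⟩)
    (hs.congr fun n => (hcoef n).symm) (π x)
  have h2 : (fun n => UnitAddTorus.mFourierCoeff F n • UnitAddTorus.mFourier n (π x)) =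
      fun n => c n * Complex.exp (Complex.I * ((2 * Real.pi * ∑ i, (n i : ℝ) * x i : ℝ) : ℂ)) := by
    funext n; rw [hcoef, smul_eq_mul, mFourier_coe]
  rw [← hF x, ← h2]; exact h

/-- The periodization of `g` is locally a finite sum, hence continuous. Unfolding identifies its
Fourier coefficients with the Fourier integrals of `g`, and the formula is its Fourier series at the
origin. -/
theorem hasSum_poisson_pi {g : (d → ℝ) → ℂ} (hg : Continuous g) (hc : HasCompactSupport g)
    (hs : Summable fun n : d → ℤ =>
      ∫ x : d → ℝ, Complex.exp (Complex.I * ((2 * Real.pi * ∑ i, (n i : ℝ) * x i : ℝ) : ℂ)) * g x) :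
    HasSum (fun n : d → ℤ =>
      ∫ x : d → ℝ, Complex.exp (Complex.I * ((2 * Real.pi * ∑ i, (n i : ℝ) * x i : ℝ) : ℂ)) * g x)
      (∑' l : d → ℤ, g (intVec l)) := by
  obtain ⟨R, hR⟩ := hc.isCompact.isBounded.subset_closedBall 0
  have hzero : ∀ x, R < ‖x‖ → g x = 0 := fun x hx => by
    by_contra h
    exact absurd (hR (subset_tsupport g h)) (by simpa using hx)
  have hcont : Continuous fun x => ∑' l : d → ℤ, g (x + intVec l) := by
    rw [continuous_iff_continuousAt]
    intro x₀
    have hfin := finite_setOf_norm_intVec_le (d := d) (R + ‖x₀‖ + 1)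
    have : (fun x => ∑' l : d → ℤ, g (x + intVec l)) =ᶠ[𝓝 x₀]
        fun x => ∑ l ∈ hfin.toFinset, g (x + intVec l) := by
      filter_upwards [Metric.ball_mem_nhds x₀ one_pos] with x hx
      refine tsum_eq_sum fun l hl => hzero _ ?_
      simp only [Set.Finite.mem_toFinset, Set.mem_ofPred_eq, not_le] at hl
      have h1 : ‖x‖ ≤ ‖x₀‖ + 1 := by
        have := norm_le_norm_add_norm_sub' x x₀
        rw [mem_ball_iff_norm] at hx; linarith
      have h2 : ‖intVec l‖ ≤ ‖x + intVec l‖ + ‖x‖ := by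
        simpa using norm_sub_le (x + intVec l) x
      linarith
    refine ContinuousAt.congr ?_ this.symm
    exact (continuous_finsetSum _ fun l _ => hg.comp (continuous_id.add continuous_const)).continuousAt
  have hexp : ∀ (n l : d → ℤ) (x : d → ℝ),
      Complex.exp (-(Complex.I * ((2 * Real.pi * ∑ i, (n i : ℝ) * (x + intVec l) i : ℝ) : ℂ))) =
      Complex.exp (-(Complex.I * ((2 * Real.pi * ∑ i, (n i : ℝ) * x i : ℝ) : ℂ))) := by
    intro n l x
    rw [Complex.exp_eq_exp_iff_exists_int]
    refine ⟨-∑ i, n i * l i, ?_⟩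
    simp only [intVec, Pi.add_apply, mul_add, Finset.sum_add_distrib]
    push_cast
    ring
  have hneg : ∀ n : d → ℤ,
      (∫ x : d → ℝ, Complex.exp (-(Complex.I * ((2 * Real.pi * ∑ i, (n i : ℝ) * x i : ℝ) : ℂ))) * g x) =
      ∫ x : d → ℝ, Complex.exp (Complex.I * ((2 * Real.pi * ∑ i, ((-n) i : ℝ) * x i : ℝ) : ℂ)) * g x := by
    intro n
    refine integral_congr_ae (Eventually.of_forall fun x => ?_)
    simp
  have hs' := (Equiv.neg (d → ℤ)).summable_iff.2 hs
  have h := hasSum_fourier_of_periodic hcont (fun m x => ?_)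
    (fun n => ∫ x : d → ℝ, Complex.exp (-(Complex.I * ((2 * Real.pi * ∑ i, (n i : ℝ) * x i : ℝ) : ℂ))) * g x)
    (fun n => ?_) (hs'.congr fun n => (hneg n).symm) 0
  · simp only [zero_add, Pi.zero_apply, mul_zero, Finset.sum_const_zero, Complex.ofReal_zero,
      Complex.exp_zero, mul_one, hneg] at h
    exact (Equiv.neg (d → ℤ)).hasSum_iff.1 h
  · rw [← (Equiv.addLeft m).tsum_eq (fun l => g (x + intVec l))]
    refine tsum_congr fun l => ?_
    simp only [Equiv.coe_addLeft, intVec_add, add_assoc]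
  · have hi : Integrable fun x : d → ℝ => Complex.exp
        (-(Complex.I * ((2 * Real.pi * ∑ i, (n i : ℝ) * x i : ℝ) : ℂ))) * g x := by
      refine Continuous.integrable_of_hasCompactSupport (by fun_prop) ?_
      exact hc.mul_left
    rw [integral_eq_setIntegral_tsum hi]
    refine setIntegral_congr_fun measurableSet_iocCube fun x _ => ?_
    simp only [hexp, tsum_mul_left]

end Poisson

/-- A family of phases for which the Poisson summation formula holds with respect to the lattice
`lat`. -/
structure PoissonFamily {V K : Type*} [NormedAddCommGroup V] [NormedSpace ℝ V] [MeasureSpace V]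
    (φ : K → V →L[ℝ] ℝ) (lat : K → V) (ν : K → ℝ) : Prop extends PhaseFamily φ ν where
  finite : ∀ R, {l | ‖lat l‖ ≤ R}.Finite
  poisson : ∀ g : V → ℂ, ContDiff ℝ ∞ g → HasCompactSupport g →
    HasSum (fun k => ∫ y, phase (φ k) y * g y) (∑' l, g (lat l))

/-! ### Poisson summation in linear coordinates. -/

section Transport

variable {V K : Type*} [NormedAddCommGroup V] [NormedSpace ℝ V] [FiniteDimensional ℝ V]
  [MeasureSpace V] [BorelSpace V] [(volume : Measure V).IsAddHaarMeasure]

/-- Volume-preserving linear coordinates reduce the formula to `ℝᵈ`. The summability required there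
is the decay of oscillatory terms. -/
lemma PhaseFamily.poissonFamily {φ : K → V →L[ℝ] ℝ} {ν : K → ℝ} (hφ : PhaseFamily φ ν)
    {d : Type*} [Fintype d] (e : (d → ℝ) ≃L[ℝ] V) (he : MeasurePreserving e) (σ : K ≃ (d → ℤ))
    (hφe : ∀ k x, φ k (e x) = 2 * Real.pi * ∑ i, (σ k i : ℝ) * x i) :
    PoissonFamily φ (fun k => e (intVec (σ k))) ν where
  toPhaseFamily := hφ
  finite R := by
    have h := finite_setOf_norm_intVec_le (d := d) (‖(e.symm : V →L[ℝ] (d → ℝ))‖ * R)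
    refine (h.preimage σ.injective.injOn).subset fun k hk => ?_
    have h1 := (e.symm : V →L[ℝ] (d → ℝ)).le_opNorm (e (intVec (σ k)))
    simp only [ContinuousLinearEquiv.coe_coe, ContinuousLinearEquiv.symm_apply_apply] at h1
    exact h1.trans (mul_le_mul_of_nonneg_left hk (norm_nonneg _))
  poisson g hg hc := by
    have hphase : ∀ k x, phase (φ k) (e x) =
        Complex.exp (Complex.I * ((2 * Real.pi * ∑ i, (σ k i : ℝ) * x i : ℝ) : ℂ)) := fun k x => by
      rw [phase, hφe]
    have hemb : MeasurableEmbedding e := e.toHomeomorph.measurableEmbedding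
    have hint : ∀ k, ∫ y, phase (φ k) y * g y = ∫ x : d → ℝ,
        Complex.exp (Complex.I * ((2 * Real.pi * ∑ i, (σ k i : ℝ) * x i : ℝ) : ℂ)) * g (e x) := by
      intro k
      rw [← he.integral_comp hemb]
      simp only [hphase]
    have hs : Summable fun k => ∫ y, phase (φ k) y * g y := by
      -- The Fourier integrals of `g` are the oscillatory terms with cutoff `g` and constant
      -- amplitude `1`, which has growth exponent `0`.
      have hb : OscBounded g ν 0 1 (fun (_ : K) (_ : V) => (1 : ℂ)) :=
        ⟨fun _ => contDiff_const, fun k n _ y _ => by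
          rcases n with _ | n
          · simp
          · rw [iteratedFDeriv_const_of_ne (by omega)]; simp⟩
      have := summable_oscTerm hφ hg hc hb
      simpa [oscTerm] using this
    have hgc : Continuous fun x => g (e x) := hg.continuous.comp e.continuous
    have hcc : HasCompactSupport fun x => g (e x) := hc.comp_homeomorph e.toHomeomorph
    have h := hasSum_poisson_pi hgc hcc (σ.summable_iff.1 (by
      refine hs.congr fun k => ?_
      rw [hint k]; rfl))
    have h2 := σ.hasSum_iff.2 h
    rw [← σ.tsum_eq] at h2
    exact h2.congr_fun hint

end Transport

section Shift

variable {V K : Type*} [NormedAddCommGroup V] [NormedSpace ℝ V]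
  [MeasureSpace V] [BorelSpace V] [(volume : Measure V).IsAddHaarMeasure]

lemma PoissonFamily.hasSum_sub {φ : K → V →L[ℝ] ℝ} {lat : K → V} {ν : K → ℝ}
    (hφ : PoissonFamily φ lat ν) {g : V → ℂ} (hg : ContDiff ℝ ∞ g) (hc : HasCompactSupport g)
    (v : V) :
    HasSum (fun k => ∫ y, phase (φ k) (y - v) * g y) (∑' l, g (lat l + v)) := by
  have h := hφ.poisson (fun y => g (y + v)) (hg.comp (contDiff_id.add contDiff_const))
    (hc.comp_homeomorph (Homeomorph.addRight v))
  refine h.congr_fun fun k => ?_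
  rw [← integral_add_right_eq_self (μ := volume) (fun y => phase (φ k) (y - v) * g y) v]
  simp

end Shift

/-! ### The lattices of the plane and of its square -/

/-- The pairing `y ↦ 2πk · y`. -/
noncomputable def freqPhase (k : Fin 2 → ℤ) : Plane →L[ℝ] ℝ := innerSL ℝ (freq k)

/-- The pairing `(y, y') ↦ 2πk · y + 2πk' · y'`. -/
noncomputable def freqPhase₂ (k : (Fin 2 → ℤ) × (Fin 2 → ℤ)) : Plane × Plane →L[ℝ] ℝ :=
  (freqPhase k.1).coprod (freqPhase k.2)

/-- The lattice `ℤ² × ℤ²`. -/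
noncomputable def latticeVec₂ (k : (Fin 2 → ℤ) × (Fin 2 → ℤ)) : Plane × Plane :=
  (latticeVec k.1, latticeVec k.2)

lemma inner_eq (x y : Plane) : inner ℝ x y = x 0 * y 0 + x 1 * y 1 := by
  simp [PiLp.inner_apply, Fin.sum_univ_two]; ring

@[simp] lemma latticeVec_zero_coord (k : Fin 2 → ℤ) : latticeVec k 0 = k 0 := rfl
@[simp] lemma latticeVec_one_coord (k : Fin 2 → ℤ) : latticeVec k 1 = k 1 := rfl

@[simp] lemma freq_apply (k : Fin 2 → ℤ) (i : Fin 2) : freq k i = 2 * Real.pi * k i := by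
  fin_cases i <;> simp [freq, latticeVec]

lemma freqPhase_apply (k : Fin 2 → ℤ) (y : Plane) : freqPhase k y = inner ℝ (freq k) y := rfl

lemma freqPhase_eq (k : Fin 2 → ℤ) (y : Plane) :
    freqPhase k y = 2 * Real.pi * (k 0 * y 0 + k 1 * y 1) := by
  rw [freqPhase_apply, inner_eq, freq_apply, freq_apply]; ring

lemma freqPhase₂_apply (k : (Fin 2 → ℤ) × (Fin 2 → ℤ)) (p : Plane × Plane) :
    freqPhase₂ k p = freqPhase k.1 p.1 + freqPhase k.2 p.2 := rfl

lemma norm_basisVec (j : Fin 2) : ‖basisVec j‖ = 1 := by simp [basisVec]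

lemma freqPhase_basisVec (k : Fin 2 → ℤ) (j : Fin 2) :
    freqPhase k (basisVec j) = 2 * Real.pi * k j := by
  rw [freqPhase_eq]; fin_cases j <;> simp [basisVec]

/-- The basis direction of a largest coordinate of `k` works, since `2π ≥ 1`. -/
lemma exists_norm_le_abs_freqPhase (k : Fin 2 → ℤ) :
    ∃ v : Plane, ‖v‖ ≤ 1 ∧ ‖k‖ ≤ |freqPhase k v| := by
  obtain ⟨i, hi⟩ : ∃ i, ‖k‖ ≤ ‖k i‖ := by
    by_contra! h
    exact lt_irrefl _ ((pi_norm_lt_iff (lt_of_le_of_lt (norm_nonneg _) (h 0))).2 h)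
  refine ⟨basisVec i, (norm_basisVec i).le, hi.trans ?_⟩
  rw [freqPhase_basisVec, abs_mul, abs_of_pos Real.two_pi_pos, Int.norm_eq_abs]
  exact le_mul_of_one_le_left (abs_nonneg _) (by linarith [Real.pi_gt_three])

lemma summable_one_add_abs_int : Summable fun n : ℤ => ((1 + |(n : ℝ)|) ^ 2)⁻¹ := by
  have h : Summable fun n : ℕ => ((1 + (n : ℝ)) ^ 2)⁻¹ := by
    have := (summable_nat_add_iff 1).2 (Real.summable_nat_pow_inv (p := 2).2 one_lt_two)
    simpa [add_comm] using this
  refine Summable.of_nat_of_neg ?_ ?_ <;> simpa using h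

lemma summable_one_add_norm_pow_four : Summable fun k : Fin 2 → ℤ => ((1 + ‖k‖) ^ 4)⁻¹ := by
  have h := (summable_one_add_abs_int.mul_of_nonneg summable_one_add_abs_int
    (fun _ => by positivity) (fun _ => by positivity))
  have h2 := (finTwoArrowEquiv ℤ).summable_iff.2 h
  refine h2.of_nonneg_of_le (fun _ => by positivity) fun k => ?_
  simp only [Function.comp, finTwoArrowEquiv_apply]
  rw [← mul_inv]
  have h0 := norm_le_pi_norm k 0
  have h1 := norm_le_pi_norm k 1
  rw [Int.norm_eq_abs] at h0 h1
  gcongr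
  calc (1 + |(k 0 : ℝ)|) ^ 2 * (1 + |(k 1 : ℝ)|) ^ 2 ≤ (1 + ‖k‖) ^ 2 * (1 + ‖k‖) ^ 2 := by gcongr
    _ = _ := by ring

/-- The size `1 + |k|` of a lattice point. -/
noncomputable def latSize {K : Type*} [Norm K] (k : K) : ℝ := 1 + ‖k‖

lemma phaseFamily_freqPhase : PhaseFamily freqPhase latSize where
  countable := inferInstance
  one_le k := by simp [latSize]
  exists_dir k := by
    obtain ⟨v, hv, h⟩ := exists_norm_le_abs_freqPhase k
    exact ⟨v, hv, by simpa [latSize] using h⟩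
  summable := by
    refine summable_one_add_norm_pow_four.of_nonneg_of_le (fun _ => by simp [latSize]; positivity)
      fun k => ?_
    rw [latSize]
    gcongr
    · simp
    · norm_num

lemma phaseFamily_freqPhase₂ : PhaseFamily freqPhase₂ latSize where
  countable := inferInstance
  one_le k := by simp [latSize]
  exists_dir k := by
    rcases le_total ‖k.1‖ ‖k.2‖ with hle | hle
    · obtain ⟨v, hv, h⟩ := exists_norm_le_abs_freqPhase k.2
      refine ⟨(0, v), by simpa [Prod.norm_def] using hv, ?_⟩
      simpa [latSize, Prod.norm_def, freqPhase₂_apply, hle] using h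
    · obtain ⟨v, hv, h⟩ := exists_norm_le_abs_freqPhase k.1
      refine ⟨(v, 0), by simpa [Prod.norm_def] using hv, ?_⟩
      simpa [latSize, Prod.norm_def, freqPhase₂_apply, hle] using h
  summable := by
    -- Four powers for each copy of `ℤ²`; their product is dominated by the eighth power of the size
    -- of the pair. This is the origin of the exponent `8` in `PhaseFamily`.
    have h := (summable_one_add_norm_pow_four.mul_of_nonneg summable_one_add_norm_pow_four
      (fun _ => by positivity) (fun _ => by positivity))
    refine h.of_nonneg_of_le (fun _ => by simp [latSize]; positivity) fun k => ?_
    rw [← mul_inv, latSize]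
    have h0 : ‖k.1‖ ≤ ‖k‖ := le_max_left _ _
    have h1 : ‖k.2‖ ≤ ‖k‖ := le_max_right _ _
    gcongr
    calc _ ≤ (1 + ‖k‖) ^ 4 * (1 + ‖k‖) ^ 4 := by gcongr
      _ = _ := by ring

/-- Coordinates on the plane. -/
noncomputable def planeEquiv : (Fin 2 → ℝ) ≃L[ℝ] Plane := (EuclideanSpace.equiv (Fin 2) ℝ).symm

lemma planeEquiv_apply (x : Fin 2 → ℝ) (i : Fin 2) : planeEquiv x i = x i := rfl

lemma measurePreserving_planeEquiv : MeasurePreserving planeEquiv :=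
  PiLp.volume_preserving_toLp (Fin 2)

lemma latticeVec_eq (k : Fin 2 → ℤ) : latticeVec k = planeEquiv (intVec k) := by
  ext i; fin_cases i <;> rfl

lemma poissonFamily_freqPhase : PoissonFamily freqPhase latticeVec latSize := by
  have h := phaseFamily_freqPhase.poissonFamily planeEquiv measurePreserving_planeEquiv
    (Equiv.refl _) fun k x => by
      rw [freqPhase_eq, Fin.sum_univ_two]; rfl
  convert h using 2
  exact latticeVec_eq _

/-- Coordinates on the square of the plane. -/
noncomputable def planeEquiv₂ : (Fin 2 ⊕ Fin 2 → ℝ) ≃L[ℝ] Plane × Plane :=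
  (ContinuousLinearEquiv.sumPiEquivProdPi ℝ (Fin 2) (Fin 2) (fun _ => ℝ)).trans
    (planeEquiv.prodCongr planeEquiv)

lemma measurePreserving_planeEquiv₂ : MeasurePreserving planeEquiv₂ :=
  (measurePreserving_planeEquiv.prod measurePreserving_planeEquiv).comp
    (volume_measurePreserving_sumPiEquivProdPi (fun _ : Fin 2 ⊕ Fin 2 => ℝ))

instance isAddHaarMeasure_prod_plane : (volume : Measure (Plane × Plane)).IsAddHaarMeasure :=
  Measure.prod.instIsAddHaarMeasure (volume : Measure Plane) (volume : Measure Plane)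

lemma poissonFamily_freqPhase₂ : PoissonFamily freqPhase₂ latticeVec₂ latSize := by
  have h := phaseFamily_freqPhase₂.poissonFamily planeEquiv₂ measurePreserving_planeEquiv₂
    (Equiv.sumArrowEquivProdArrow (Fin 2) (Fin 2) ℤ).symm fun k x => by
      rw [freqPhase₂_apply, freqPhase_eq, freqPhase_eq, Fintype.sum_sum_type, Fin.sum_univ_two,
        Fin.sum_univ_two, ← mul_add]
      rfl
  convert h using 2 with k
  exact Prod.ext (latticeVec_eq _) (latticeVec_eq _)

/-! ### Lattice cutoffs -/

/-- A smooth function on the line, supported in `[-1, 1]`, whose integer translates add up to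
`1`. -/
noncomputable def stepBump (t : ℝ) : ℝ := Real.smoothTransition (t + 1) - Real.smoothTransition t

lemma contDiff_stepBump : ContDiff ℝ ∞ stepBump :=
  (Real.smoothTransition.contDiff.comp (contDiff_id.add contDiff_const)).sub
    Real.smoothTransition.contDiff

lemma stepBump_eq_zero {t : ℝ} (ht : 1 < |t|) : stepBump t = 0 := by
  rcases lt_abs.1 ht with h | h
  · rw [stepBump, Real.smoothTransition.one_of_one_le (by linarith),
      Real.smoothTransition.one_of_one_le h.le, sub_self]
  · rw [stepBump, Real.smoothTransition.zero_of_nonpos (by linarith),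
      Real.smoothTransition.zero_of_nonpos (by linarith), sub_self]

/-- The bump is a difference of consecutive translates of a smooth step, so the sum telescopes. Only
`⌊t⌋` and `⌊t⌋ + 1` can contribute. -/
lemma hasSum_stepBump (t : ℝ) : HasSum (fun n : ℤ => stepBump (t - n)) 1 := by
  have h0 := Int.floor_le t
  have h1 := Int.lt_floor_add_one t
  have hne : ⌊t⌋ ≠ ⌊t⌋ + 1 := by omega
  have h := hasSum_sum_of_ne_finset_zero (f := fun n : ℤ => stepBump (t - n))
    (s := {⌊t⌋, ⌊t⌋ + 1}) (L := .unconditional ℤ) fun n hn => by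
      simp only [Finset.mem_insert, Finset.mem_singleton, not_or] at hn
      by_cases hlt : n < ⌊t⌋
      · have : (n : ℝ) + 1 ≤ ⌊t⌋ := by exact_mod_cast hlt
        rw [stepBump, Real.smoothTransition.one_of_one_le (by linarith),
          Real.smoothTransition.one_of_one_le (by linarith), sub_self]
      · have h2 : ⌊t⌋ + 2 ≤ n := by omega
        have : (⌊t⌋ : ℝ) + 2 ≤ n := by exact_mod_cast h2
        rw [stepBump, Real.smoothTransition.zero_of_nonpos (by linarith),
          Real.smoothTransition.zero_of_nonpos (by linarith), sub_self]
  rw [Finset.sum_pair hne] at h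
  convert h using 1
  simp only [stepBump]
  push_cast
  rw [Real.smoothTransition.one_of_one_le (x := t - ⌊t⌋ + 1) (by linarith),
    Real.smoothTransition.zero_of_nonpos (x := t - (⌊t⌋ + 1)) (by linarith)]
  rw [show t - (⌊t⌋ + 1 : ℝ) + 1 = t - ⌊t⌋ by ring]
  ring

lemma contDiff_coord (i : Fin 2) : ContDiff ℝ ∞ fun x : Plane => x i :=
  (EuclideanSpace.proj i : Plane →L[ℝ] ℝ).contDiff

/-- A smooth compactly supported function on the plane whose translates by `ℤ²` add up to `1`. -/
noncomputable def planeCutoff (x : Plane) : ℝ := stepBump (x 0) * stepBump (x 1)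

lemma contDiff_planeCutoff : ContDiff ℝ ∞ planeCutoff :=
  (contDiff_stepBump.comp (contDiff_coord 0)).mul (contDiff_stepBump.comp (contDiff_coord 1))

lemma hasCompactSupport_planeCutoff : HasCompactSupport planeCutoff := by
  refine HasCompactSupport.intro (K := planeEquiv '' Set.Icc (fun _ => -1) fun _ => 1)
    (isCompact_Icc.image planeEquiv.continuous) fun x hx => ?_
  by_contra hne
  refine hx ⟨planeEquiv.symm x, ?_, planeEquiv.apply_symm_apply x⟩
  have h : ∀ i, |x i| ≤ 1 := by
    rw [Fin.forall_fin_two]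
    constructor <;> by_contra! hi
    · exact hne (by rw [planeCutoff, stepBump_eq_zero hi, zero_mul])
    · exact hne (by rw [planeCutoff, stepBump_eq_zero hi, mul_zero])
  exact ⟨fun i => (abs_le.1 (h i)).1, fun i => (abs_le.1 (h i)).2⟩

lemma HasSum.mul_prod {ι κ : Type*} {f : ι → ℝ} {g : κ → ℝ} {a b : ℝ} (hf : HasSum f a)
    (hg : HasSum g b) : HasSum (fun p : ι × κ => f p.1 * g p.2) (a * b) :=
  hf.mul hg (summable_mul_of_summable_norm hf.summable.norm hg.summable.norm)

lemma hasSum_planeCutoff (x : Plane) :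
    HasSum (fun k : Fin 2 → ℤ => planeCutoff (x - latticeVec k)) 1 := by
  have h2 := (finTwoArrowEquiv ℤ).hasSum_iff.2
    (HasSum.mul_prod (hasSum_stepBump (x 0)) (hasSum_stepBump (x 1)))
  rw [one_mul] at h2
  refine h2.congr_fun fun k => ?_
  simp [planeCutoff]

lemma latticeVec_neg (k : Fin 2 → ℤ) : latticeVec (-k) = -latticeVec k := by
  ext i; fin_cases i <;> simp [latticeVec]

lemma latticeVec_add (k l : Fin 2 → ℤ) : latticeVec (k + l) = latticeVec k + latticeVec l := by
  ext i; fin_cases i <;> simp [latticeVec]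

lemma hasSum_planeCutoff_add (x : Plane) :
    HasSum (fun k : Fin 2 → ℤ => planeCutoff (x + latticeVec k)) 1 := by
  refine ((Equiv.neg (Fin 2 → ℤ)).hasSum_iff.2 (hasSum_planeCutoff x)).congr_fun fun k => ?_
  simp [latticeVec_neg]

/-- The product cutoff on `ℝ² × ℝ²`. -/
noncomputable def pairCutoff (p : Plane × Plane) : ℝ := planeCutoff p.1 * planeCutoff p.2

lemma isLatticeCutoff_pairCutoff : IsLatticeCutoff pairCutoff := by
  refine ⟨(contDiff_planeCutoff.comp contDiff_fst).mul (contDiff_planeCutoff.comp contDiff_snd),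
    ?_, fun y y' => ?_⟩
  · refine HasCompactSupport.intro (K := tsupport planeCutoff ×ˢ tsupport planeCutoff)
      (hasCompactSupport_planeCutoff.isCompact.prod hasCompactSupport_planeCutoff.isCompact)
      fun p hp => ?_
    rw [Set.mem_prod, not_and_or] at hp
    rcases hp with h | h
    · rw [pairCutoff, image_eq_zero_of_notMem_tsupport h, zero_mul]
    · rw [pairCutoff, image_eq_zero_of_notMem_tsupport h, mul_zero]
  · have h := HasSum.mul_prod (hasSum_planeCutoff y) (hasSum_planeCutoff y')
    rw [one_mul] at h
    exact h

/-! ### Integrals over the unit cell -/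

/-- Unfolding the right-hand side gives the integral over the cube of `f` times the sum of the
translates of the cutoff, and that sum is `1`. -/
theorem setIntegral_unitCell {f : Plane → ℂ}
    (hp : ∀ (k : Fin 2 → ℤ) x, f (x + latticeVec k) = f x)
    (hi : Integrable fun x => (planeCutoff x : ℂ) * f x) :
    ∫ x in unitCell, f x = ∫ x, (planeCutoff x : ℂ) * f x := by
  have he := measurePreserving_planeEquiv
  have hemb : MeasurableEmbedding planeEquiv := planeEquiv.toHomeomorph.measurableEmbedding
  rw [← he.integral_comp hemb (fun x => (planeCutoff x : ℂ) * f x)]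
  have hi' : Integrable fun x => (planeCutoff (planeEquiv x) : ℂ) * f (planeEquiv x) :=
    (he.integrable_comp_emb hemb).2 hi
  rw [integral_eq_setIntegral_tsum hi', ← he.setIntegral_preimage_emb hemb]
  have hset : planeEquiv ⁻¹' unitCell = Set.Icc 0 1 := by
    ext x
    simp only [unitCell, Set.mem_preimage, Set.mem_ofPred_eq, planeEquiv_apply, Set.mem_Icc,
      Pi.le_def, Pi.zero_apply, Pi.one_apply, forall_and]
  have hcube : iocCube (Fin 2) = Set.pi Set.univ fun i => Set.Ioc ((0 : Fin 2 → ℝ) i)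
      ((1 : Fin 2 → ℝ) i) := by
    ext x; simp [iocCube, Set.mem_pi]
  -- The closed cell and the half-open cube of the unfolding differ by a null set.
  have hae : (Set.Icc 0 1 : Set (Fin 2 → ℝ)) =ᵐ[volume] iocCube (Fin 2) := by
    rw [hcube]; exact Measure.univ_pi_Ioc_ae_eq_Icc.symm
  rw [hset, setIntegral_congr_set hae]
  refine setIntegral_congr_fun measurableSet_iocCube fun x _ => ?_
  have hsum := hasSum_planeCutoff_add (planeEquiv x)
  have hper : ∀ l, f (planeEquiv (x + intVec l)) = f (planeEquiv x) := fun l => by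
    rw [map_add, ← latticeVec_eq, hp]
  have hc : ∑' l : Fin 2 → ℤ, (planeCutoff (planeEquiv (x + intVec l)) : ℂ) = 1 := by
    rw [← Complex.ofReal_one, ← hsum.tsum_eq, Complex.ofReal_tsum]
    simp only [map_add, latticeVec_eq]
  simp only [hper, tsum_mul_right, hc, one_mul]

/-! ### Independence of the cutoff -/

section Vanishing

variable {V K : Type*} [NormedAddCommGroup V] [NormedSpace ℝ V] [FiniteDimensional ℝ V]
  [MeasureSpace V] [BorelSpace V] [(volume : Measure V).IsAddHaarMeasure]

lemma exists_pos_norm_bound {V E : Type*} [NormedAddCommGroup V] [Zero E] {ρ : V → E}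
    (hc : HasCompactSupport ρ) : ∃ R, ∀ y, R < ‖y‖ → ρ y = 0 := by
  obtain ⟨R, hR⟩ := hc.isCompact.isBounded.subset_closedBall 0
  refine ⟨R, fun y hy => ?_⟩
  by_contra h
  exact absurd (hR (subset_tsupport ρ h)) (by simpa using hy)

/-- Translation by a lattice vector only permutes the `J k`, so the summed family acts as a periodic
distribution, which cannot detect a test function whose translates cancel. Concretely, the auxiliary
partition of unity `χ₀` is inserted, each translation is moved onto `ρ`, the series is reindexed,
and the translates of `ρ` are added up. Compact supports keep the sum over translations finite. -/
theorem tsum_integral_eq_zero {lat : K → V} (hfin : ∀ R, {l | ‖lat l‖ ≤ R}.Finite)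
    {χ₀ ρ : V → ℂ} (hχ : ContDiff ℝ ∞ χ₀) (hχc : HasCompactSupport χ₀)
    (hχ1 : ∀ y, HasSum (fun l => χ₀ (y - lat l)) 1)
    (hρ : ContDiff ℝ ∞ ρ) (hρc : HasCompactSupport ρ)
    (hρ0 : ∀ y, HasSum (fun l => ρ (y + lat l)) 0)
    {J : K → V → ℂ} (hJ : ∀ k, Continuous (J k))
    (hs : ∀ g : V → ℂ, ContDiff ℝ ∞ g → HasCompactSupport g →
      Summable fun k => ∫ y, g y * J k y)
    (σ : K → K ≃ K) (hσ : ∀ l k y, J k (y + lat l) = J (σ l k) y) :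
    ∑' k, ∫ y, ρ y * J k y = 0 := by
  obtain ⟨R₁, hR₁⟩ := exists_pos_norm_bound hχc
  obtain ⟨R₂, hR₂⟩ := exists_pos_norm_bound hρc
  have hzero : ∀ l y, R₁ + R₂ < ‖lat l‖ → ρ (y + lat l) * χ₀ y = 0 := fun l y hl => by
    by_cases h : R₁ < ‖y‖
    · rw [hR₁ y h, mul_zero]
    · rw [hR₂, zero_mul]
      have : ‖lat l‖ ≤ ‖y + lat l‖ + ‖y‖ := by simpa using norm_sub_le (y + lat l) y
      linarith
  set S := (hfin (R₁ + R₂)).toFinset with hS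
  have hS' : ∀ l, l ∉ S → R₁ + R₂ < ‖lat l‖ := fun l hl => by
    simpa [hS] using hl
  have hsm : ∀ l, ContDiff ℝ ∞ fun y => ρ (y + lat l) * χ₀ y := fun l =>
    (hρ.comp (contDiff_id.add contDiff_const)).mul hχ
  have hsc : ∀ l, HasCompactSupport fun y => ρ (y + lat l) * χ₀ y := fun l => hχc.mul_left
  have hint : ∀ l k, Integrable fun y => ρ (y + lat l) * χ₀ y * J k y := fun l k =>
    ((hsm l).continuous.mul (hJ k)).integrable_of_hasCompactSupport ((hsc l).mul_right)
  -- Insert `1 = ∑ χ₀(y - l)`, substitute `y + l` for `y`, and absorb the translation of `J k` into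
  -- the permutation `σ l`.
  have e1 : ∀ k, ∫ y, ρ y * J k y = ∑ l ∈ S, ∫ y, ρ (y + lat l) * χ₀ y * J (σ l k) y := by
    intro k
    have : ∀ l, ∫ y, ρ (y + lat l) * χ₀ y * J (σ l k) y = ∫ y, ρ y * χ₀ (y - lat l) * J k y := by
      intro l
      rw [← integral_add_right_eq_self (μ := volume)
        (fun y => ρ y * χ₀ (y - lat l) * J k y) (lat l)]
      simp [hσ]
    simp only [this]
    rw [← integral_finsetSum]
    · refine integral_congr_ae (Eventually.of_forall fun y => ?_)
      simp only
      rw [← Finset.sum_mul, ← Finset.mul_sum]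
      by_cases hy : ρ y = 0
      · simp [hy]
      · have h1 : ∑ l ∈ S, χ₀ (y - lat l) = 1 := by
          rw [← (hχ1 y).tsum_eq]
          refine (tsum_eq_sum fun l hl => ?_).symm
          have := hzero l (y - lat l) (hS' l hl)
          simpa [hy] using this
        rw [h1, mul_one]
    · intro l _
      refine ((hρ.continuous.mul (hχ.continuous.comp
        (continuous_id.sub continuous_const))).mul (hJ k)).integrable_of_hasCompactSupport ?_
      exact (hρc.mul_right).mul_right
  simp only [e1]
  rw [Summable.tsum_finsetSum (f := fun l k => ∫ y, ρ (y + lat l) * χ₀ y * J (σ l k) y) fun l _ =>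
    (σ l).summable_iff.2 (hs _ (hsm l) (hsc l))]
  have e2 : ∀ l, ∑' k, ∫ y, ρ (y + lat l) * χ₀ y * J (σ l k) y =
      ∑' k, ∫ y, ρ (y + lat l) * χ₀ y * J k y := fun l =>
    (σ l).tsum_eq fun k => ∫ y, ρ (y + lat l) * χ₀ y * J k y
  simp only [e2]
  rw [← Summable.tsum_finsetSum fun l _ => hs _ (hsm l) (hsc l)]
  have e3 : ∀ k, ∑ l ∈ S, ∫ y, ρ (y + lat l) * χ₀ y * J k y = 0 := fun k => by
    rw [← integral_finsetSum _ fun l _ => hint l k]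
    refine integral_eq_zero_of_ae (Eventually.of_forall fun y => ?_)
    simp only [Pi.zero_apply]
    rw [← Finset.sum_mul, ← Finset.sum_mul]
    by_cases hy : χ₀ y = 0
    · simp [hy]
    · have h1 : ∑ l ∈ S, ρ (y + lat l) = 0 := by
        rw [← (hρ0 y).tsum_eq]
        refine (tsum_eq_sum fun l hl => ?_).symm
        have := hzero l y (hS' l hl)
        simpa [hy] using this
      rw [h1, zero_mul, zero_mul]
  simp [e3]

/-- The sum of translates is locally finite, so it may be differentiated term by term, and the
derivative of a constant vanishes. This is what makes derivatives of lattice cutoffs invisible to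
periodic families. -/
lemma hasSum_fderiv_translates {lat : K → V} (hfin : ∀ R, {l | ‖lat l‖ ≤ R}.Finite)
    {χ : V → ℂ} (hχ : ContDiff ℝ ∞ χ) (hχc : HasCompactSupport χ) {c : ℂ}
    (hχ1 : ∀ y, HasSum (fun l => χ (y + lat l)) c) (v y : V) :
    HasSum (fun l => fderiv ℝ χ (y + lat l) v) 0 := by
  obtain ⟨R, hR⟩ := exists_pos_norm_bound hχc
  set S := (hfin (R + ‖y‖ + 1)).toFinset with hS
  have hnear : ∀ x ∈ Metric.ball y 1, ∀ l ∉ S, χ (x + lat l) = 0 := fun x hx l hl => by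
    refine hR _ ?_
    have hl' : R + ‖y‖ + 1 < ‖lat l‖ := by simpa [hS] using hl
    have h1 : ‖lat l‖ ≤ ‖x + lat l‖ + ‖x‖ := by simpa using norm_sub_le (x + lat l) x
    have h2 : ‖x‖ ≤ ‖y‖ + ‖x - y‖ := norm_le_norm_add_norm_sub' x y
    rw [mem_ball_iff_norm] at hx
    linarith
  have hd : ∀ l, HasFDerivAt (fun x => χ (x + lat l)) (fderiv ℝ χ (y + lat l)) y := fun l =>
    (hasFDerivAt_comp_add_right (lat l)).2 ((hχ.differentiable (by simp)) (y + lat l)).hasFDerivAt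
  have hball := Metric.ball_mem_nhds y one_pos
  have hsum : ∑ l ∈ S, fderiv ℝ χ (y + lat l) = 0 := by
    have h1 : HasFDerivAt (fun x => ∑ l ∈ S, χ (x + lat l)) (∑ l ∈ S, fderiv ℝ χ (y + lat l)) y :=
      HasFDerivAt.fun_sum fun l _ => hd l
    have h2 : HasFDerivAt (fun x => ∑ l ∈ S, χ (x + lat l)) (0 : V →L[ℝ] ℂ) y := by
      refine (hasFDerivAt_const c y).congr_of_eventuallyEq ?_
      filter_upwards [hball] with x hx
      rw [← (hχ1 x).tsum_eq, tsum_eq_sum (hnear x hx)]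
    exact h1.unique h2
  have h := hasSum_sum_of_ne_finset_zero (f := fun l => fderiv ℝ χ (y + lat l) v)
    (s := S) (L := .unconditional K) fun l hl => by
      have : HasFDerivAt (fun x => χ (x + lat l)) (0 : V →L[ℝ] ℂ) y := by
        refine (hasFDerivAt_const 0 y).congr_of_eventuallyEq ?_
        filter_upwards [hball] with x hx using hnear x hx l hl
      rw [(hd l).unique this]; rfl
  have e : ∑ l ∈ S, fderiv ℝ χ (y + lat l) v = 0 := by
    rw [← sum_apply, hsum]; rfl
  rwa [e] at h

end Vanishing

/-! ### Weighted bounds of all derivatives -/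

section SymbolBound

variable {P Q E E' : Type*} [NormedAddCommGroup P] [NormedSpace ℝ P]
  [NormedAddCommGroup Q] [NormedSpace ℝ Q]
  [NormedAddCommGroup E] [NormedSpace ℝ E] [NormedAddCommGroup E'] [NormedSpace ℝ E']

/-- The `n`-th derivative of `F` is bounded by `C n` times the weight `w`. -/
structure SymbolBound (w : P → ℝ) (C : ℕ → ℝ) (F : P → E) : Prop where
  smooth : ContDiff ℝ ∞ F
  bound : ∀ n p, ‖iteratedFDeriv ℝ n F p‖ ≤ C n * w p

/-- All derivatives of `F` are bounded by multiples of the weight `w`. -/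
def HasSymbolBound (w : P → ℝ) (F : P → E) : Prop := ∃ C, SymbolBound w C F

variable {w w' : P → ℝ} {C C' : ℕ → ℝ} {F : P → E}

lemma SymbolBound.norm_le (h : SymbolBound w C F) (p : P) : ‖F p‖ ≤ C 0 * w p := by
  simpa using h.bound 0 p

lemma SymbolBound.nonneg (h : SymbolBound w C F) (n : ℕ) (p : P) : 0 ≤ C n * w p :=
  (norm_nonneg _).trans (h.bound n p)

lemma SymbolBound.fderiv (h : SymbolBound w C F) :
    SymbolBound w (fun n => C (n + 1)) (fderiv ℝ F) where
  smooth := h.smooth.fderiv_right (by simp)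
  bound n p := by rw [norm_iteratedFDeriv_fderiv]; exact h.bound _ _

lemma SymbolBound.fderiv_apply (h : SymbolBound w C F) (v : P) :
    SymbolBound w (fun n => ‖v‖ * C (n + 1)) (fun p => _root_.fderiv ℝ F p v) where
  smooth := contDiff_fderiv_apply h.smooth v
  bound n p := (norm_iteratedFDeriv_fderiv_apply_le h.smooth v n p).trans
    ((mul_le_mul_of_nonneg_left (h.bound _ _) (norm_nonneg _)).trans_eq (mul_assoc _ _ _).symm)

lemma SymbolBound.comp_left (h : SymbolBound w C F) (L : E →L[ℝ] E') :
    SymbolBound w (fun n => ‖L‖ * C n) (fun p => L (F p)) where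
  smooth := L.contDiff.comp h.smooth
  bound n p := (L.norm_iteratedFDeriv_comp_left h.smooth.contDiffAt
    (by exact_mod_cast le_top)).trans
    ((mul_le_mul_of_nonneg_left (h.bound _ _) (norm_nonneg _)).trans_eq (mul_assoc _ _ _).symm)

lemma norm_iteratedFDeriv_comp_clm_le {F : P → E} (hF : ContDiff ℝ ∞ F) (L : Q →L[ℝ] P) (n : ℕ)
    (q : Q) : ‖iteratedFDeriv ℝ n (fun q => F (L q)) q‖ ≤
      ‖L‖ ^ n * ‖iteratedFDeriv ℝ n F (L q)‖ := by
  have := L.iteratedFDeriv_comp_right hF q (i := n) (by exact_mod_cast le_top)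
  rw [show (fun q => F (L q)) = F ∘ L from rfl, this]
  refine (ContinuousMultilinearMap.norm_compContinuousLinearMap_le _ _).trans_eq ?_
  simp [mul_comm]

lemma SymbolBound.comp_clm (h : SymbolBound w C F) (L : Q →L[ℝ] P) :
    SymbolBound (fun q => w (L q)) (fun n => ‖L‖ ^ n * C n) (fun q => F (L q)) where
  smooth := h.smooth.comp L.contDiff
  bound n q := (norm_iteratedFDeriv_comp_clm_le h.smooth L n q).trans
    ((mul_le_mul_of_nonneg_left (h.bound _ _) (by positivity)).trans_eq (mul_assoc _ _ _).symm)

lemma SymbolBound.comp_clm_of_norm_le_one (h : SymbolBound w C F) {L : Q →L[ℝ] P} (hL : ‖L‖ ≤ 1) :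
    SymbolBound (fun q => w (L q)) C (fun q => F (L q)) where
  smooth := h.smooth.comp L.contDiff
  bound n q := (norm_iteratedFDeriv_comp_clm_le h.smooth L n q).trans
    ((mul_le_of_le_one_left (norm_nonneg _) (pow_le_one₀ (norm_nonneg _) hL)).trans (h.bound _ _))

lemma SymbolBound.add {G : P → E} (h : SymbolBound w C F) (h' : SymbolBound w C' G) :
    SymbolBound w (fun n => C n + C' n) (fun p => F p + G p) where
  smooth := h.smooth.add h'.smooth
  bound n p := by
    rw [fun_iteratedFDeriv_add_apply (h.smooth.of_le (by exact_mod_cast le_top)).contDiffAt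
      (h'.smooth.of_le (by exact_mod_cast le_top)).contDiffAt, add_mul]
    exact (norm_add_le _ _).trans (add_le_add (h.bound _ _) (h'.bound _ _))

/-- The constants of a product. -/
noncomputable def leibnizConst (C C' : ℕ → ℝ) (n : ℕ) : ℝ :=
  ∑ i ∈ Finset.range (n + 1), (n.choose i : ℝ) * C i * C' (n - i)

lemma SymbolBound.mul {F G : P → ℂ} (h : SymbolBound w C F) (h' : SymbolBound w' C' G) :
    SymbolBound (fun p => w p * w' p) (leibnizConst C C') (fun p => F p * G p) where
  smooth := h.smooth.mul h'.smooth
  bound n p := by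
    refine (norm_iteratedFDeriv_mul_le h.smooth h'.smooth p (n := n)
      (by exact_mod_cast le_top)).trans ?_
    rw [leibnizConst, Finset.sum_mul]
    refine Finset.sum_le_sum fun i _ => ?_
    calc (n.choose i : ℝ) * ‖iteratedFDeriv ℝ i F p‖ * ‖iteratedFDeriv ℝ (n - i) G p‖
        ≤ (n.choose i : ℝ) * (C i * w p) * (C' (n - i) * w' p) := by
          gcongr
          · exact mul_nonneg (by positivity) (h.nonneg _ _)
          · exact h.bound _ _
          · exact h'.bound _ _
      _ = _ := by ring

lemma HasSymbolBound.smooth (h : HasSymbolBound w F) : ContDiff ℝ ∞ F := h.choose_spec.smooth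

lemma HasSymbolBound.add {G : P → E} (h : HasSymbolBound w F) (h' : HasSymbolBound w G) :
    HasSymbolBound w (fun p => F p + G p) :=
  ⟨_, h.choose_spec.add h'.choose_spec⟩

lemma HasSymbolBound.const_mul {F : P → ℂ} (h : HasSymbolBound w F) (c : ℂ) :
    HasSymbolBound w (fun p => c * F p) :=
  ⟨_, h.choose_spec.comp_left (ContinuousLinearMap.mul ℝ ℂ c)⟩

lemma HasSymbolBound.fderiv_apply (h : HasSymbolBound w F) (v : P) :
    HasSymbolBound w (fun p => fderiv ℝ F p v) := ⟨_, h.choose_spec.fderiv_apply v⟩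

lemma HasSymbolBound.exists_norm_le (h : HasSymbolBound w F) : ∃ C, ∀ p, ‖F p‖ ≤ C * w p :=
  ⟨_, h.choose_spec.norm_le⟩

end SymbolBound

/-! ### Directional derivatives -/

section DirDeriv

variable {P E : Type*} [NormedAddCommGroup P] [NormedSpace ℝ P]
  [NormedAddCommGroup E] [NormedSpace ℝ E]

/-- The derivative in a fixed direction. -/
noncomputable def dirDeriv (v : P) (F : P → E) : P → E := fun p => fderiv ℝ F p v

lemma contDiff_dirDeriv {F : P → E} (hF : ContDiff ℝ ∞ F) (v : P) : ContDiff ℝ ∞ (dirDeriv v F) :=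
  contDiff_fderiv_apply hF v

lemma contDiff_dirDeriv_iterate {F : P → E} (hF : ContDiff ℝ ∞ F) (v : P) (n : ℕ) :
    ContDiff ℝ ∞ ((dirDeriv v)^[n] F) := by
  induction n with
  | zero => exact hF
  | succ n ih => rw [Function.iterate_succ_apply']; exact contDiff_dirDeriv ih v

lemma dirDeriv_comm {F : P → E} (hF : ContDiff ℝ ∞ F) (v w : P) :
    dirDeriv v (dirDeriv w F) = dirDeriv w (dirDeriv v F) := by
  funext p
  have hd : DifferentiableAt ℝ (fderiv ℝ F) p :=
    ((hF.fderiv_right (m := ∞) (by simp)).differentiable (by simp)) p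
  have e : ∀ u u' : P, dirDeriv u (dirDeriv u' F) p = fderiv ℝ (fderiv ℝ F) p u u' := fun u u' => by
    show fderiv ℝ (fun y => fderiv ℝ F y u') p u = _
    rw [fderiv_clm_apply hd (differentiableAt_const u')]
    simp
  rw [e, e]
  exact (hF.contDiffAt.isSymmSndFDerivAt (by simp; exact WithTop.coe_le_coe.2 le_top)).eq v w

lemma dirDeriv_iterate_comm {F : P → E} (hF : ContDiff ℝ ∞ F) (v w : P) (n : ℕ) :
    (dirDeriv v)^[n] (dirDeriv w F) = dirDeriv w ((dirDeriv v)^[n] F) := by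
  induction n with
  | zero => rfl
  | succ n ih =>
    rw [Function.iterate_succ_apply', ih, dirDeriv_comm (contDiff_dirDeriv_iterate hF v n),
      ← Function.iterate_succ_apply' (dirDeriv v)]

lemma dirDeriv_add {F G : P → E} (hF : ContDiff ℝ ∞ F) (hG : ContDiff ℝ ∞ G) (v : P) :
    dirDeriv v (fun p => F p + G p) = fun p => dirDeriv v F p + dirDeriv v G p := by
  funext p
  simp only [dirDeriv]
  rw [fderiv_fun_add (hF.differentiable (by simp) p) (hG.differentiable (by simp) p)]; rfl

lemma dirDeriv_const_mul {F : P → ℂ} (hF : ContDiff ℝ ∞ F) (c : ℂ) (v : P) :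
    dirDeriv v (fun p => c * F p) = fun p => c * dirDeriv v F p := by
  funext p
  simp only [dirDeriv]
  rw [fderiv_const_mul (hF.differentiable (by simp) p)]; rfl

lemma dirDeriv_comp_clm {Q : Type*} [NormedAddCommGroup Q] [NormedSpace ℝ Q] {F : P → E}
    (hF : ContDiff ℝ ∞ F) (L : Q →L[ℝ] P) (v : Q) :
    dirDeriv v (fun q => F (L q)) = fun q => dirDeriv (L v) F (L q) := by
  funext q
  have h := (hF.differentiable (by simp) (L q)).hasFDerivAt.comp q L.hasFDerivAt
  simp only [dirDeriv]
  rw [show (fun q => F (L q)) = F ∘ L from rfl, h.fderiv]; rfl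

end DirDeriv

/-! ### The symbol classes -/

lemma dX_eq (j : Fin 2) : dX j = dirDeriv ((basisVec j, 0) : Phase) := rfl
lemma dXi_eq (j : Fin 2) : dXi j = dirDeriv ((0, basisVec j) : Phase) := rfl

lemma multiDeriv_dirDeriv {a : Phase → ℂ} (ha : ContDiff ℝ ∞ a) (α β : Fin 2 → ℕ) (v : Phase) :
    multiDeriv α β (dirDeriv v a) = dirDeriv v (multiDeriv α β a) := by
  simp only [multiDeriv, dX_eq, dXi_eq]
  have h1 := contDiff_dirDeriv_iterate ha ((0, basisVec 1) : Phase) (β 1)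
  have h2 := contDiff_dirDeriv_iterate h1 ((0, basisVec 0) : Phase) (β 0)
  have h3 := contDiff_dirDeriv_iterate h2 ((basisVec 1, 0) : Phase) (α 1)
  rw [dirDeriv_iterate_comm ha, dirDeriv_iterate_comm h1, dirDeriv_iterate_comm h2,
    dirDeriv_iterate_comm h3]

/-- `multiDeriv` fixes the order of the partial derivatives; symmetry of second derivatives moves
the additional one to its place. -/
lemma exists_multiDeriv_dX {a : Phase → ℂ} (ha : ContDiff ℝ ∞ a) (α β : Fin 2 → ℕ) (j : Fin 2) :
    ∃ α', multiDeriv α β (dX j a) = multiDeriv α' β a := by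
  have h1 := contDiff_dirDeriv_iterate ha ((0, basisVec 1) : Phase) (β 1)
  have h2 := contDiff_dirDeriv_iterate h1 ((0, basisVec 0) : Phase) (β 0)
  have h3 := contDiff_dirDeriv_iterate h2 ((basisVec 1, 0) : Phase) (α 1)
  rw [dX_eq, multiDeriv_dirDeriv ha]
  fin_cases j
  · refine ⟨![α 0 + 1, α 1], ?_⟩
    simp only [multiDeriv, dX_eq, dXi_eq, Matrix.cons_val_zero, Matrix.cons_val_one,
      Function.iterate_succ_apply']
    rfl
  · refine ⟨![α 0, α 1 + 1], ?_⟩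
    simp only [multiDeriv, dX_eq, dXi_eq, Matrix.cons_val_zero, Matrix.cons_val_one,
      Function.iterate_succ_apply']
    exact (dirDeriv_iterate_comm h3 _ _ _).symm

lemma exists_multiDeriv_dXi {a : Phase → ℂ} (ha : ContDiff ℝ ∞ a) (α β : Fin 2 → ℕ) (j : Fin 2) :
    ∃ β', multiDeriv α β (dXi j a) = multiDeriv α β' a := by
  have h1 := contDiff_dirDeriv_iterate ha ((0, basisVec 1) : Phase) (β 1)
  fin_cases j
  · refine ⟨![β 0 + 1, β 1], ?_⟩
    simp only [multiDeriv, dX_eq, dXi_eq, Matrix.cons_val_zero, Matrix.cons_val_one,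
      Function.iterate_succ_apply']
    rw [dirDeriv_iterate_comm ha, dirDeriv_iterate_comm h1]; rfl
  · refine ⟨![β 0, β 1 + 1], ?_⟩
    simp only [multiDeriv, dX_eq, dXi_eq, Matrix.cons_val_zero, Matrix.cons_val_one,
      Function.iterate_succ_apply']
    rw [dirDeriv_iterate_comm ha]; rfl

lemma plane_eq (v : Plane) : v = v 0 • basisVec 0 + v 1 • basisVec 1 := by
  ext i; fin_cases i <;> simp [basisVec]

/-- Evaluation of a coordinate of the plane. -/
noncomputable def coordCLM (j : Fin 2) : Plane →L[ℝ] ℝ := EuclideanSpace.proj j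

/-- The rank-one maps `c ↦ (v ↦ v_j c)` for the four coordinates of phase space. -/
noncomputable def coordSmulX (j : Fin 2) : ℂ →L[ℝ] Phase →L[ℝ] ℂ :=
  ContinuousLinearMap.smulRightL ℝ Phase ℂ ((coordCLM j).comp (ContinuousLinearMap.fst ℝ Plane Plane))

/-- The rank-one maps `c ↦ (v ↦ v_j c)` for the momentum coordinates of phase space. -/
noncomputable def coordSmulXi (j : Fin 2) : ℂ →L[ℝ] Phase →L[ℝ] ℂ :=
  ContinuousLinearMap.smulRightL ℝ Phase ℂ ((coordCLM j).comp (ContinuousLinearMap.snd ℝ Plane Plane))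

lemma fderiv_eq_sum (a : Phase → ℂ) : fderiv ℝ a = fun z =>
    coordSmulX 0 (dX 0 a z) + coordSmulX 1 (dX 1 a z) +
      (coordSmulXi 0 (dXi 0 a z) + coordSmulXi 1 (dXi 1 a z)) := by
  funext z
  refine ContinuousLinearMap.ext fun v => ?_
  have hv : v = v.1 0 • ((basisVec 0, 0) : Phase) + v.1 1 • ((basisVec 1, 0) : Phase) +
      (v.2 0 • ((0, basisVec 0) : Phase) + v.2 1 • ((0, basisVec 1) : Phase)) := by
    refine Prod.ext ?_ ?_
    · simpa using plane_eq v.1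
    · simpa using plane_eq v.2
  conv_lhs => rw [hv]
  simp only [map_add, map_smul]
  rfl

/-- Induction on the order for all `a` at once: the Fréchet derivative is a combination of the four
partial derivatives with constant rank-one maps, and each partial derivative satisfies the same
hypotheses. -/
lemma hasSymbolBound_of_multiDeriv {w : Phase → ℝ} {a : Phase → ℂ} (ha : ContDiff ℝ ∞ a)
    (h : ∀ α β : Fin 2 → ℕ, ∃ C, ∀ z, ‖multiDeriv α β a z‖ ≤ C * w z) : HasSymbolBound w a := by
  have key : ∀ n : ℕ, ∀ a : Phase → ℂ, ContDiff ℝ ∞ a →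
      (∀ α β : Fin 2 → ℕ, ∃ C, ∀ z, ‖multiDeriv α β a z‖ ≤ C * w z) →
      ∃ C, ∀ z, ‖iteratedFDeriv ℝ n a z‖ ≤ C * w z := by
    intro n
    induction n with
    | zero =>
      intro a _ h
      obtain ⟨C, hC⟩ := h 0 0
      exact ⟨C, fun z => by rw [norm_iteratedFDeriv_zero]; exact hC z⟩
    | succ n ih =>
      intro a ha h
      have step : ∀ (L : ℂ →L[ℝ] Phase →L[ℝ] ℂ) (b : Phase → ℂ), ContDiff ℝ ∞ b →
          (∀ α β : Fin 2 → ℕ, ∃ C, ∀ z, ‖multiDeriv α β b z‖ ≤ C * w z) →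
          ∃ C, ∀ z, ‖iteratedFDeriv ℝ n (fun z => L (b z)) z‖ ≤ C * w z := by
        intro L b hb hm
        obtain ⟨C, hC⟩ := ih b hb hm
        refine ⟨‖L‖ * C, fun z => (L.norm_iteratedFDeriv_comp_left hb.contDiffAt
          (by exact_mod_cast le_top)).trans ?_⟩
        rw [mul_assoc]
        exact mul_le_mul_of_nonneg_left (hC z) (norm_nonneg _)
      have hX : ∀ j, ∀ α β : Fin 2 → ℕ, ∃ C, ∀ z, ‖multiDeriv α β (dX j a) z‖ ≤ C * w z := by
        intro j α β
        obtain ⟨α', e⟩ := exists_multiDeriv_dX ha α β j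
        rw [e]; exact h _ _
      have hXi : ∀ j, ∀ α β : Fin 2 → ℕ, ∃ C, ∀ z, ‖multiDeriv α β (dXi j a) z‖ ≤ C * w z := by
        intro j α β
        obtain ⟨β', e⟩ := exists_multiDeriv_dXi ha α β j
        rw [e]; exact h _ _
      have sX : ∀ j, ContDiff ℝ ∞ (dX j a) := fun j => contDiff_dirDeriv ha _
      have sXi : ∀ j, ContDiff ℝ ∞ (dXi j a) := fun j => contDiff_dirDeriv ha _
      obtain ⟨C₀, h₀⟩ := step (coordSmulX 0) _ (sX 0) (hX 0)
      obtain ⟨C₁, h₁⟩ := step (coordSmulX 1) _ (sX 1) (hX 1)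
      obtain ⟨C₂, h₂⟩ := step (coordSmulXi 0) _ (sXi 0) (hXi 0)
      obtain ⟨C₃, h₃⟩ := step (coordSmulXi 1) _ (sXi 1) (hXi 1)
      refine ⟨C₀ + C₁ + (C₂ + C₃), fun z => ?_⟩
      have d : ∀ (L : ℂ →L[ℝ] Phase →L[ℝ] ℂ) {b : Phase → ℂ}, ContDiff ℝ ∞ b →
          ContDiff ℝ n (fun z => L (b z)) := fun L b hb =>
        (L.contDiff.comp hb).of_le (by exact_mod_cast le_top)
      rw [← norm_iteratedFDeriv_fderiv, fderiv_eq_sum,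
        fun_iteratedFDeriv_add_apply ((d _ (sX 0)).add (d _ (sX 1))).contDiffAt
          ((d _ (sXi 0)).add (d _ (sXi 1))).contDiffAt,
        fun_iteratedFDeriv_add_apply (d _ (sX 0)).contDiffAt (d _ (sX 1)).contDiffAt,
        fun_iteratedFDeriv_add_apply (d _ (sXi 0)).contDiffAt (d _ (sXi 1)).contDiffAt]
      refine (norm_add_le _ _).trans ((add_le_add (norm_add_le _ _) (norm_add_le _ _)).trans ?_)
      have := h₀ z; have := h₁ z; have := h₂ z; have := h₃ z
      linarith
  choose C hC using fun n => key n a ha h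
  exact ⟨C, ha, hC⟩

lemma HasSymbolBound.dirDeriv {P : Type*} [NormedAddCommGroup P] [NormedSpace ℝ P] {w : P → ℝ}
    {F : P → ℂ} (h : HasSymbolBound w F) (v : P) : HasSymbolBound w (dirDeriv v F) :=
  h.fderiv_apply v

lemma HasSymbolBound.dirDeriv_iterate {P : Type*} [NormedAddCommGroup P] [NormedSpace ℝ P]
    {w : P → ℝ} {F : P → ℂ} (h : HasSymbolBound w F) (v : P) (n : ℕ) :
    HasSymbolBound w ((MagneticWeyl.dirDeriv v)^[n] F) := by
  induction n with
  | zero => exact h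
  | succ n ih => rw [Function.iterate_succ_apply']; exact ih.dirDeriv v

/-- The weight `⟨ξ⟩^m`. -/
noncomputable def symbolWeight (m : ℝ) (z : Phase) : ℝ := japanese z.2 ^ m

lemma one_le_japanese (ξ : Plane) : 1 ≤ japanese ξ := by
  rw [japanese, Real.one_le_sqrt]; linarith [sq_nonneg ‖ξ‖]

lemma japanese_pos (ξ : Plane) : 0 < japanese ξ := zero_lt_one.trans_le (one_le_japanese ξ)

lemma symbolWeight_pos (m : ℝ) (z : Phase) : 0 < symbolWeight m z :=
  Real.rpow_pos_of_pos (japanese_pos _) _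

/-- Replaces the multi-index seminorms by bounds on iterated Fréchet derivatives, which behave well
under composition with linear maps and under products. -/
lemma mem_symbolClass_iff {m : ℝ} {a : Phase → ℂ} :
    a ∈ symbolClass m ↔ IsSmoothPeriodic a ∧ HasSymbolBound (symbolWeight m) a := by
  constructor
  · rintro ⟨h1, h2⟩
    refine ⟨h1, hasSymbolBound_of_multiDeriv h1.1 fun α β => ?_⟩
    obtain ⟨C, hC⟩ := h2 α β
    exact ⟨C, fun z => hC z.1 z.2⟩
  · rintro ⟨h1, h2⟩
    refine ⟨h1, fun α β => ?_⟩
    obtain ⟨C, hC⟩ := HasSymbolBound.exists_norm_le (((((h2.dirDeriv_iterate (0, basisVec 1)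
      (β 1)).dirDeriv_iterate (0, basisVec 0) (β 0)).dirDeriv_iterate (basisVec 1, 0)
      (α 1)).dirDeriv_iterate (basisVec 0, 0) (α 0)))
    exact ⟨C, fun x ξ => hC (x, ξ)⟩

lemma japanese_le (ξ : Plane) : japanese ξ ≤ 1 + ‖ξ‖ := by
  rw [japanese, Real.sqrt_le_left (by positivity)]
  nlinarith [norm_nonneg ξ]

lemma japanese_add_le (ξ δ : Plane) : japanese (ξ + δ) ≤ 2 * (1 + ‖δ‖) * japanese ξ := by
  have h1 : japanese ξ ^ 2 = 1 + ‖ξ‖ ^ 2 := Real.sq_sqrt (by positivity)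
  have h2 := norm_add_le ξ δ
  have h3 := one_le_japanese ξ
  have h4 : ‖ξ‖ ≤ japanese ξ := by
    rw [japanese]; exact Real.le_sqrt_of_sq_le (by linarith)
  have h5 := japanese_le (ξ + δ)
  nlinarith [norm_nonneg δ, norm_nonneg ξ]

/-- **Peetre's inequality.** -/
lemma japanese_add_rpow_le (m : ℝ) (ξ δ : Plane) :
    japanese (ξ + δ) ^ m ≤ (2 * (1 + ‖δ‖)) ^ ⌈|m|⌉₊ * japanese ξ ^ m := by
  have hb : (1 : ℝ) ≤ 2 * (1 + ‖δ‖) := by linarith [norm_nonneg δ]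
  have hpow : (2 * (1 + ‖δ‖)) ^ |m| ≤ (2 * (1 + ‖δ‖)) ^ ⌈|m|⌉₊ := by
    rw [← Real.rpow_natCast]
    exact Real.rpow_le_rpow_of_exponent_le hb (Nat.le_ceil _)
  refine le_trans ?_ (mul_le_mul_of_nonneg_right hpow
    (Real.rpow_pos_of_pos (japanese_pos ξ) m).le)
  rcases le_total 0 m with hm | hm
  · rw [abs_of_nonneg hm, ← Real.mul_rpow (by positivity) (japanese_pos ξ).le]
    exact Real.rpow_le_rpow (japanese_pos _).le (japanese_add_le ξ δ) hm
  -- For negative exponents the inequality is applied to `ξ + δ` and the displacement `-δ`, which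
  -- bounds `⟨ξ + δ⟩` from below.
  · rw [abs_of_nonpos hm]
    have h := japanese_add_le (ξ + δ) (-δ)
    rw [add_neg_cancel_right, norm_neg] at h
    have h2 : japanese ξ / (2 * (1 + ‖δ‖)) ≤ japanese (ξ + δ) := by
      rw [div_le_iff₀ (by positivity)]; linarith
    refine (Real.rpow_le_rpow_of_nonpos (div_pos (japanese_pos ξ) (by positivity)) h2 hm).trans_eq ?_
    rw [Real.div_rpow (japanese_pos ξ).le (by positivity), Real.rpow_neg (by positivity),
      div_eq_mul_inv, mul_comm]

/-! ### Oscillatory series with sheared amplitudes -/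

section Shear

variable {V K P E : Type} [NormedAddCommGroup V] [NormedSpace ℝ V]
  [NormedAddCommGroup P] [NormedSpace ℝ P]
  [NormedAddCommGroup E] [NormedSpace ℝ E]
  {ν : K → ℝ} {g : V → ℂ} {q : ℕ}

/-- The derivatives of order at most `q + 8` are needed, hence the sum of the bounds over `n < q +
9`. -/
lemma oscBounded_of_bounds {f : K → V → E} (hf : ∀ k, ContDiff ℝ ∞ (f k)) {b : ℕ → ℝ}
    (hb : ∀ n, 0 ≤ b n) (hν : ∀ k, 1 ≤ ν k)
    (h : ∀ n k, ∀ y ∈ tsupport g, ‖iteratedFDeriv ℝ n (f k) y‖ ≤ b n * ν k ^ q) :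
    OscBounded g ν q (∑ n ∈ Finset.range (q + 9), b n) f where
  smooth := hf
  bound k n hn y hy := (h n k y hy).trans <| mul_le_mul_of_nonneg_right
    (Finset.single_le_sum (fun i _ => hb i) (Finset.mem_range.2 (by omega)))
    (pow_nonneg (zero_le_one.trans (hν k)) _)

lemma contDiff_shear {F : P → E} (hF : ContDiff ℝ ∞ F) (M : V →L[ℝ] P) (z c : P) :
    ContDiff ℝ ∞ (fun y => F (z + M y + c)) :=
  hF.comp ((contDiff_const.add M.contDiff).add contDiff_const)

lemma norm_iteratedFDeriv_shear_le {F : P → E} (hF : ContDiff ℝ ∞ F) (M : V →L[ℝ] P) (z c : P)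
    (n : ℕ) (y : V) : ‖iteratedFDeriv ℝ n (fun y => F (z + M y + c)) y‖ ≤
      ‖M‖ ^ n * ‖iteratedFDeriv ℝ n F (z + M y + c)‖ := by
  have e : (fun y => F (z + M y + c)) = fun y => (fun p => F (p + (z + c))) (M y) := by
    funext y; exact congrArg F (by abel)
  rw [e]
  refine (norm_iteratedFDeriv_comp_clm_le (F := fun p => F (p + (z + c)))
    (hF.comp (contDiff_id.add contDiff_const)) M n y).trans_eq ?_
  rw [iteratedFDeriv_comp_add_right, show M y + (z + c) = z + M y + c by abel]

/-- All derivatives of `F` at `z + M y + c k` grow at most like `ν k ^ q`, locally uniformly in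
`z`. -/
def ShearBounded (g : V → ℂ) (ν : K → ℝ) (M : V →L[ℝ] P) (c : K → P) (q : ℕ) (F : P → E) : Prop :=
  ContDiff ℝ ∞ F ∧ ∀ (R : ℝ) (n : ℕ), ∃ B, 0 ≤ B ∧ ∀ z, ‖z‖ ≤ R → ∀ k, ∀ y ∈ tsupport g,
    ‖iteratedFDeriv ℝ n F (z + M y + c k)‖ ≤ B * ν k ^ q

variable {M : V →L[ℝ] P} {c : K → P}

lemma ShearBounded.fderiv {F : P → E} (h : ShearBounded g ν M c q F) :
    ShearBounded g ν M c q (fderiv ℝ F) := by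
  refine ⟨h.1.fderiv_right (by simp), fun R n => ?_⟩
  obtain ⟨B, hB, H⟩ := h.2 R (n + 1)
  exact ⟨B, hB, fun z hz k y hy => by rw [norm_iteratedFDeriv_fderiv]; exact H z hz k y hy⟩

lemma ShearBounded.exists_oscBounded {F : P → E} (h : ShearBounded g ν M c q F)
    (hν : ∀ k, 1 ≤ ν k) (R : ℝ) :
    ∃ B, ∀ z, ‖z‖ ≤ R → OscBounded g ν q B (fun k y => F (z + M y + c k)) := by
  choose B hB H using h.2 R
  refine ⟨_, fun z hz => oscBounded_of_bounds (b := fun n => ‖M‖ ^ n * B n)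
    (fun k => contDiff_shear h.1 M z (c k)) (fun n => mul_nonneg (by positivity) (hB n)) hν
    fun n k y hy => (norm_iteratedFDeriv_shear_le h.1 M z (c k) n y).trans ?_⟩
  rw [mul_assoc]
  exact mul_le_mul_of_nonneg_left (H n z hz k y hy) (by positivity)

variable [FiniteDimensional ℝ V] [MeasureSpace V] [BorelSpace V]
  [(volume : Measure V).IsAddHaarMeasure] [NormedSpace ℂ E] [IsScalarTower ℝ ℂ E]
  {φ : K → V →L[ℝ] ℝ}

/-- The oscillatory series with amplitudes `F (z + M y + c k)`, as a function of `z`. -/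
noncomputable def shearSum (φ : K → V →L[ℝ] ℝ) (g : V → ℂ) (M : V →L[ℝ] P) (c : K → P) (F : P → E)
    (z : P) : E :=
  oscSum φ g fun k y => F (z + M y + c k)

lemma hasFDerivAt_shearSum (hφ : PhaseFamily φ ν) (hg : ContDiff ℝ ∞ g) (hc : HasCompactSupport g)
    [CompleteSpace E] {F : P → E} (h : ShearBounded g ν M c q F) (z : P) :
    HasFDerivAt (shearSum φ g M c F) (shearSum φ g M c (fderiv ℝ F) z) z := by
  obtain ⟨B, hB⟩ := h.exists_oscBounded hφ.one_le (‖z‖ + 1)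
  obtain ⟨B', hB'⟩ := h.fderiv.exists_oscBounded hφ.one_le (‖z‖ + 1)
  have hz : ∀ w ∈ Metric.ball z 1, ‖w‖ ≤ ‖z‖ + 1 := fun w hw => by
    have h1 := norm_sub_norm_le w z
    have h2 := mem_ball_iff_norm.1 hw
    linarith
  refine hasFDerivAt_oscSum hφ hg hc one_pos (fun w hw => hB w (hz w hw))
    (fun w hw => hB' w (hz w hw)) fun w _ k y _ => ?_
  have h1 := (h.1.differentiable (by simp) (w + M y + c k)).hasFDerivAt
  exact h1.comp w (((hasFDerivAt_id w).add_const (M y)).add_const (c k))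

lemma contDiff_shearSum (hφ : PhaseFamily φ ν) (hg : ContDiff ℝ ∞ g) (hc : HasCompactSupport g)
    [CompleteSpace E] {F : P → E} (h : ShearBounded g ν M c q F) :
    ContDiff ℝ ∞ (shearSum φ g M c F) := by
  refine contDiff_infty.2 fun n => ?_
  -- The target space has to vary, because the derivative is a series with values in `P →L[ℝ] E`.
  induction n generalizing E with
  | zero =>
    exact contDiff_zero.2 (continuous_iff_continuousAt.2 fun z =>
      (hasFDerivAt_shearSum hφ hg hc h z).continuousAt)
  | succ n ih =>
    have e : _root_.fderiv ℝ (shearSum φ g M c F) = shearSum φ g M c (_root_.fderiv ℝ F) :=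
      funext fun z => (hasFDerivAt_shearSum hφ hg hc h z).fderiv
    rw [Nat.cast_add, Nat.cast_one, contDiff_succ_iff_fderiv, e]
    exact ⟨fun z => (hasFDerivAt_shearSum hφ hg hc h z).differentiableAt, by simp, ih h.fderiv⟩

/-- The growth exponent `q'` of the derivative is independent of `q`: differentiation in `h`
produces a factor that is linear in the frequency and so costs one more power. -/
lemma hasDerivAt_oscSum (hφ : PhaseFamily φ ν) (hg : ContDiff ℝ ∞ g) (hc : HasCompactSupport g)
    {f f' : ℝ → K → V → ℂ} {B B' : ℝ} {q' : ℕ} {t₀ r : ℝ} (hr : 0 < r)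
    (hf : ∀ t ∈ Metric.ball t₀ r, OscBounded g ν q B (f t))
    (hf' : ∀ t ∈ Metric.ball t₀ r, OscBounded g ν q' B' (f' t))
    (hd : ∀ t ∈ Metric.ball t₀ r, ∀ k, ∀ y ∈ tsupport g, HasDerivAt (fun t => f t k y) (f' t k y) t) :
    HasDerivAt (fun t => oscSum φ g (f t)) (oscSum φ g (f' t₀)) t₀ := by
  have ht₀ : t₀ ∈ Metric.ball t₀ r := Metric.mem_ball_self hr
  refine hasDerivAt_tsum_of_isPreconnected (g := fun k t => oscTerm (φ k) g (f t k))
    (g' := fun k t => oscTerm (φ k) g (f' t k)) (hφ.summable.mul_left (oscConst g q' * B'))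
    Metric.isOpen_ball
    (convex_ball t₀ r).isPreconnected (fun k t ht => ?_)
    (fun k t ht => norm_oscTerm_le hφ hg hc (hf' t ht) k) ht₀
    (summable_oscTerm hφ hg hc (hf t₀ ht₀)) ht₀
  refine (hasDerivAt_integral_of_dominated_loc_of_deriv_le (Metric.isOpen_ball.mem_nhds ht)
    ?_ ?_ ?_ (Eventually.of_forall fun y w hw => norm_oscIntegrand_le (hf' w hw) k y)
    ((integrable_norm_cutoff hg hc).mul_const _) (Eventually.of_forall fun y w hw => ?_)).2
  · filter_upwards [Metric.isOpen_ball.mem_nhds ht] with w hw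
    exact aestronglyMeasurable_oscIntegrand _ hg.continuous ((hf w hw).smooth k).continuous
  · exact integrable_oscIntegrand hg hc _ ((hf t ht).smooth k).continuous
  · exact aestronglyMeasurable_oscIntegrand _ hg.continuous ((hf' t ht).smooth k).continuous
  · by_cases hy : y ∈ tsupport g
    · exact ((hd w hw k y hy).const_smul (g y)).const_smul (phase (φ k) y)
    · simpa [image_eq_zero_of_notMem_tsupport hy] using hasDerivAt_const w (0 : ℂ)

/-- Evaluation at `v` is continuous and linear, so it passes through the series and the integrals.
-/
lemma dirDeriv_shearSum (hφ : PhaseFamily φ ν) (hg : ContDiff ℝ ∞ g) (hc : HasCompactSupport g)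
    {F : P → ℂ} (h : ShearBounded g ν M c q F) (v : P) :
    dirDeriv v (shearSum φ g M c F) = shearSum φ g M c (dirDeriv v F) := by
  funext z
  obtain ⟨B, hB⟩ := h.fderiv.exists_oscBounded hφ.one_le ‖z‖
  simp only [dirDeriv]
  rw [(hasFDerivAt_shearSum hφ hg hc h z).fderiv, shearSum, shearSum, oscSum, oscSum]
  have hs := summable_oscTerm hφ hg hc (hB z le_rfl)
  have := (ContinuousLinearMap.apply ℝ ℂ v).map_tsum hs
  simp only [ContinuousLinearMap.apply_apply] at this
  rw [this]
  refine tsum_congr fun k => ?_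
  rw [oscTerm, oscTerm]
  have hi := integrable_oscIntegrand hg hc (φ k) ((hB z le_rfl).smooth k).continuous
  have := (ContinuousLinearMap.apply ℝ ℂ v).integral_comp_comm hi
  simp only [ContinuousLinearMap.apply_apply] at this
  rw [← this]
  rfl

lemma shearSum_congr (φ : K → V →L[ℝ] ℝ) (g : V → ℂ) (M : V →L[ℝ] P) (c : K → P) {F F' : P → E}
    {z z' : P} (h : ∀ δ, F (z + δ) = F' (z' + δ)) :
    shearSum φ g M c F z = shearSum φ g M c F' z' := by
  unfold shearSum
  congr 1
  funext k y
  simpa [add_assoc] using h (M y + c k)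

end Shear

/-! ### Weights of moderate growth -/

section Moderate

/-- A positive weight that changes by a factor `C (1 + |δ|) ^ s` under translation by `δ`. -/
structure ModerateWeight {P : Type} [NormedAddCommGroup P] (w : P → ℝ) (C : ℝ) (s : ℕ) : Prop where
  pos : ∀ p, 0 < w p
  const_nonneg : 0 ≤ C
  le : ∀ p δ, w (p + δ) ≤ C * (1 + ‖δ‖) ^ s * w p

variable {V K P E : Type} [NormedAddCommGroup V] [NormedSpace ℝ V]
  [NormedAddCommGroup P] [NormedSpace ℝ P]
  [NormedAddCommGroup E] [NormedSpace ℝ E]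
  {ν : K → ℝ} {g : V → ℂ} {w : P → ℝ} {A : ℝ} {s : ℕ} {C : ℕ → ℝ} {F : P → E}

lemma SymbolBound.const_nonneg (hw : ModerateWeight w A s) (h : SymbolBound w C F) (n : ℕ) :
    0 ≤ C n :=
  nonneg_of_mul_nonneg_left (h.nonneg n 0) (hw.pos 0)

lemma exists_tsupport_norm_le (hc : HasCompactSupport g) : ∃ R, 0 ≤ R ∧ ∀ y ∈ tsupport g, ‖y‖ ≤ R := by
  obtain ⟨R, hR⟩ := hc.isCompact.isBounded.exists_norm_le
  exact ⟨max R 0, le_max_right _ _, fun y hy => (hR y hy).trans (le_max_left _ _)⟩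

lemma one_add_norm_shear_le {M : V →L[ℝ] P} {c : P} {μ κ R t : ℝ} (hM : ‖M‖ ≤ μ) (hR : 0 ≤ R)
    (ht : 1 ≤ t) (hc : ‖c‖ ≤ κ * t) {y : V} (hy : ‖y‖ ≤ R) :
    1 + ‖M y + c‖ ≤ (1 + μ * R + κ) * t := by
  have h1 : ‖M y‖ ≤ μ * R := (M.le_opNorm y).trans (by gcongr; exact (norm_nonneg _).trans hM)
  have h2 := norm_add_le (M y) c
  have h3 : 0 ≤ μ * R := mul_nonneg ((norm_nonneg _).trans hM) hR
  nlinarith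

/-- Uniform bounds of a moderate weight at the arguments of sheared amplitudes. -/
theorem ModerateWeight.exists_shear_bound (hw : ModerateWeight w A s)
    (hc : HasCompactSupport g) (hν : ∀ k, 1 ≤ ν k) (μ κ : ℝ) :
    ∃ B, 0 ≤ B ∧ ∀ (M : V →L[ℝ] P) (c : K → P), ‖M‖ ≤ μ → (∀ k, ‖c k‖ ≤ κ * ν k) →
      ∀ z k, ∀ y ∈ tsupport g, w (z + M y + c k) ≤ B * w z * ν k ^ s := by
  obtain ⟨R, hR, hy⟩ := exists_tsupport_norm_le hc
  have hA := hw.const_nonneg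
  refine ⟨A * (1 + |μ| * R + |κ|) ^ s, by positivity, fun M c hM hck z k y hyg => ?_⟩
  have hk := hν k
  have hz := (hw.pos z).le
  have h1 : 1 + ‖M y + c k‖ ≤ (1 + |μ| * R + |κ|) * ν k :=
    one_add_norm_shear_le (hM.trans (le_abs_self _)) hR hk ((hck k).trans (by
      gcongr; exact le_abs_self κ)) (hy y hyg)
  rw [add_assoc]
  refine (hw.le z _).trans ?_
  calc _ ≤ A * ((1 + |μ| * R + |κ|) * ν k) ^ s * w z := by gcongr
    _ = _ := by rw [mul_pow]; ring

/-- The sum of the first seminorms of a symbol, which controls oscillatory series. -/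
noncomputable def seminormSum (s : ℕ) (C : ℕ → ℝ) : ℝ := ∑ n ∈ Finset.range (s + 9), C n

/-- The constant precedes the linear map, the shifts, the symbol and the point, and the dependence
on the symbol is explicit. The same bound thus serves all `h` in a bounded set and whole families of
symbols. -/
theorem ModerateWeight.exists_oscBounded (hw : ModerateWeight w A s) (hc : HasCompactSupport g)
    (hν : ∀ k, 1 ≤ ν k) (μ κ : ℝ) :
    ∃ B, 0 ≤ B ∧ ∀ (M : V →L[ℝ] P) (c : K → P), ‖M‖ ≤ μ → (∀ k, ‖c k‖ ≤ κ * ν k) →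
      ∀ (C : ℕ → ℝ) (F : P → E), SymbolBound w C F → ∀ z,
        OscBounded g ν s (B * seminormSum s C * w z) (fun k y => F (z + M y + c k)) := by
  obtain ⟨B, hB, H⟩ := hw.exists_shear_bound hc hν μ κ
  refine ⟨(1 + |μ|) ^ (s + 8) * B, by positivity, fun M c hM hck C F h z => ⟨fun k =>
    contDiff_shear h.smooth M z (c k), fun k n hn y hy =>
      (norm_iteratedFDeriv_shear_le h.smooth M z (c k) n y).trans ?_⟩⟩
  have hz := hw.pos z
  have hC := fun n => h.const_nonneg hw n
  have h1 := H M c hM hck z k y hy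
  have h2 : ‖M‖ ≤ 1 + |μ| := hM.trans (by linarith [le_abs_self μ])
  have h3 : ‖M‖ ^ n ≤ (1 + |μ|) ^ (s + 8) := (pow_le_pow_left₀ (norm_nonneg _) h2 n).trans
    (pow_le_pow_right₀ (by linarith [abs_nonneg μ]) hn)
  have h4 : C n ≤ seminormSum s C :=
    Finset.single_le_sum (fun i _ => hC i) (Finset.mem_range.2 (by omega))
  have h5 : 0 ≤ ν k := zero_le_one.trans (hν k)
  have h6 := (hC n).trans h4
  calc _ ≤ (1 + |μ|) ^ (s + 8) * (seminormSum s C * (B * w z * ν k ^ s)) := by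
        refine mul_le_mul h3 ((h.bound n _).trans ?_) (norm_nonneg _) (by positivity)
        exact mul_le_mul h4 h1 (hw.pos _).le h6
    _ = _ := by ring

lemma ModerateWeight.le_of_norm_le (hw : ModerateWeight w A s) {R : ℝ} {z : P} (hz : ‖z‖ ≤ R) :
    w z ≤ A * (1 + R) ^ s * w 0 := by
  have h1 := hw.le 0 z
  rw [zero_add] at h1
  have := hw.const_nonneg; have := (hw.pos 0).le
  exact h1.trans (by gcongr)

theorem SymbolBound.shearBounded (hw : ModerateWeight w A s) (h : SymbolBound w C F)
    (hc : HasCompactSupport g) (hν : ∀ k, 1 ≤ ν k) (M : V →L[ℝ] P) {c : K → P} {κ : ℝ}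
    (hκ : ∀ k, ‖c k‖ ≤ κ * ν k) : ShearBounded g ν M c s F := by
  refine ⟨h.smooth, fun R n => ?_⟩
  obtain ⟨B, hB, H⟩ := hw.exists_shear_bound hc hν ‖M‖ κ
  have hA := hw.const_nonneg
  have h0 := hw.pos 0
  have hC := h.const_nonneg hw n
  refine ⟨C n * (B * (A * (1 + |R|) ^ s * w 0)), by positivity, fun z hz k y hy =>
    (h.bound n _).trans ?_⟩
  have h1 := hw.le_of_norm_le (hz.trans (le_abs_self R))
  have h2 := zero_le_one.trans (hν k)
  rw [mul_assoc]
  refine mul_le_mul_of_nonneg_left ((H M c le_rfl hκ z k y hy).trans ?_) hC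
  gcongr

/-- The sheared oscillatory series of symbols are symbols, with uniform bounds. -/
theorem ModerateWeight.exists_symbolBound_shearSum [FiniteDimensional ℝ V] [MeasureSpace V]
    [BorelSpace V] [(volume : Measure V).IsAddHaarMeasure] [NormedSpace ℂ E] [IsScalarTower ℝ ℂ E]
    [CompleteSpace E] (hw : ModerateWeight w A s) {φ : K → V →L[ℝ] ℝ} (hφ : PhaseFamily φ ν)
    (hg : ContDiff ℝ ∞ g) (hc : HasCompactSupport g) (M : V →L[ℝ] P) {c : K → P} {κ : ℝ}
    (hκ : ∀ k, ‖c k‖ ≤ κ * ν k) (C : ℕ → ℝ) :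
    ∃ C', ∀ F : P → E, SymbolBound w C F → SymbolBound w C' (shearSum φ g M c F) := by
  have key : ∀ n, ∃ B, ∀ F : P → E, SymbolBound w C F → ∀ z,
      ‖iteratedFDeriv ℝ n (shearSum φ g M c F) z‖ ≤ B * w z := by
    intro n
    -- The derivative of the series is the series of `fderiv ℝ F`, which has other values and the
    -- shifted constants `C (n + 1)`.
    induction n generalizing E C with
    | zero =>
      obtain ⟨B, hB, H⟩ := hw.exists_oscBounded (E := E) hc hφ.one_le ‖M‖ κ
      refine ⟨oscConst g s * (B * seminormSum s C) * ∑' k, (ν k ^ 8)⁻¹, fun F hF z => ?_⟩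
      rw [norm_iteratedFDeriv_zero]
      exact (norm_oscSum_le hφ hg hc (H M c le_rfl hκ C F hF z)).trans_eq (by ring)
    | succ n ih =>
      obtain ⟨B, hB⟩ := ih (E := P →L[ℝ] E) (fun n => C (n + 1))
      refine ⟨B, fun F hF z => ?_⟩
      have hs := hF.shearBounded hw hc hφ.one_le M hκ
      have e : _root_.fderiv ℝ (shearSum φ g M c F) = shearSum φ g M c (_root_.fderiv ℝ F) :=
        funext fun z => (hasFDerivAt_shearSum hφ hg hc hs z).fderiv
      rw [← norm_iteratedFDeriv_fderiv, e]
      exact hB _ hF.fderiv z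
  choose B hB using key
  exact ⟨B, fun F hF => ⟨contDiff_shearSum hφ hg hc (hF.shearBounded hw hc hφ.one_le M hκ),
    fun n z => hB n F hF z⟩⟩

/-- The derivative of a sheared amplitude in a direction that depends linearly on `y` and on
`ν k`. -/
theorem SymbolBound.exists_oscBounded_fderiv (hw : ModerateWeight w A s) (h : SymbolBound w C F)
    (hc : HasCompactSupport g) (hν : ∀ k, 1 ≤ ν k) (μ κ : ℝ) (M₁ : V →L[ℝ] P) {c₁ : K → P} {κ₁ : ℝ}
    (hκ₁ : ∀ k, ‖c₁ k‖ ≤ κ₁ * ν k) :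
    ∃ B, 0 ≤ B ∧ ∀ (M : V →L[ℝ] P) (c : K → P), ‖M‖ ≤ μ → (∀ k, ‖c k‖ ≤ κ * ν k) →
      ∀ z, OscBounded g ν (s + 1) (B * w z)
        (fun k y => _root_.fderiv ℝ F (z + M y + c k) (M₁ y + c₁ k)) := by
  obtain ⟨R, hR, hyR⟩ := exists_tsupport_norm_le hc
  obtain ⟨B₀, hB₀, H₀⟩ := hw.exists_shear_bound hc hν μ κ
  set B : ℕ → ℝ := fun n => C (n + 1) * B₀ with hBdef
  have hB : ∀ n, 0 ≤ B n := fun n => mul_nonneg (h.const_nonneg hw _) hB₀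
  set D : ℝ := ‖M₁‖ * R + |κ₁| + ‖M₁‖ with hD
  have hD0 : 0 ≤ D := by positivity
  -- The direction is affine in `y`: its value grows linearly in `ν k`, its first derivative is the
  -- constant `M₁`, and higher derivatives vanish. It contributes the extra power in `s + 1`.
  have hlin : ∀ n k, ∀ y ∈ tsupport g,
      ‖iteratedFDeriv ℝ n (fun y => M₁ y + c₁ k) y‖ ≤ D * ν k := by
    intro n k y hy
    have hk := hν k
    have e : (fun y => M₁ y + c₁ k) = fun y => (fun p => p) (0 + M₁ y + c₁ k) := by
      funext y; simp
    have h1 : ‖M₁ y + c₁ k‖ ≤ D * ν k := by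
      have h2 := norm_add_le (M₁ y) (c₁ k)
      have h3 : ‖M₁ y‖ ≤ ‖M₁‖ * R := (M₁.le_opNorm y).trans (by gcongr; exact hyR y hy)
      have h4 : ‖c₁ k‖ ≤ |κ₁| * ν k := (hκ₁ k).trans (by gcongr; exact le_abs_self _)
      have h5 : 0 ≤ ‖M₁‖ * R := by positivity
      have h6 := norm_nonneg M₁
      rw [hD]; nlinarith
    rcases n with _ | n
    · simpa using h1
    · rw [← norm_iteratedFDeriv_fderiv]
      have : _root_.fderiv ℝ (fun y => M₁ y + c₁ k) = fun _ => M₁ := by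
        funext y
        exact (M₁.hasFDerivAt.add_const (c₁ k)).fderiv
      rw [this]
      have h7 : ‖M₁‖ ≤ D * ν k := by
        have h5 : 0 ≤ ‖M₁‖ * R := by positivity
        have h6 := norm_nonneg M₁
        have h8 := abs_nonneg κ₁
        rw [hD]; nlinarith
      rcases n with _ | n
      · simpa using h7
      · rw [iteratedFDeriv_const_of_ne (by omega)]
        simpa using mul_nonneg hD0 (zero_le_one.trans hk)
  refine ⟨∑ n ∈ Finset.range (s + 1 + 9), ∑ i ∈ Finset.range (n + 1),
    (n.choose i : ℝ) * (|μ| ^ i * B i) * D, Finset.sum_nonneg fun n _ => Finset.sum_nonneg fun i _ =>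
      mul_nonneg (mul_nonneg (by positivity) (mul_nonneg (by positivity) (hB i))) hD0,
    fun M c hM hck z => ?_⟩
  have hz := hw.pos z
  have hsm : ∀ k, ContDiff ℝ ∞ (fun y => _root_.fderiv ℝ F (z + M y + c k)) := fun k =>
    contDiff_shear h.fderiv.smooth M z (c k)
  have hsm' : ∀ k, ContDiff ℝ ∞ (fun y => M₁ y + c₁ k) := fun k =>
    M₁.contDiff.add contDiff_const
  have := oscBounded_of_bounds (g := g) (ν := ν) (q := s + 1)
    (f := fun k y => _root_.fderiv ℝ F (z + M y + c k) (M₁ y + c₁ k))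
    (b := fun n => (∑ i ∈ Finset.range (n + 1), (n.choose i : ℝ) * (|μ| ^ i * B i) * D) * w z)
    (fun k => (hsm k).clm_apply (hsm' k))
    (fun n => mul_nonneg (Finset.sum_nonneg fun i _ =>
      mul_nonneg (mul_nonneg (by positivity) (mul_nonneg (by positivity) (hB i))) hD0) hz.le) hν
    (fun n k y hy => (norm_iteratedFDeriv_clm_apply (hsm k) (hsm' k) y
      (n := n) (by exact_mod_cast le_top)).trans ?_)
  · rwa [← Finset.sum_mul] at this
  · rw [Finset.sum_mul, Finset.sum_mul]
    refine Finset.sum_le_sum fun i _ => ?_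
    have h1 := norm_iteratedFDeriv_shear_le h.fderiv.smooth M z (c k) i y
    have h2 : ‖iteratedFDeriv ℝ i (_root_.fderiv ℝ F) (z + M y + c k)‖ ≤ B i * w z * ν k ^ s :=
      (h.fderiv.bound i _).trans ((mul_le_mul_of_nonneg_left (H₀ M c hM hck z k y hy)
        (h.const_nonneg hw _)).trans_eq (by rw [hBdef]; ring))
    have h3 : ‖M‖ ≤ |μ| := hM.trans (le_abs_self _)
    have h4 := hlin (n - i) k y hy
    have h5 := hB i
    have h6 := zero_le_one.trans (hν k)
    calc _ ≤ (n.choose i : ℝ) * (|μ| ^ i * (B i * w z * ν k ^ s)) * (D * ν k) := by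
          gcongr
          exact h1.trans (by gcongr)
      _ = _ := by ring

end Moderate

/-! ### The star product of general bisymbols -/

/-- The space of pairs of points of phase space. -/
abbrev Pair : Type := Phase × Phase

/-- Pairs of lattice points. -/
abbrev Lat₂ : Type := (Fin 2 → ℤ) × (Fin 2 → ℤ)

lemma perp_add (x y : Plane) : perp (x + y) = perp x + perp y := by
  ext i; fin_cases i <;> simp [perp]; ring

lemma perp_smul (c : ℝ) (x : Plane) : perp (c • x) = c • perp x := by
  ext i; fin_cases i <;> simp [perp]

/-- `y ↦ y^⊥` as a continuous linear map. -/
noncomputable def perpCLM : Plane →L[ℝ] Plane :=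
  LinearMap.toContinuousLinearMap ⟨⟨perp, perp_add⟩, perp_smul⟩

@[simp] lemma perpCLM_apply (y : Plane) : perpCLM y = perp y := rfl

/-- The linear map `(y, y') ↦ ((-y, 0), (-y', 0))`. -/
noncomputable def starBase : Plane × Plane →L[ℝ] Pair :=
  ((-(ContinuousLinearMap.fst ℝ Plane Plane)).prod 0).prod
    ((-(ContinuousLinearMap.snd ℝ Plane Plane)).prod 0)

/-- The linear map `(y, y') ↦ ((0, β y^⊥), (0, β y'^⊥))`. -/
noncomputable def starSlope (β : ℝ) : Plane × Plane →L[ℝ] Pair :=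
  ((0 : Plane × Plane →L[ℝ] Plane).prod (β • perpCLM.comp (ContinuousLinearMap.fst ℝ Plane Plane))).prod
    ((0 : Plane × Plane →L[ℝ] Plane).prod (β • perpCLM.comp (ContinuousLinearMap.snd ℝ Plane Plane)))

/-- The linear part of the argument of the bisymbol in the star product. -/
noncomputable def starMap (h β : ℝ) : Plane × Plane →L[ℝ] Pair := starBase + h • starSlope β

/-- The shift of the argument of the bisymbol, for `h = 1`. -/
noncomputable def unitShift (k : Lat₂) : Pair :=
  ((0, (1 / 2 : ℝ) • freq k.2), (0, -((1 / 2 : ℝ) • freq k.1)))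

/-- The factor `e^{2iβ y ∧ y'}`. -/
noncomputable def starPhase (β : ℝ) (p : Plane × Plane) : ℂ :=
  Complex.exp (Complex.I * ((2 * β * wedge p.1 p.2 : ℝ) : ℂ))

lemma starBase_apply (p : Plane × Plane) : starBase p = ((-p.1, 0), (-p.2, 0)) := rfl

lemma starSlope_apply (β : ℝ) (p : Plane × Plane) :
    starSlope β p = ((0, β • perp p.1), (0, β • perp p.2)) := rfl

lemma starMap_apply (h β : ℝ) (p : Plane × Plane) :
    starMap h β p = ((-p.1, (h * β) • perp p.1), (-p.2, (h * β) • perp p.2)) := by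
  simp [starMap, starBase_apply, starSlope_apply, smul_smul]

lemma contDiff_wedge : ContDiff ℝ ∞ fun p : Plane × Plane => wedge p.1 p.2 := by
  unfold wedge
  exact (((contDiff_coord 0).comp contDiff_fst).mul ((contDiff_coord 1).comp contDiff_snd)).sub
    (((contDiff_coord 1).comp contDiff_fst).mul ((contDiff_coord 0).comp contDiff_snd))

lemma contDiff_cexp_I {V : Type*} [NormedAddCommGroup V] [NormedSpace ℝ V] {f : V → ℝ}
    (hf : ContDiff ℝ ∞ f) : ContDiff ℝ ∞ fun y => Complex.exp (Complex.I * ((f y : ℝ) : ℂ)) :=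
  (contDiff_const.mul (Complex.ofRealCLM.contDiff.comp hf)).cexp

lemma contDiff_starPhase (β : ℝ) : ContDiff ℝ ∞ (starPhase β) :=
  contDiff_cexp_I (contDiff_const.mul contDiff_wedge)

lemma norm_latticeVec_le (k : Fin 2 → ℤ) : ‖latticeVec k‖ ≤ 2 * ‖k‖ := by
  rw [plane_eq (latticeVec k)]
  refine (norm_add_le _ _).trans ?_
  rw [norm_smul, norm_smul, norm_basisVec, norm_basisVec]
  have h0 := norm_le_pi_norm k 0
  have h1 := norm_le_pi_norm k 1
  rw [Int.norm_eq_abs] at h0 h1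
  simp only [latticeVec, Real.norm_eq_abs, mul_one]
  simp only [Matrix.cons_val_zero, Matrix.cons_val_one]
  linarith

lemma norm_freq_le (k : Fin 2 → ℤ) : ‖freq k‖ ≤ 4 * Real.pi * ‖k‖ := by
  rw [freq, norm_smul, Real.norm_of_nonneg (by positivity)]
  have := norm_latticeVec_le k
  have := Real.pi_pos
  nlinarith

lemma one_le_latSize {K : Type*} [NormedAddCommGroup K] (k : K) : 1 ≤ latSize k := by
  simp [latSize]

lemma norm_unitShift_le (k : Lat₂) : ‖unitShift k‖ ≤ (2 * Real.pi) * latSize k := by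
  have h1 := norm_freq_le k.1
  have h2 := norm_freq_le k.2
  have h3 := norm_fst_le k
  have h4 := norm_snd_le k
  have hp := Real.pi_pos
  have hr : ∀ v : Plane, ‖((1 / 2 : ℝ) • v)‖ = (1 / 2) * ‖v‖ := fun v => by
    rw [norm_smul]; norm_num
  have h5 := norm_nonneg k
  rw [unitShift, latSize]
  refine norm_prod_le_iff.2 ⟨norm_prod_le_iff.2 ⟨?_, ?_⟩, norm_prod_le_iff.2 ⟨?_, ?_⟩⟩
  · simp only [norm_zero]; positivity
  · simp only [hr]; nlinarith
  · simp only [norm_zero]; positivity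
  · simp only [norm_neg, hr]; nlinarith

lemma norm_starMap_le (h β : ℝ) {H : ℝ} (hH : |h| ≤ H) :
    ‖starMap h β‖ ≤ ‖starBase‖ + H * ‖starSlope β‖ := by
  refine (norm_add_le _ _).trans ?_
  rw [norm_smul, Real.norm_eq_abs]
  gcongr

lemma norm_smul_unitShift_le {h H : ℝ} (hH : |h| ≤ H) (k : Lat₂) :
    ‖h • unitShift k‖ ≤ (H * (2 * Real.pi)) * latSize k := by
  rw [norm_smul, Real.norm_eq_abs, mul_assoc]
  exact mul_le_mul hH (norm_unitShift_le k) (norm_nonneg _) ((abs_nonneg _).trans hH)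

/-- The star product of a bisymbol, with cutoff `χ`. -/
noncomputable def starSum (χ : Plane × Plane → ℂ) (β h : ℝ) (F : Pair → ℂ) : Pair → ℂ :=
  shearSum freqPhase₂ (fun p => χ p * starPhase β p) (starMap h β) (fun k => h • unitShift k) F

/-- Periodicity in both position variables. -/
def IsBiperiodic (F : Pair → ℂ) : Prop :=
  ∀ (l l' : Fin 2 → ℤ) (q : Pair), F (q + ((latticeVec l, 0), (latticeVec l', 0))) = F q

/-! ### Convergence, derivatives and uniform bounds of the star series. -/

section Basic

variable {χ : Plane × Plane → ℂ} {w : Pair → ℝ} {A : ℝ} {s : ℕ} {F : Pair → ℂ}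

lemma contDiff_starCutoff (hχ : ContDiff ℝ ∞ χ) (β : ℝ) :
    ContDiff ℝ ∞ fun p => χ p * starPhase β p := hχ.mul (contDiff_starPhase β)

lemma hasCompactSupport_starCutoff (hc : HasCompactSupport χ) (β : ℝ) :
    HasCompactSupport fun p => χ p * starPhase β p := hc.mul_right

lemma HasSymbolBound.shearBounded_star (hw : ModerateWeight w A s) (hF : HasSymbolBound w F)
    (hc : HasCompactSupport χ) (β h : ℝ) :
    ShearBounded (fun p => χ p * starPhase β p) latSize (starMap h β) (fun k => h • unitShift k) s F :=
  hF.choose_spec.shearBounded hw (hasCompactSupport_starCutoff hc β) one_le_latSize _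
    (norm_smul_unitShift_le le_rfl)

lemma contDiff_starSum (hw : ModerateWeight w A s) (hF : HasSymbolBound w F)
    (hχ : ContDiff ℝ ∞ χ) (hc : HasCompactSupport χ) (β h : ℝ) :
    ContDiff ℝ ∞ (starSum χ β h F) :=
  contDiff_shearSum phaseFamily_freqPhase₂ (contDiff_starCutoff hχ β)
    (hasCompactSupport_starCutoff hc β) (hF.shearBounded_star hw hc β h)

lemma dirDeriv_starSum (hw : ModerateWeight w A s) (hF : HasSymbolBound w F)
    (hχ : ContDiff ℝ ∞ χ) (hc : HasCompactSupport χ) (β h : ℝ) (v : Pair) :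
    dirDeriv v (starSum χ β h F) = starSum χ β h (dirDeriv v F) :=
  dirDeriv_shearSum phaseFamily_freqPhase₂ (contDiff_starCutoff hχ β)
    (hasCompactSupport_starCutoff hc β) (hF.shearBounded_star hw hc β h) v

lemma isBiperiodic_starSum (hF : IsBiperiodic F) (β h : ℝ) : IsBiperiodic (starSum χ β h F) := by
  intro l l' q
  exact shearSum_congr _ _ _ _ fun δ => by rw [add_right_comm, hF]

/-- Uniformity in `|h| ≤ H` is needed both to differentiate in `h` and to obtain remainders that are
uniform in `0 < h ≤ 1`. -/
lemma HasSymbolBound.oscBounded_star (hw : ModerateWeight w A s) (hF : HasSymbolBound w F)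
    (hc : HasCompactSupport χ) (β H : ℝ) :
    ∃ B, 0 ≤ B ∧ ∀ h, |h| ≤ H → ∀ z, OscBounded (fun p => χ p * starPhase β p) latSize s (B * w z)
      (fun (k : Lat₂) y => F (z + starMap h β y + h • unitShift k)) := by
  obtain ⟨B, hB, h⟩ := hw.exists_oscBounded (E := ℂ) (hasCompactSupport_starCutoff hc β)
    (ν := latSize) (K := Lat₂) one_le_latSize (‖starBase‖ + H * ‖starSlope β‖) (H * (2 * Real.pi))
  obtain ⟨C, hC⟩ := hF
  exact ⟨B * seminormSum s C, mul_nonneg hB (Finset.sum_nonneg fun n _ => hC.const_nonneg hw n),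
    fun h' hH z => h _ _ (norm_starMap_le _ _ hH) (norm_smul_unitShift_le hH) C F hC z⟩

lemma exists_norm_starSum_le (hw : ModerateWeight w A s) (hF : HasSymbolBound w F)
    (hχ : ContDiff ℝ ∞ χ) (hc : HasCompactSupport χ) (β H : ℝ) :
    ∃ C, ∀ h, |h| ≤ H → ∀ z, ‖starSum χ β h F z‖ ≤ C * w z := by
  obtain ⟨B, -, h⟩ := hF.oscBounded_star hw hc β H
  refine ⟨oscConst (fun p => χ p * starPhase β p) s * B * ∑' k : Lat₂, (latSize k ^ 8)⁻¹,
    fun h' hH z => (norm_oscSum_le phaseFamily_freqPhase₂ (contDiff_starCutoff hχ β)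
      (hasCompactSupport_starCutoff hc β) (h h' hH z)).trans_eq (by ring)⟩

lemma summable_starTerm (hw : ModerateWeight w A s) (hF : HasSymbolBound w F)
    (hχ : ContDiff ℝ ∞ χ) (hc : HasCompactSupport χ) (β h : ℝ) (z : Pair) :
    Summable fun k : Lat₂ => oscTerm (freqPhase₂ k) (fun p => χ p * starPhase β p)
      (fun y => F (z + starMap h β y + h • unitShift k)) := by
  obtain ⟨B, -, H⟩ := hF.oscBounded_star hw hc β |h|
  exact summable_oscTerm phaseFamily_freqPhase₂ (contDiff_starCutoff hχ β)
      (hasCompactSupport_starCutoff hc β) (H h le_rfl z)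

end Basic

/-! ### Invariance under translations -/

lemma cexp_I_eq {a b : ℝ} (n : ℤ) (h : a = b + 2 * Real.pi * n) :
    Complex.exp (Complex.I * (a : ℂ)) = Complex.exp (Complex.I * (b : ℂ)) := by
  refine Complex.exp_eq_exp_iff_exists_int.2 ⟨n, ?_⟩
  rw [h]; push_cast; ring

lemma phase_mul_starPhase (k : Lat₂) (β : ℝ) (p : Plane × Plane) :
    phase (freqPhase₂ k) p * starPhase β p =
      Complex.exp (Complex.I * ((freqPhase₂ k p + 2 * β * wedge p.1 p.2 : ℝ) : ℂ)) := by
  rw [phase, starPhase, ← Complex.exp_add]; push_cast; ring_nf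

/-- The integrand of the star product without its cutoff. -/
noncomputable def starKernel (β h : ℝ) (F : Pair → ℂ) (z : Pair) (k : Lat₂) (p : Plane × Plane) : ℂ :=
  phase (freqPhase₂ k) p * (starPhase β p * F (z + starMap h β p + h • unitShift k))

lemma starSum_eq_tsum (χ : Plane × Plane → ℂ) (β h : ℝ) (F : Pair → ℂ) (z : Pair) :
    starSum χ β h F z = ∑' k, ∫ p, χ p * starKernel β h F z k p := by
  refine tsum_congr fun k => integral_congr_ae (Eventually.of_forall fun p => ?_)
  simp only [starKernel, smul_eq_mul]; ring

/-- The change of the frequencies under a lattice translation. -/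
def starFreqShift (n : ℤ) (l : Lat₂) : Lat₂ :=
  (![2 * n * l.2 1, -(2 * n * l.2 0)], ![-(2 * n * l.1 1), 2 * n * l.1 0])

/-- Translation turns the bilinear phase `2β y ∧ y'` into itself plus a linear phase, that is, a
change of frequency by `2β` times a rotated lattice vector, which lies in `2πℤ²` as `β = 2πn`. The
factor `h/2` in front of the frequencies makes this same change reproduce the shift `hβ l^⊥` of the
momenta. The shift of the positions disappears by periodicity. -/
lemma starKernel_add_latticeVec (n : ℤ) (h : ℝ) {F : Pair → ℂ} (hF : IsBiperiodic F) (z : Pair)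
    (l k : Lat₂) (p : Plane × Plane) :
    starKernel (2 * Real.pi * n) h F z k (p + latticeVec₂ l) =
      starKernel (2 * Real.pi * n) h F z (k + starFreqShift n l) p := by
  have e1 : z + starMap h (2 * Real.pi * n) (p + latticeVec₂ l) + h • unitShift k +
      ((latticeVec l.1, 0), (latticeVec l.2, 0)) =
      z + starMap h (2 * Real.pi * n) p + h • unitShift (k + starFreqShift n l) := by
    simp only [starMap_apply, latticeVec₂, unitShift, starFreqShift]
    refine Prod.ext (Prod.ext ?_ ?_) (Prod.ext ?_ ?_) <;> ext i <;> fin_cases i <;>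
      simp [perp, freq, latticeVec] <;> ring
  have e2 : phase (freqPhase₂ k) (p + latticeVec₂ l) * starPhase (2 * Real.pi * n) (p + latticeVec₂ l)
      = phase (freqPhase₂ (k + starFreqShift n l)) p * starPhase (2 * Real.pi * n) p := by
    rw [phase_mul_starPhase, phase_mul_starPhase]
    -- The constants left over in the exponent are integer multiples of `2π`.
    refine cexp_I_eq (k.1 0 * l.1 0 + k.1 1 * l.1 1 + (k.2 0 * l.2 0 + k.2 1 * l.2 1) +
      2 * n * (l.1 0 * l.2 1 - l.1 1 * l.2 0)) ?_
    simp only [freqPhase₂_apply, freqPhase_eq, wedge, latticeVec₂, starFreqShift, Prod.fst_add,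
      Prod.snd_add, PiLp.add_apply, Pi.add_apply, latticeVec_zero_coord, latticeVec_one_coord,
      Matrix.cons_val_zero, Matrix.cons_val_one]
    push_cast
    ring
  rw [starKernel, starKernel, ← mul_assoc, ← mul_assoc, e2, ← e1, hF]

lemma continuous_starKernel (β h : ℝ) {F : Pair → ℂ} (hF : Continuous F) (z : Pair) (k : Lat₂) :
    Continuous (starKernel β h F z k) := by
  refine (continuous_phase _).mul ((contDiff_starPhase β).continuous.mul (hF.comp ?_))
  exact (continuous_const.add (starMap h β).continuous).add continuous_const

lemma pairCutoff_hasSum (y : Plane × Plane) :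
    HasSum (fun l => ((pairCutoff (y - latticeVec₂ l) : ℝ) : ℂ)) 1 := by
  have := (Complex.hasSum_ofReal (L := SummationFilter.unconditional _)).2
    (isLatticeCutoff_pairCutoff.2.2 y.1 y.2)
  rwa [Complex.ofReal_one] at this

lemma contDiff_ofReal_comp {V : Type*} [NormedAddCommGroup V] [NormedSpace ℝ V] {f : V → ℝ}
    (hf : ContDiff ℝ ∞ f) : ContDiff ℝ ∞ fun y => ((f y : ℝ) : ℂ) :=
  Complex.ofRealCLM.contDiff.comp hf

lemma hasCompactSupport_ofReal_comp {V : Type*} [TopologicalSpace V] {f : V → ℝ}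
    (hf : HasCompactSupport f) : HasCompactSupport fun y => ((f y : ℝ) : ℂ) :=
  hf.comp_left Complex.ofReal_zero

section Invariance

variable {w : Pair → ℝ} {A : ℝ} {s : ℕ} {F : Pair → ℂ} {β : ℝ}

lemma hasSum_starKernel (hw : ModerateWeight w A s) (hF : HasSymbolBound w F)
    {χ : Plane × Plane → ℂ} (hχ : ContDiff ℝ ∞ χ) (hc : HasCompactSupport χ) (β h : ℝ) (z : Pair) :
    HasSum (fun k => ∫ p, χ p * starKernel β h F z k p) (starSum χ β h F z) := by
  rw [starSum_eq_tsum]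
  refine Summable.hasSum ((summable_starTerm hw hF hχ hc β h z).congr fun k =>
    integral_congr_ae (Eventually.of_forall fun p => ?_))
  simp only [starKernel, smul_eq_mul]; ring

/-- The star product vanishes if the translates of the cutoff add up to zero. -/
theorem starSum_eq_zero (hβ : ∃ n : ℤ, β = 2 * Real.pi * n) (hw : ModerateWeight w A s)
    (hF : HasSymbolBound w F) (hp : IsBiperiodic F) {ρ : Plane × Plane → ℂ} (hρ : ContDiff ℝ ∞ ρ)
    (hc : HasCompactSupport ρ) (h0 : ∀ y, HasSum (fun l => ρ (y + latticeVec₂ l)) 0) (h : ℝ)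
    (z : Pair) : starSum ρ β h F z = 0 := by
  obtain ⟨n, rfl⟩ := hβ
  rw [starSum_eq_tsum]
  exact tsum_integral_eq_zero poissonFamily_freqPhase₂.finite
    (contDiff_ofReal_comp isLatticeCutoff_pairCutoff.1)
    (hasCompactSupport_ofReal_comp isLatticeCutoff_pairCutoff.2.1) pairCutoff_hasSum hρ hc h0
    (continuous_starKernel _ h hF.smooth.continuous z)
    (fun g hg hgc => (hasSum_starKernel hw hF hg hgc _ h z).summable)
    (fun l => Equiv.addRight (starFreqShift n l))
    (fun l k y => starKernel_add_latticeVec n h hp z l k y)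

lemma IsLatticeCutoff.hasSum_add {χ : Plane × Plane → ℝ} (hχ : IsLatticeCutoff χ)
    (y : Plane × Plane) : HasSum (fun l => ((χ (y + latticeVec₂ l) : ℝ) : ℂ)) 1 := by
  have h := (Equiv.neg Lat₂).hasSum_iff.2 (hχ.2.2 y.1 y.2)
  have h2 : HasSum (fun l => χ (y + latticeVec₂ l)) 1 := by
    refine h.congr_fun ?_ |> id
    intro l
    simp only [Function.comp, Equiv.neg_apply]
    exact congrArg χ (Prod.ext (by simp [latticeVec₂, latticeVec_neg])
      (by simp [latticeVec₂, latticeVec_neg]))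
  have := (Complex.hasSum_ofReal (L := SummationFilter.unconditional _)).2 h2
  rwa [Complex.ofReal_one] at this

lemma starSum_sub (hw : ModerateWeight w A s) (hF : HasSymbolBound w F)
    {χ ρ : Plane × Plane → ℂ} (hχ : ContDiff ℝ ∞ χ) (hc : HasCompactSupport χ)
    (hρ : ContDiff ℝ ∞ ρ) (hρc : HasCompactSupport ρ) (β h : ℝ) (z : Pair) :
    starSum (fun p => χ p - ρ p) β h F z = starSum χ β h F z - starSum ρ β h F z := by
  have h1 := hasSum_starKernel hw hF hχ hc β h z
  have h2 := hasSum_starKernel hw hF hρ hρc β h z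
  have h3 := hasSum_starKernel hw hF (hχ.sub hρ) (hc.sub hρc) β h z
  refine h3.unique ((h1.sub h2).congr_fun fun k => ?_ |> id)
  have hi : ∀ {g : Plane × Plane → ℂ}, ContDiff ℝ ∞ g → HasCompactSupport g →
      Integrable fun p => g p * starKernel β h F z k p := fun hg hgc =>
    (hg.continuous.mul (continuous_starKernel _ h hF.smooth.continuous z k)).integrable_of_hasCompactSupport
      hgc.mul_right
  rw [← integral_sub (hi hχ hc) (hi hρ hρc)]
  exact integral_congr_ae (Eventually.of_forall fun p => sub_mul _ _ _)

/-- The star product does not depend on the choice of the cutoff. -/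
theorem starSum_congr_cutoff (hβ : ∃ n : ℤ, β = 2 * Real.pi * n) (hw : ModerateWeight w A s)
    (hF : HasSymbolBound w F) (hp : IsBiperiodic F) {χ χ' : Plane × Plane → ℝ}
    (hχ : IsLatticeCutoff χ) (hχ' : IsLatticeCutoff χ') (h : ℝ) (z : Pair) :
    starSum (fun p => χ p) β h F z = starSum (fun p => χ' p) β h F z := by
  have hd := contDiff_ofReal_comp hχ.1
  have hd' := contDiff_ofReal_comp hχ'.1
  have hc := hasCompactSupport_ofReal_comp hχ.2.1
  have hc' := hasCompactSupport_ofReal_comp hχ'.2.1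
  rw [← sub_eq_zero, ← starSum_sub hw hF hd hc hd' hc']
  -- The translates of the difference of two lattice cutoffs add up to `1 - 1 = 0`.
  refine starSum_eq_zero hβ hw hF hp (hd.sub hd') (hc.sub hc') (fun y => ?_) h z
  simpa using (hχ.hasSum_add y).sub (hχ'.hasSum_add y)

/-- For `h = 0` the star product is the identity. -/
theorem starSum_zero (hβ : ∃ n : ℤ, β = 2 * Real.pi * n) (hF : ContDiff ℝ ∞ F)
    (hp : IsBiperiodic F) {χ : Plane × Plane → ℝ} (hχ : IsLatticeCutoff χ) (z : Pair) :
    starSum (fun p => χ p) β 0 F z = F z := by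
  obtain ⟨n, rfl⟩ := hβ
  have hg : ContDiff ℝ ∞ fun p => (χ p : ℂ) * (starPhase (2 * Real.pi * n) p *
      F (z + starMap 0 (2 * Real.pi * n) p)) :=
    (contDiff_ofReal_comp hχ.1).mul ((contDiff_starPhase _).mul
      (hF.comp (contDiff_const.add (starMap 0 _).contDiff)))
  have hgc : HasCompactSupport fun p => (χ p : ℂ) * (starPhase (2 * Real.pi * n) p *
      F (z + starMap 0 (2 * Real.pi * n) p)) := (hasCompactSupport_ofReal_comp hχ.2.1).mul_right
  -- For `h = 0` the frequency occurs only in the linear phase, so Poisson summation evaluates the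
  -- rest at lattice points. There the bilinear phase is `1` and `F` takes its value at `z`.
  have h1 := (poissonFamily_freqPhase₂.poisson _ hg hgc).tsum_eq
  have h2 : ∀ l : Lat₂, (χ (latticeVec₂ l) : ℂ) * (starPhase (2 * Real.pi * n) (latticeVec₂ l) *
      F (z + starMap 0 (2 * Real.pi * n) (latticeVec₂ l))) = (χ (0 + latticeVec₂ l) : ℂ) * F z := by
    intro l
    have e1 : starPhase (2 * Real.pi * n) (latticeVec₂ l) = 1 := by
      have := cexp_I_eq (a := 2 * (2 * Real.pi * n) * wedge (latticeVec₂ l).1 (latticeVec₂ l).2)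
        (b := 0) (2 * n * (l.1 0 * l.2 1 - l.1 1 * l.2 0)) (by
          simp only [wedge, latticeVec₂, latticeVec_zero_coord, latticeVec_one_coord]
          push_cast; ring)
      simpa [starPhase] using this
    have e2 : F (z + starMap 0 (2 * Real.pi * n) (latticeVec₂ l)) = F z := by
      rw [← hp l.1 l.2]
      congr 1
      rw [starMap_apply, add_assoc]
      simp [latticeVec₂]
    rw [e1, e2, one_mul, zero_add]
  simp only [h2] at h1
  rw [tsum_mul_right, (hχ.hasSum_add 0).tsum_eq, one_mul] at h1
  rw [← h1, starSum_eq_tsum]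
  refine tsum_congr fun k => integral_congr_ae (Eventually.of_forall fun p => ?_)
  simp only [starKernel, zero_smul, add_zero]; ring

end Invariance

/-! ### The algebra of constant-coefficient operators on bisymbols -/

lemma HasSymbolBound.zero {P : Type*} [NormedAddCommGroup P] [NormedSpace ℝ P] (w : P → ℝ) :
    HasSymbolBound w (fun _ => (0 : ℂ)) :=
  ⟨fun _ => 0, contDiff_const, fun n p => by
    rw [show (fun _ : P => (0 : ℂ)) = 0 from rfl, iteratedFDeriv_zero]; simp⟩

lemma dirDeriv_add_dir {P : Type*} [NormedAddCommGroup P] [NormedSpace ℝ P] (v v' : P) (F : P → ℂ)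
    (p : P) : dirDeriv (v + v') F p = dirDeriv v F p + dirDeriv v' F p := map_add _ _ _

lemma dirDeriv_smul_dir {P : Type*} [NormedAddCommGroup P] [NormedSpace ℝ P] (c : ℝ) (v : P)
    (F : P → ℂ) (p : P) : dirDeriv (c • v) F p = (c : ℂ) * dirDeriv v F p := by
  rw [dirDeriv, map_smul]; simp [dirDeriv]

lemma IsBiperiodic.dirDeriv {F : Pair → ℂ} (hF : IsBiperiodic F) (v : Pair) :
    IsBiperiodic (dirDeriv v F) := by
  intro l l' q
  have h : (fun q => F (q + ((latticeVec l, 0), (latticeVec l', 0)))) = F := funext (hF l l')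
  rw [MagneticWeyl.dirDeriv, MagneticWeyl.dirDeriv, ← fderiv_comp_add_right, h]

/-- Biperiodic functions all of whose derivatives are bounded by multiples of `w`. -/
def bisymbols (w : Pair → ℝ) : Submodule ℂ (Pair → ℂ) where
  carrier := {F | HasSymbolBound w F ∧ IsBiperiodic F}
  zero_mem' := ⟨.zero w, fun _ _ _ => rfl⟩
  add_mem' := fun h h' => ⟨h.1.add h'.1, fun l l' q => by simp only [Pi.add_apply, h.2 l l', h'.2 l l']⟩
  smul_mem' := fun c _ h => ⟨h.1.const_mul c, fun l l' q => by simp only [Pi.smul_apply, h.2 l l']⟩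

variable {w : Pair → ℝ} {A : ℝ} {s : ℕ}

/-- A directional derivative as an operator on bisymbols. -/
noncomputable def diffOp (w : Pair → ℝ) (v : Pair) : Module.End ℂ (bisymbols w) where
  toFun F := ⟨dirDeriv v F, F.2.1.dirDeriv v, F.2.2.dirDeriv v⟩
  map_add' F G := Subtype.ext (dirDeriv_add F.2.1.smooth G.2.1.smooth v)
  map_smul' c F := Subtype.ext (dirDeriv_const_mul F.2.1.smooth c v)

lemma diffOp_apply (v : Pair) (F : bisymbols w) : (diffOp w v F : Pair → ℂ) = dirDeriv v F := rfl

lemma commute_diffOp (v v' : Pair) : Commute (diffOp w v) (diffOp w v') :=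
  LinearMap.ext fun F => Subtype.ext (dirDeriv_comm F.2.1.smooth v v')

lemma diffOp_add (v v' : Pair) : diffOp w (v + v') = diffOp w v + diffOp w v' :=
  LinearMap.ext fun F => Subtype.ext (funext fun q => dirDeriv_add_dir v v' F q)

lemma diffOp_smul (c : ℝ) (v : Pair) : diffOp w (c • v) = (c : ℂ) • diffOp w v :=
  LinearMap.ext fun F => Subtype.ext (funext fun q => dirDeriv_smul_dir c v F q)

lemma diffOp_neg (v : Pair) : diffOp w (-v) = -diffOp w v :=
  LinearMap.ext fun _ => Subtype.ext (funext fun _ => map_neg _ _)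

/-- The direction of `x_j`. -/
noncomputable def dirX (j : Fin 2) : Pair := ((basisVec j, 0), 0)
/-- The direction of `ξ_j`. -/
noncomputable def dirXi (j : Fin 2) : Pair := ((0, basisVec j), 0)
/-- The direction of `x'_j`. -/
noncomputable def dirX' (j : Fin 2) : Pair := (0, (basisVec j, 0))
/-- The direction of `ξ'_j`. -/
noncomputable def dirXi' (j : Fin 2) : Pair := (0, (0, basisVec j))

/-- The part `D_{x'} · D_ξ - D_x · D_{ξ'}` of the bidifferential operator. -/
noncomputable def symplOp (w : Pair → ℝ) : Module.End ℂ (bisymbols w) :=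
  (-1 : ℂ) • (∑ j, diffOp w (dirX' j) * diffOp w (dirXi j)) + ∑ j, diffOp w (dirX j) * diffOp w (dirXi' j)

/-- The part `β D_{ξ'} ∧ D_ξ` of the bidifferential operator. -/
noncomputable def wedgeOp (w : Pair → ℝ) (β : ℝ) : Module.End ℂ (bisymbols w) :=
  (-β : ℂ) • (diffOp w (dirXi' 0) * diffOp w (dirXi 1)) +
    (β : ℂ) • (diffOp w (dirXi' 1) * diffOp w (dirXi 0))

lemma commute_diffOp_mul (v v₁ v₂ : Pair) : Commute (diffOp w v) (diffOp w v₁ * diffOp w v₂) :=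
  (commute_diffOp _ _).mul_right (commute_diffOp _ _)

lemma commute_diffOp_symplOp (v : Pair) : Commute (diffOp w v) (symplOp w) := by
  unfold symplOp
  refine Commute.add_right (Commute.smul_right ?_ _) ?_ <;>
    exact Commute.sum_right _ _ _ fun _ _ => commute_diffOp_mul _ _ _

lemma commute_diffOp_wedgeOp (v : Pair) (β : ℝ) : Commute (diffOp w v) (wedgeOp w β) := by
  unfold wedgeOp
  refine Commute.add_right (Commute.smul_right ?_ _) (Commute.smul_right ?_ _) <;>
    exact commute_diffOp_mul _ _ _

lemma commute_symplOp_wedgeOp (β : ℝ) : Commute (symplOp w) (wedgeOp w β) := by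
  have h := fun v : Pair => (commute_diffOp_symplOp (w := w) v).symm
  unfold wedgeOp
  refine Commute.add_right (Commute.smul_right ?_ _) (Commute.smul_right ?_ _) <;>
    exact Commute.mul_right (h _) (h _)

/-- The operator `(ih/2) Ω_h` on bisymbols. -/
noncomputable def starExponent (w : Pair → ℝ) (β h : ℝ) : Module.End ℂ (bisymbols w) :=
  (Complex.I / 2) • ((h : ℂ) • symplOp w + ((h : ℂ) ^ 2) • wedgeOp w β)

/-- The derivative in `h` of `(ih/2) Ω_h`. -/
noncomputable def starGenerator (w : Pair → ℝ) (β h : ℝ) : Module.End ℂ (bisymbols w) :=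
  (Complex.I / 2) • (symplOp w + (2 * (h : ℂ)) • wedgeOp w β)

/-- Both are polynomials in constant-coefficient derivatives, so the exponential series can be
differentiated in `h` as if it were scalar. -/
lemma commute_starGenerator_starExponent (β h : ℝ) :
    Commute (starGenerator w β h) (starExponent w β h) := by
  have h1 := commute_symplOp_wedgeOp (w := w) β
  refine Commute.smul_left (Commute.smul_right ?_ _) _
  exact (((Commute.refl _).smul_right _).add_right (h1.smul_right _)).add_left
    ((((h1.symm).smul_right _).add_right ((Commute.refl _).smul_right _)).smul_left _)

lemma commute_diffOp_starExponent (v : Pair) (β h : ℝ) :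
    Commute (diffOp w v) (starExponent w β h) :=
  (((commute_diffOp_symplOp v).smul_right _).add_right
    ((commute_diffOp_wedgeOp v β).smul_right _)).smul_right _

/-- The operators carry no topology here, so differentiability is tested with linear functionals.
The induction peels off one factor, which is a polynomial in `h` with operator coefficients, and
commutation gathers the generators on the right. -/
lemma hasDerivAt_starExponent_pow (β : ℝ) (n : ℕ) (L : Module.End ℂ (bisymbols w) →ₗ[ℂ] ℂ) (h : ℝ) :
    HasDerivAt (fun h : ℝ => L (starExponent w β h ^ n))
      (n * L (starExponent w β h ^ (n - 1) * starGenerator w β h)) h := by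
  induction n generalizing L with
  | zero => simpa using hasDerivAt_const h (L 1)
  | succ n ih =>
    have e : ∀ T U : Module.End ℂ (bisymbols w), ∀ h : ℝ, T * starExponent w β h * U =
        (Complex.I / 2) • ((h : ℂ) • (T * (symplOp w * U)) + ((h : ℂ) ^ 2) • (T * (wedgeOp w β * U))) := by
      intro T U h
      simp only [starExponent, mul_smul_comm, mul_add, smul_mul_assoc, add_mul, mul_assoc]
    have e2 : ∀ T U : Module.End ℂ (bisymbols w), ∀ h : ℝ, T * starGenerator w β h * U =
        (Complex.I / 2) • ((T * (symplOp w * U)) + (2 * (h : ℂ)) • (T * (wedgeOp w β * U))) := by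
      intro T U h
      simp only [starGenerator, mul_smul_comm, mul_add, smul_mul_assoc, add_mul, mul_assoc]
    -- Absorbing the peeled-off factor into the functional is the reason for quantifying over all
    -- `L`.
    have hA := ih (L.comp (LinearMap.mulRight ℂ (symplOp w)))
    have hW := ih (L.comp (LinearMap.mulRight ℂ (wedgeOp w β)))
    have hid : HasDerivAt (fun h : ℝ => (h : ℂ)) 1 h := Complex.ofRealCLM.hasDerivAt
    have hsq : HasDerivAt (fun h : ℝ => (h : ℂ) ^ 2) (2 * (h : ℂ)) h := by
      simpa using hid.fun_pow 2
    have key := ((hid.mul hA).add (hsq.mul hW)).const_mul (Complex.I / 2)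
    refine (key.congr_deriv ?_).congr_of_eventuallyEq (Eventually.of_forall fun t => ?_)
    · simp only [LinearMap.comp_apply, LinearMap.mulRight_apply]
      have hc := commute_starGenerator_starExponent (w := w) β h
      have h1 : (starExponent w β h ^ n) * starGenerator w β h =
        (Complex.I / 2) • ((starExponent w β h ^ n) * symplOp w +
          (2 * (h : ℂ)) • ((starExponent w β h ^ n) * wedgeOp w β)) := by
        simpa using e2 (starExponent w β h ^ n) 1 h
      rcases n with _ | n
      · simp only [Nat.add_sub_cancel, h1, map_smul, map_add, smul_eq_mul]; simp
      · have h2 : starExponent w β h ^ (n + 1) * starGenerator w β h =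
          (starExponent w β h ^ n * starGenerator w β h) * starExponent w β h := by
          rw [pow_succ, mul_assoc, mul_assoc, hc.eq]
        have h3 := e (starExponent w β h ^ n * starGenerator w β h) 1 h
        simp only [mul_one] at h3
        have h4 := congrArg L h1
        have h5 := congrArg L (h2.trans h3)
        simp only [map_smul, map_add, smul_eq_mul, Nat.add_sub_cancel] at h4 h5 ⊢
        push_cast
        linear_combination (-1 : ℂ) * h4 - ((n : ℂ) + 1) * h5
    · simp only [LinearMap.comp_apply, LinearMap.mulRight_apply, Pi.mul_apply, Pi.add_apply]
      rw [pow_succ]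
      have := e (starExponent w β t ^ n) 1 t
      simp only [mul_one] at this
      rw [this]
      simp only [map_smul, map_add, smul_eq_mul]

/-! ### Linearity of the star product -/

section Linear

variable {χ : Plane × Plane → ℂ} (hχ : ContDiff ℝ ∞ χ) (hc : HasCompactSupport χ)
  (hw : ModerateWeight w A s)

lemma integrable_mul_starKernel {χ : Plane × Plane → ℂ} (hχ : ContDiff ℝ ∞ χ)
    (hc : HasCompactSupport χ) (β h : ℝ) {F : Pair → ℂ} (hF : Continuous F) (z : Pair) (k : Lat₂) :
    Integrable fun p => χ p * starKernel β h F z k p :=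
  (hχ.continuous.mul (continuous_starKernel _ h hF z k)).integrable_of_hasCompactSupport hc.mul_right

/-- The value at `z` of the star product, as a linear functional of the bisymbol. -/
noncomputable def starLin (hχ : ContDiff ℝ ∞ χ) (hc : HasCompactSupport χ)
    (hw : ModerateWeight w A s) (β h : ℝ) (z : Pair) : bisymbols w →ₗ[ℂ] ℂ where
  toFun F := starSum χ β h F z
  map_add' F G := by
    refine (hasSum_starKernel hw (F + G).2.1 hχ hc β h z).unique
      (((hasSum_starKernel hw F.2.1 hχ hc β h z).add
        (hasSum_starKernel hw G.2.1 hχ hc β h z)).congr_fun fun k => ?_ |> id)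
    rw [← integral_add (integrable_mul_starKernel hχ hc β h F.2.1.smooth.continuous z k)
      (integrable_mul_starKernel hχ hc β h G.2.1.smooth.continuous z k)]
    refine integral_congr_ae (Eventually.of_forall fun p => ?_)
    simp only [starKernel, Submodule.coe_add, Pi.add_apply]; ring
  map_smul' c F := by
    refine (hasSum_starKernel hw (c • F).2.1 hχ hc β h z).unique
      (((hasSum_starKernel hw F.2.1 hχ hc β h z).mul_left c).congr_fun fun k => ?_ |> id)
    rw [← integral_const_mul]
    refine integral_congr_ae (Eventually.of_forall fun p => ?_)
    simp only [starKernel, Submodule.coe_smul, Pi.smul_apply, smul_eq_mul]; ring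

lemma starLin_apply (hχ : ContDiff ℝ ∞ χ) (hc : HasCompactSupport χ)
    (hw : ModerateWeight w A s) (β h : ℝ) (z : Pair) (F : bisymbols w) :
    starLin hχ hc hw β h z F = starSum χ β h F z := rfl

end Linear

/-! ### Integration by parts -/

lemma hasFDerivAt_coord (i : Fin 2) (L : Plane × Plane →L[ℝ] Plane) (p : Plane × Plane) :
    HasFDerivAt (fun p => L p i) ((coordCLM i).comp L) p :=
  ((coordCLM i).comp L).hasFDerivAt

lemma fderiv_wedge (p v : Plane × Plane) :
    fderiv ℝ (fun p : Plane × Plane => wedge p.1 p.2) p v = wedge v.1 p.2 + wedge p.1 v.2 := by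
  have f := fun i => hasFDerivAt_coord i (ContinuousLinearMap.fst ℝ Plane Plane) p
  have g := fun i => hasFDerivAt_coord i (ContinuousLinearMap.snd ℝ Plane Plane) p
  have h := ((f 0).fun_mul (g 1)).fun_sub ((f 1).fun_mul (g 0))
  have e : (fun p : Plane × Plane => wedge p.1 p.2) =
    (fun p => (ContinuousLinearMap.fst ℝ Plane Plane) p 0 * (ContinuousLinearMap.snd ℝ Plane Plane) p 1
      - (ContinuousLinearMap.fst ℝ Plane Plane) p 1 * (ContinuousLinearMap.snd ℝ Plane Plane) p 0) := rfl
  rw [e, h.fderiv]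
  simp [wedge, coordCLM]
  ring

lemma fderiv_cexp_I {V : Type*} [NormedAddCommGroup V] [NormedSpace ℝ V] {f : V → ℝ} {p : V}
    (hf : DifferentiableAt ℝ f p) (v : V) :
    fderiv ℝ (fun y => Complex.exp (Complex.I * ((f y : ℝ) : ℂ))) p v =
      Complex.I * (fderiv ℝ f p v : ℝ) * Complex.exp (Complex.I * ((f p : ℝ) : ℂ)) := by
  have h1 : HasFDerivAt (fun y => ((f y : ℝ) : ℂ)) (Complex.ofRealCLM.comp (fderiv ℝ f p)) p :=
    Complex.ofRealCLM.hasFDerivAt.comp p hf.hasFDerivAt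
  rw [((h1.const_mul Complex.I).cexp).fderiv]
  simp; ring

lemma fderiv_starKernel (β h : ℝ) {F : Pair → ℂ} (hF : ContDiff ℝ ∞ F) (z : Pair) (k : Lat₂)
    (p v : Plane × Plane) :
    fderiv ℝ (starKernel β h F z k) p v =
      Complex.I * ((freqPhase₂ k v + 2 * β * (wedge v.1 p.2 + wedge p.1 v.2) : ℝ) : ℂ) *
        starKernel β h F z k p + starKernel β h (dirDeriv (starMap h β v) F) z k p := by
  have hθ : ContDiff ℝ ∞ fun p : Plane × Plane => freqPhase₂ k p + 2 * β * wedge p.1 p.2 :=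
    (freqPhase₂ k).contDiff.add (contDiff_const.mul contDiff_wedge)
  have e : ∀ F : Pair → ℂ, starKernel β h F z k = fun p =>
      Complex.exp (Complex.I * ((freqPhase₂ k p + 2 * β * wedge p.1 p.2 : ℝ) : ℂ)) *
        F (z + starMap h β p + h • unitShift k) := by
    intro F; funext p
    rw [starKernel, ← mul_assoc, phase_mul_starPhase]
  have h1 : HasFDerivAt (fun p => F (z + starMap h β p + h • unitShift k))
      ((fderiv ℝ F (z + starMap h β p + h • unitShift k)).comp (starMap h β)) p :=
    (hF.differentiable (by simp) _).hasFDerivAt.comp p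
      (((starMap h β).hasFDerivAt.const_add z).add_const _)
  have h2 := ((contDiff_cexp_I hθ).differentiable (by simp) p).hasFDerivAt
  have h3 := fderiv_cexp_I (hθ.differentiable (by simp) p) v
  have h4 : fderiv ℝ (fun p : Plane × Plane => freqPhase₂ k p + 2 * β * wedge p.1 p.2) p v =
      freqPhase₂ k v + 2 * β * (wedge v.1 p.2 + wedge p.1 v.2) := by
    rw [fderiv_fun_add (freqPhase₂ k).differentiableAt
      ((contDiff_const.mul contDiff_wedge).differentiable (by simp) p),
      fderiv_const_mul (contDiff_wedge.differentiable (by simp) p)]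
    simp [fderiv_wedge]
  rw [h4] at h3
  rw [e, e]
  rw [(h2.fun_mul h1).fderiv]
  simp only [_root_.add_apply, _root_.smul_apply, smul_eq_mul, h3,
    ContinuousLinearMap.comp_apply, dirDeriv]
  ring

lemma integral_fderiv_eq_zero {V : Type} [NormedAddCommGroup V] [NormedSpace ℝ V]
    [FiniteDimensional ℝ V] [MeasureSpace V] [BorelSpace V]
    [(volume : Measure V).IsAddHaarMeasure] {H : V → ℂ} (hH : ContDiff ℝ ∞ H)
    (hc : HasCompactSupport H) (v : V) : ∫ p, fderiv ℝ H p v = 0 := by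
  have hi : Integrable H := hH.continuous.integrable_of_hasCompactSupport hc
  have hi' : Integrable fun p => fderiv ℝ H p v :=
    (contDiff_fderiv_apply hH v).continuous.integrable_of_hasCompactSupport (hc.fderiv_apply ℝ v)
  -- With zero phase, integration by parts says that the derivative has vanishing integral.
  have := integral_phase_smul_fderiv (0 : V →L[ℝ] ℝ) hH hi v hi'
  simpa [phase] using this

lemma contDiff_starKernel (β h : ℝ) {F : Pair → ℂ} (hF : ContDiff ℝ ∞ F) (z : Pair) (k : Lat₂) :
    ContDiff ℝ ∞ (starKernel β h F z k) :=
  (contDiff_phase _).mul ((contDiff_starPhase β).mul (contDiff_shear hF _ _ _))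

/-- Integration by parts in the star product. -/
theorem hasSum_starKernel_mul (hβ : ∃ n : ℤ, β = 2 * Real.pi * n) (hw : ModerateWeight w A s)
    (F : bisymbols w) {χ : Plane × Plane → ℝ} (hχ : IsLatticeCutoff χ) (h : ℝ) (z : Pair)
    (v : Plane × Plane) :
    HasSum (fun k => ∫ p, (χ p : ℂ) *
      (Complex.I * ((freqPhase₂ k v + 2 * β * (wedge v.1 p.2 + wedge p.1 v.2) : ℝ) : ℂ) *
        starKernel β h F z k p))
      (-starSum (fun p => χ p) β h (dirDeriv (starMap h β v) F) z) := by
  have hd := contDiff_ofReal_comp hχ.1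
  have hcs := hasCompactSupport_ofReal_comp hχ.2.1
  have hd' := contDiff_fderiv_apply hd v
  have hcs' := hcs.fderiv_apply ℝ v
  have h1 := hasSum_starKernel hw F.2.1 hd' hcs' β h z
  -- The terms with the derivative of the cutoff need not vanish individually; their sum over all
  -- frequencies does, because the translates of that derivative cancel.
  rw [starSum_eq_zero hβ hw F.2.1 F.2.2 hd' hcs' (fun y => hasSum_fderiv_translates
    poissonFamily_freqPhase₂.finite hd hcs hχ.hasSum_add v y)] at h1
  have h2 := hasSum_starKernel hw (diffOp w (starMap h β v) F).2.1 hd hcs β h z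
  have h3 := (h1.add h2).neg
  rw [zero_add] at h3
  refine h3.congr_fun fun k => ?_ |> id
  have hJ := contDiff_starKernel β h F.2.1.smooth z k
  have h0 := integral_fderiv_eq_zero (hd.mul hJ) hcs.mul_right v
  have e : ∀ p, fderiv ℝ (fun p => (χ p : ℂ) * starKernel β h F z k p) p v =
      fderiv ℝ (fun p => (χ p : ℂ)) p v * starKernel β h F z k p +
      (χ p : ℂ) * starKernel β h (diffOp w (starMap h β v) F) z k p +
      (χ p : ℂ) *
      (Complex.I * ((freqPhase₂ k v + 2 * β * (wedge v.1 p.2 + wedge p.1 v.2) : ℝ) : ℂ) *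
        starKernel β h F z k p) := by
    intro p
    rw [fderiv_fun_mul (hd.differentiable (by simp) p) (hJ.differentiable (by simp) p)]
    simp only [_root_.add_apply, _root_.smul_apply, smul_eq_mul,
      fderiv_starKernel β h F.2.1.smooth z k p v, diffOp_apply]
    ring
  have hi1 := integrable_mul_starKernel hd' hcs' β h F.2.1.smooth.continuous z k
  have hi2 := integrable_mul_starKernel hd hcs β h
    (diffOp w (starMap h β v) F).2.1.smooth.continuous z k
  have hi3 : Integrable fun p => (χ p : ℂ) *
      (Complex.I * ((freqPhase₂ k v + 2 * β * (wedge v.1 p.2 + wedge p.1 v.2) : ℝ) : ℂ) *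
        starKernel β h F z k p) := by
    refine Continuous.integrable_of_hasCompactSupport (hd.continuous.mul
      ((continuous_const.mul (Complex.continuous_ofReal.comp ?_)).mul hJ.continuous)) hcs.mul_right
    unfold wedge
    fun_prop
  have e2 : (fun p => fderiv ℝ ((fun p => (χ p : ℂ)) * starKernel β h F z k) p v) = _ :=
    funext e
  rw [show (fun p => (χ p : ℂ) * starKernel β h F z k p) = (fun p => (χ p : ℂ)) * starKernel β h F z k
    from rfl] at h0
  have s1 := integral_add (hi1.add hi2) hi3
  have s2 := integral_add hi1 hi2
  simp only [Pi.add_apply] at s1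
  rw [e2, s1, s2] at h0
  linear_combination h0

/-! ### The derivative of the star product in `h` -/

variable {w : Pair → ℝ} {A : ℝ} {s : ℕ} {β : ℝ}

lemma perp_basisVec_zero : perp (basisVec 0) = basisVec 1 := by
  ext i; fin_cases i <;> simp [perp, basisVec]

lemma perp_basisVec_one : perp (basisVec 1) = -basisVec 0 := by
  ext i; fin_cases i <;> simp [perp, basisVec]

lemma starMap_inr_zero (h β : ℝ) :
    starMap h β (0, basisVec 0) = -dirX' 0 + (h * β) • dirXi' 1 := by
  rw [starMap_apply, perp_basisVec_zero]
  simp [dirX', dirXi', perp, Prod.ext_iff]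

lemma starMap_inr_one (h β : ℝ) :
    starMap h β (0, basisVec 1) = -dirX' 1 + (-(h * β)) • dirXi' 0 := by
  rw [starMap_apply, perp_basisVec_one]
  simp [dirX', dirXi', perp, Prod.ext_iff]

lemma starMap_inl_zero (h β : ℝ) :
    starMap h β (basisVec 0, 0) = -dirX 0 + (h * β) • dirXi 1 := by
  rw [starMap_apply, perp_basisVec_zero]
  simp [dirX, dirXi, perp, Prod.ext_iff]

lemma starMap_inl_one (h β : ℝ) :
    starMap h β (basisVec 1, 0) = -dirX 1 + (-(h * β)) • dirXi 0 := by
  rw [starMap_apply, perp_basisVec_one]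
  simp [dirX, dirXi, perp, Prod.ext_iff]

/-- The phase derivatives that occur in the integration by parts. -/
noncomputable def phaseSlope (β : ℝ) (k : Lat₂) (v p : Plane × Plane) : ℝ :=
  freqPhase₂ k v + 2 * β * (wedge v.1 p.2 + wedge p.1 v.2)

/-- The left side is the velocity in `h` of the argument of the bisymbol. Its `ξ` part is half the
`y'`-gradient of the phase and its `ξ'` part is minus half the `y`-gradient; this allows integration
by parts to remove every factor that grows with the frequency. -/
lemma starSlope_add_unitShift (β : ℝ) (k : Lat₂) (p : Plane × Plane) :
    starSlope β p + unitShift k =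
      (1 / 2 * phaseSlope β k (0, basisVec 0) p) • dirXi 0 +
      (1 / 2 * phaseSlope β k (0, basisVec 1) p) • dirXi 1 +
      ((-1 / 2 * phaseSlope β k (basisVec 0, 0) p) • dirXi' 0 +
      (-1 / 2 * phaseSlope β k (basisVec 1, 0) p) • dirXi' 1) := by
  simp only [starSlope_apply, unitShift, phaseSlope, freqPhase₂_apply, freqPhase_apply, inner_eq]
  refine Prod.ext (Prod.ext ?_ ?_) (Prod.ext ?_ ?_) <;> ext i <;> fin_cases i <;>
    simp [dirXi, dirXi', perp, wedge, basisVec] <;> ring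

/-- The derivative in `h` puts phase gradients in front of `∂_ξ F` and `∂_{ξ'} F`. Integration by
parts exchanges a gradient in `y'` for `-∂_{x'}` plus a term `hβ ∂_{ξ'}`, and a gradient in `y`
likewise for the unprimed variables. The two wedge contributions coincide, which explains the factor
`2h` in `starGenerator`. -/
theorem hasDerivAt_starSum (hβ : ∃ n : ℤ, β = 2 * Real.pi * n) (hw : ModerateWeight w A s)
    (F : bisymbols w) {χ : Plane × Plane → ℝ} (hχ : IsLatticeCutoff χ) (h : ℝ) (z : Pair) :
    HasDerivAt (fun h => starSum (fun p => χ p) β h F z)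
      (starSum (fun p => χ p) β h (starGenerator w β h F) z) h := by
  have hd := contDiff_ofReal_comp hχ.1
  have hc := hasCompactSupport_ofReal_comp hχ.2.1
  obtain ⟨B, -, hB⟩ := F.2.1.oscBounded_star hw hc β (|h| + 1)
  obtain ⟨B', -, hB'⟩ := F.2.1.choose_spec.exists_oscBounded_fderiv hw
    (hasCompactSupport_starCutoff hc β) (ν := latSize) (K := Lat₂) one_le_latSize
    (‖starBase‖ + (|h| + 1) * ‖starSlope β‖) ((|h| + 1) * (2 * Real.pi)) (starSlope β)
    norm_unitShift_le
  have hball : ∀ t ∈ Metric.ball h 1, |t| ≤ |h| + 1 := fun t ht => by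
    have h1 := abs_sub_abs_le_abs_sub t h
    rw [Metric.mem_ball, Real.dist_eq] at ht
    linarith
  have key := hasDerivAt_oscSum phaseFamily_freqPhase₂ (contDiff_starCutoff hd β)
    (hasCompactSupport_starCutoff hc β) (t₀ := h) one_pos
    (f := fun t k y => (F : Pair → ℂ) (z + starMap t β y + t • unitShift k))
    (f' := fun t k y => fderiv ℝ (F : Pair → ℂ) (z + starMap t β y + t • unitShift k)
      (starSlope β y + unitShift k))
    (fun t ht => hB t (hball t ht) z)
    (fun t ht => hB' _ _ (norm_starMap_le _ _ (hball t ht)) (norm_smul_unitShift_le (hball t ht)) z)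
    (fun t _ k y _ => ?_)
  · refine key.congr_deriv ?_
    have hs := fun (v : Plane × Plane) (G : bisymbols w) => hasSum_starKernel_mul hβ hw G hχ h z v
    -- The signs are those of `starSlope_add_unitShift`, and the later factor `1 / (2i)` turns `i`
    -- times a phase gradient into half of it.
    have h1 := ((hs (0, basisVec 0) (diffOp w (dirXi 0) F)).add
      (hs (0, basisVec 1) (diffOp w (dirXi 1) F))).sub ((hs (basisVec 0, 0) (diffOp w (dirXi' 0) F)).add
      (hs (basisVec 1, 0) (diffOp w (dirXi' 1) F)))
    have h2 := h1.mul_left (1 / (2 * Complex.I))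
    have hi : ∀ (v : Plane × Plane) (G : bisymbols w) (k : Lat₂), Integrable fun p => (χ p : ℂ) *
      (Complex.I * ((freqPhase₂ k v + 2 * β * (wedge v.1 p.2 + wedge p.1 v.2) : ℝ) : ℂ) *
        starKernel β h G z k p) := by
      intro v G k
      refine Continuous.integrable_of_hasCompactSupport (hd.continuous.mul
        ((continuous_const.mul (Complex.continuous_ofReal.comp ?_)).mul
          (continuous_starKernel β h G.2.1.smooth.continuous z k))) hc.mul_right
      unfold wedge
      fun_prop
    refine ((tsum_congr fun k => ?_).trans h2.tsum_eq).trans ?_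
    · have i₁ := hi (0, basisVec 0) (diffOp w (dirXi 0) F) k
      have i₂ := hi (0, basisVec 1) (diffOp w (dirXi 1) F) k
      have i₃ := hi (basisVec 0, 0) (diffOp w (dirXi' 0) F) k
      have i₄ := hi (basisVec 1, 0) (diffOp w (dirXi' 1) F) k
      have t := integral_sub (i₁.add i₂) (i₃.add i₄)
      simp only [Pi.add_apply] at t
      rw [← integral_add i₁ i₂, ← integral_add i₃ i₄, ← t, ← integral_const_mul]
      refine integral_congr_ae (Eventually.of_forall fun p => ?_)
      simp only [starSlope_add_unitShift, map_add, map_smul, smul_eq_mul, starKernel, diffOp_apply,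
        dirDeriv, Complex.real_smul, phaseSlope]
      push_cast
      field_simp
      ring
    have hL := fun G : bisymbols w => (starLin_apply hd hc hw β h z G).symm
    have hv : ∀ (v : Pair) (G : bisymbols w), starSum (fun p => (χ p : ℂ)) β h (dirDeriv v G) z =
        starLin hd hc hw β h z (diffOp w v G) := fun v G => hL (diffOp w v G)
    have hcomm : ∀ i j, diffOp w (dirXi i) (diffOp w (dirXi' j) F) =
        diffOp w (dirXi' j) (diffOp w (dirXi i) F) := fun i j =>
      LinearMap.congr_fun (commute_diffOp (dirXi i) (dirXi' j)).eq F
    simp only [hv, hL, hcomm, starMap_inr_zero, starMap_inr_one, starMap_inl_zero, starMap_inl_one,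
      diffOp_add, diffOp_neg, diffOp_smul, starGenerator, symplOp, wedgeOp, Fin.sum_univ_two,
      LinearMap.add_apply, LinearMap.smul_apply, LinearMap.neg_apply, map_add, map_smul, map_neg,
      smul_eq_mul, Module.End.mul_apply]
    push_cast
    field_simp
    rw [Complex.I_sq]
    ring
  · have e : HasDerivAt (fun t : ℝ => z + starMap t β y + t • unitShift k)
        (starSlope β y + unitShift k) t := by
      -- The argument is affine in `t`, with constant velocity `starSlope β y + unitShift k`.
      have e1 : HasDerivAt (fun t : ℝ => (z + starBase y) + t • (starSlope β y + unitShift k))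
          ((1 : ℝ) • (starSlope β y + unitShift k)) t :=
        ((hasDerivAt_id t).smul_const _).const_add _
      rw [one_smul] at e1
      refine e1.congr_of_eventuallyEq (Eventually.of_forall fun t => ?_)
      simp only [starMap, _root_.add_apply, _root_.smul_apply, smul_add]
      abel
    exact (F.2.1.smooth.differentiable (by simp) _).hasFDerivAt.comp_hasDerivAt t e

/-! ### Remainders of the expansion -/

/-- The remainder of order `N` in the expansion of the star product. -/
noncomputable def starRemainder (χ : Plane × Plane → ℝ) (β : ℝ) (N : ℕ) (h : ℝ) (F : bisymbols w)
    (z : Pair) : ℂ :=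
  starSum (fun p => χ p) β h F z -
    ∑ n ∈ Finset.range N, (1 / (n.factorial : ℂ)) * ((starExponent w β h ^ n) F : Pair → ℂ) z

/-- Evaluation of the image of a bisymbol, as a functional on operators. -/
noncomputable def evalOp (F : bisymbols w) (z : Pair) : Module.End ℂ (bisymbols w) →ₗ[ℂ] ℂ where
  toFun T := (T F : Pair → ℂ) z
  map_add' _ _ := rfl
  map_smul' _ _ := rfl

/-- As for the exponential series, differentiation lowers the number of terms by one and brings out
the generator. -/
lemma hasDerivAt_starRemainder (hβ : ∃ n : ℤ, β = 2 * Real.pi * n) (hw : ModerateWeight w A s)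
    (F : bisymbols w) {χ : Plane × Plane → ℝ} (hχ : IsLatticeCutoff χ) (N : ℕ) (h : ℝ) (z : Pair) :
    HasDerivAt (fun h => starRemainder χ β (N + 1) h F z)
      (starRemainder χ β N h (starGenerator w β h F) z) h := by
  refine (hasDerivAt_starSum hβ hw F hχ h z).fun_sub ?_
  have h1 : HasDerivAt (fun h => ∑ n ∈ Finset.range (N + 1), (1 / (n.factorial : ℂ)) *
      ((starExponent w β h ^ n) F : Pair → ℂ) z)
      (∑ n ∈ Finset.range (N + 1), (1 / (n.factorial : ℂ)) *
        (n * ((starExponent w β h ^ (n - 1)) (starGenerator w β h F) : Pair → ℂ) z)) h :=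
    HasDerivAt.fun_sum fun n _ => (hasDerivAt_starExponent_pow β n (evalOp F z) h).const_mul _
  refine h1.congr_deriv ?_
  rw [Finset.sum_range_succ']
  simp only [Nat.add_sub_cancel, Nat.cast_zero, zero_mul, mul_zero, add_zero]
  refine Finset.sum_congr rfl fun n _ => ?_
  rw [Nat.factorial_succ]
  have : (n.factorial : ℂ) ≠ 0 := by exact_mod_cast n.factorial_ne_zero
  have h2 : ((n + 1 : ℕ) : ℂ) ≠ 0 := by exact_mod_cast n.succ_ne_zero
  rw [Nat.cast_mul]
  field_simp

/-- At `h = 0` only the term `n = 0` survives, and it cancels the value of the star series. At least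
one term is required, hence `N + 1`. -/
lemma starRemainder_zero (hβ : ∃ n : ℤ, β = 2 * Real.pi * n) (F : bisymbols w)
    {χ : Plane × Plane → ℝ} (hχ : IsLatticeCutoff χ) (N : ℕ) (z : Pair) :
    starRemainder χ β (N + 1) 0 F z = 0 := by
  rw [starRemainder, starSum_zero hβ F.2.1.smooth F.2.2 hχ, Finset.sum_range_succ']
  have : starExponent w β 0 = 0 := by simp [starExponent]
  simp [this]

/-- Needed to split `G_h F` into two bisymbols that do not depend on `h`, with scalar coefficients.
-/
lemma starRemainder_add_smul (hw : ModerateWeight w A s) {χ : Plane × Plane → ℝ}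
    (hχ : IsLatticeCutoff χ) (N : ℕ) (h : ℝ) (F G : bisymbols w) (c : ℂ) (z : Pair) :
    starRemainder χ β N h (F + c • G) z =
      starRemainder χ β N h F z + c * starRemainder χ β N h G z := by
  have e : starSum (fun p => χ p) β h (F + c • G : bisymbols w) z =
      starSum (fun p => χ p) β h F z + c * starSum (fun p => χ p) β h G z := by
    have := fun G : bisymbols w => (starLin_apply (contDiff_ofReal_comp hχ.1)
      (hasCompactSupport_ofReal_comp hχ.2.1) hw β h z G).symm
    rw [this, this, this, map_add, map_smul, smul_eq_mul]
  rw [starRemainder, e, starRemainder, starRemainder]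
  simp only [map_add, map_smul, Submodule.coe_add, Submodule.coe_smul,
    Pi.add_apply, Pi.smul_apply, smul_eq_mul, mul_add, Finset.sum_add_distrib]
  rw [mul_sub, Finset.mul_sum]
  have : ∀ n ∈ Finset.range N, (1 / (n.factorial : ℂ)) *
      (c * ((starExponent w β h ^ n) G : Pair → ℂ) z) =
      c * ((1 / (n.factorial : ℂ)) * ((starExponent w β h ^ n) G : Pair → ℂ) z) :=
    fun n _ => by ring
  rw [Finset.sum_congr rfl this]
  ring

/-- The remainder of order `N` is `O(h^N)`. -/
theorem exists_norm_starRemainder_le (hβ : ∃ n : ℤ, β = 2 * Real.pi * n) (hw : ModerateWeight w A s)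
    {χ : Plane × Plane → ℝ} (hχ : IsLatticeCutoff χ) (N : ℕ) (F : bisymbols w) :
    ∃ C, 0 ≤ C ∧ ∀ h ∈ Set.Icc (0 : ℝ) 1, ∀ z, ‖starRemainder χ β N h F z‖ ≤ C * h ^ N * w z := by
  induction N generalizing F with
  | zero =>
    obtain ⟨C, hC⟩ := exists_norm_starSum_le hw F.2.1 (contDiff_ofReal_comp hχ.1)
      (hasCompactSupport_ofReal_comp hχ.2.1) β 1
    refine ⟨|C|, abs_nonneg _, fun h hh z => ?_⟩
    have hz := (hw.pos z).le
    simp only [starRemainder, Finset.range_zero, Finset.sum_empty, sub_zero, pow_zero, mul_one]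
    refine (hC h (abs_le.2 ⟨by linarith [hh.1], hh.2⟩) z).trans ?_
    gcongr
    exact le_abs_self C
  | succ N ih =>
    -- The generator at `t` is a fixed operator plus `2t` times another, so the induction hypothesis
    -- is applied to two fixed bisymbols and its constants do not depend on `t`.
    obtain ⟨C₁, hC₁, H₁⟩ := ih ((Complex.I / 2) • symplOp w F)
    obtain ⟨C₂, hC₂, H₂⟩ := ih ((Complex.I / 2) • wedgeOp w β F)
    refine ⟨C₁ + 2 * C₂, by positivity, fun h hh z => ?_⟩
    have hz := hw.pos z
    have hder : ∀ t ∈ Set.Icc (0 : ℝ) h, ‖starRemainder χ β N t (starGenerator w β t F) z‖ ≤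
        (C₁ + 2 * C₂) * h ^ N * w z := by
      intro t ht
      have ht1 : t ∈ Set.Icc (0 : ℝ) 1 := ⟨ht.1, ht.2.trans hh.2⟩
      have e : starGenerator w β t F =
          (Complex.I / 2) • symplOp w F + (2 * (t : ℂ)) • ((Complex.I / 2) • wedgeOp w β F) := by
        simp only [starGenerator, LinearMap.smul_apply, LinearMap.add_apply, smul_add]
        rw [smul_comm]
      rw [e, starRemainder_add_smul hw hχ]
      refine (norm_add_le _ _).trans ?_
      rw [norm_mul]
      have h2 : ‖(2 * (t : ℂ))‖ ≤ 2 := by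
        rw [norm_mul, Complex.norm_real, Real.norm_of_nonneg ht.1]
        norm_num
        linarith [ht1.2]
      have a1 := H₁ t ht1 z
      have a2 := H₂ t ht1 z
      have a3 : t ^ N ≤ h ^ N := pow_le_pow_left₀ ht.1 ht.2 N
      calc _ ≤ C₁ * t ^ N * w z + 2 * (C₂ * t ^ N * w z) := by gcongr
        _ = (C₁ + 2 * C₂) * t ^ N * w z := by ring
        _ ≤ _ := by gcongr
    -- The remainder vanishes at `0` and has derivative of size `h ^ N` on `[0, h]`, so the length
    -- of the interval supplies the last power.
    have mv := (convex_Icc (0 : ℝ) h).norm_image_sub_le_of_norm_hasDerivWithin_le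
      (f := fun h => starRemainder χ β (N + 1) h F z)
      (fun t _ => (hasDerivAt_starRemainder hβ hw F hχ N t z).hasDerivWithinAt) hder
      (Set.left_mem_Icc.2 hh.1) (Set.right_mem_Icc.2 hh.1)
    simp only [starRemainder_zero hβ F hχ, sub_zero] at mv
    refine mv.trans_eq ?_
    rw [Real.norm_of_nonneg hh.1]
    ring

lemma contDiff_starRemainder (hw : ModerateWeight w A s) {χ : Plane × Plane → ℝ}
    (hχ : IsLatticeCutoff χ) (N : ℕ) (h : ℝ) (F : bisymbols w) :
    ContDiff ℝ ∞ (starRemainder χ β N h F) :=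
  (contDiff_starSum hw F.2.1 (contDiff_ofReal_comp hχ.1) (hasCompactSupport_ofReal_comp hχ.2.1)
    β h).sub (ContDiff.sum fun n _ => contDiff_const.mul (((starExponent w β h ^ n) F).2.1.smooth))

lemma isBiperiodic_starRemainder {χ : Plane × Plane → ℝ} (N : ℕ) (h : ℝ) (F : bisymbols w) :
    IsBiperiodic (starRemainder χ β N h F) := by
  intro l l' q
  rw [starRemainder, starRemainder, isBiperiodic_starSum F.2.2 β h l l' q]
  congr 1
  exact Finset.sum_congr rfl fun n _ => by rw [((starExponent w β h ^ n) F).2.2 l l' q]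

lemma dirDeriv_sum {ι P : Type*} [NormedAddCommGroup P] [NormedSpace ℝ P] {t : Finset ι}
    {f : ι → P → ℂ} (hf : ∀ i ∈ t, ContDiff ℝ ∞ (f i)) (v : P) :
    dirDeriv v (fun p => ∑ i ∈ t, f i p) = fun p => ∑ i ∈ t, dirDeriv v (f i) p := by
  funext p
  simp only [dirDeriv]
  rw [fderiv_fun_sum fun i hi => (hf i hi).differentiable (by simp) p]
  simp

lemma dirDeriv_sub {P : Type*} [NormedAddCommGroup P] [NormedSpace ℝ P] {F G : P → ℂ}
    (hF : ContDiff ℝ ∞ F) (hG : ContDiff ℝ ∞ G) (v : P) :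
    dirDeriv v (fun p => F p - G p) = fun p => dirDeriv v F p - dirDeriv v G p := by
  funext p
  simp only [dirDeriv]
  rw [fderiv_fun_sub (hF.differentiable (by simp) p) (hG.differentiable (by simp) p)]; rfl

/-- The star series and the powers of the exponent both commute with constant-coefficient
derivatives. -/
lemma dirDeriv_starRemainder (hw : ModerateWeight w A s) {χ : Plane × Plane → ℝ}
    (hχ : IsLatticeCutoff χ) (N : ℕ) (h : ℝ) (F : bisymbols w) (v : Pair) :
    dirDeriv v (starRemainder χ β N h F) = starRemainder χ β N h (diffOp w v F) := by
  have hsm := fun n => ((starExponent w β h ^ n) F).2.1.smooth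
  have e := dirDeriv_sub (contDiff_starSum hw F.2.1 (contDiff_ofReal_comp hχ.1)
    (hasCompactSupport_ofReal_comp hχ.2.1) β h)
    (G := fun z => ∑ n ∈ Finset.range N, (1 / (n.factorial : ℂ)) *
      ((starExponent w β h ^ n) F : Pair → ℂ) z)
    (ContDiff.sum fun n _ => contDiff_const.mul (hsm n)) v
  refine e.trans (funext fun z => ?_)
  rw [dirDeriv_starSum hw F.2.1 (contDiff_ofReal_comp hχ.1)
    (hasCompactSupport_ofReal_comp hχ.2.1), dirDeriv_sum fun n _ => contDiff_const.mul (hsm n),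
    starRemainder]
  congr 1
  refine Finset.sum_congr rfl fun n _ => ?_
  have hcomm : diffOp w v ((starExponent w β h ^ n) F) = (starExponent w β h ^ n) (diffOp w v F) :=
    LinearMap.congr_fun ((commute_diffOp_starExponent (w := w) v β h).pow_right n).eq F
  rw [dirDeriv_const_mul (hsm n), ← hcomm]
  rfl

/-! ### Restriction to the diagonal -/

/-- The diagonal embedding of phase space. -/
noncomputable def diagCLM : Phase →L[ℝ] Pair :=
  (ContinuousLinearMap.id ℝ Phase).prod (ContinuousLinearMap.id ℝ Phase)

lemma diagCLM_apply (z : Phase) : diagCLM z = (z, z) := rfl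

lemma iterate_dirDeriv_diag {ι : Type*} (R : ι → bisymbols w → Pair → ℂ)
    (hR : ∀ h F, ContDiff ℝ ∞ (R h F))
    (hd : ∀ h F v, dirDeriv v (R h F) = R h (diffOp w v F)) (v : Phase) (n : ℕ) (h : ι)
    (F : bisymbols w) : (dirDeriv v)^[n] (fun z => R h F (diagCLM z)) =
      fun z => R h ((diffOp w (diagCLM v) ^ n) F) (diagCLM z) := by
  induction n with
  | zero => rfl
  | succ n ih =>
    rw [Function.iterate_succ_apply', ih, dirDeriv_comp_clm (hR _ _), hd, pow_succ']
    rfl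

/-- A derivative along `v` on the diagonal is a derivative along `(v, v)` of the bisymbol, and `R`
commutes with it. The bisymbol `G` does not depend on the parameter, so uniform sup bounds for `R h
G` bound the seminorms uniformly. -/
lemma exists_multiDeriv_diag {ι : Type*} (R : ι → bisymbols w → Pair → ℂ)
    (hR : ∀ h F, ContDiff ℝ ∞ (R h F))
    (hd : ∀ h F v, dirDeriv v (R h F) = R h (diffOp w v F)) (α γ : Fin 2 → ℕ) (F : bisymbols w) :
    ∃ G : bisymbols w, ∀ h, multiDeriv α γ (fun z => R h F (diagCLM z)) =
      fun z => R h G (diagCLM z) := by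
  refine ⟨(diffOp w (diagCLM (basisVec 0, 0)) ^ α 0) ((diffOp w (diagCLM (basisVec 1, 0)) ^ α 1)
    ((diffOp w (diagCLM (0, basisVec 0)) ^ γ 0) ((diffOp w (diagCLM (0, basisVec 1)) ^ γ 1) F))),
    fun h => ?_⟩
  simp only [multiDeriv, dX_eq, dXi_eq]
  rw [iterate_dirDeriv_diag R hR hd, iterate_dirDeriv_diag R hR hd, iterate_dirDeriv_diag R hR hd,
    iterate_dirDeriv_diag R hR hd]

lemma isSmoothPeriodic_diag {H : Pair → ℂ} (hH : ContDiff ℝ ∞ H) (hp : IsBiperiodic H) :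
    IsSmoothPeriodic fun z => H (diagCLM z) := by
  refine ⟨hH.comp diagCLM.contDiff, fun k x ξ => ?_⟩
  have := hp k k (diagCLM (x, ξ))
  simpa [diagCLM_apply] using this

/-! ### The star product of two symbols -/

/-- The weight `⟨ξ⟩^{m₁} ⟨ξ'⟩^{m₂}`. -/
noncomputable def pairWeight (m₁ m₂ : ℝ) (q : Pair) : ℝ := symbolWeight m₁ q.1 * symbolWeight m₂ q.2

lemma symbolWeight_add_le (m : ℝ) (z δ : Phase) :
    symbolWeight m (z + δ) ≤ 2 ^ ⌈|m|⌉₊ * (1 + ‖δ‖) ^ ⌈|m|⌉₊ * symbolWeight m z := by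
  refine (japanese_add_rpow_le m z.2 δ.2).trans ?_
  rw [mul_pow]
  have := norm_snd_le δ
  have := (symbolWeight_pos m z).le
  unfold symbolWeight at *
  gcongr

lemma moderateWeight_symbolWeight (m : ℝ) :
    ModerateWeight (symbolWeight m) (2 ^ ⌈|m|⌉₊) ⌈|m|⌉₊ where
  pos := symbolWeight_pos m
  const_nonneg := by positivity
  le := symbolWeight_add_le m

lemma moderateWeight_pairWeight (m₁ m₂ : ℝ) :
    ModerateWeight (pairWeight m₁ m₂) (2 ^ ⌈|m₁|⌉₊ * 2 ^ ⌈|m₂|⌉₊) (⌈|m₁|⌉₊ + ⌈|m₂|⌉₊) where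
  pos q := mul_pos (symbolWeight_pos _ _) (symbolWeight_pos _ _)
  const_nonneg := by positivity
  le q δ := by
    have h1 := symbolWeight_add_le m₁ q.1 δ.1
    have h2 := symbolWeight_add_le m₂ q.2 δ.2
    have h3 := norm_fst_le δ
    have h4 := norm_snd_le δ
    have p1 := (symbolWeight_pos m₁ q.1).le
    have p2 := (symbolWeight_pos m₂ q.2).le
    have p3 := (symbolWeight_pos m₂ (q.2 + δ.2)).le
    calc pairWeight m₁ m₂ (q + δ) = symbolWeight m₁ (q.1 + δ.1) * symbolWeight m₂ (q.2 + δ.2) := rfl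
      _ ≤ (2 ^ ⌈|m₁|⌉₊ * (1 + ‖δ‖) ^ ⌈|m₁|⌉₊ * symbolWeight m₁ q.1) *
          (2 ^ ⌈|m₂|⌉₊ * (1 + ‖δ‖) ^ ⌈|m₂|⌉₊ * symbolWeight m₂ q.2) := by
        refine mul_le_mul (h1.trans ?_) (h2.trans ?_) p3 (by positivity) <;> gcongr
      _ = _ := by rw [pairWeight, pow_add]; ring

lemma pairWeight_diag (m₁ m₂ : ℝ) (z : Phase) :
    pairWeight m₁ m₂ (diagCLM z) = symbolWeight (m₁ + m₂) z :=
  (Real.rpow_add (japanese_pos _) _ _).symm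

/-- The bisymbol `a(x, ξ) b(x', ξ')`. -/
def tensor (a b : Phase → ℂ) : Pair → ℂ := fun q => a q.1 * b q.2

lemma HasSymbolBound.tensor {w₁ w₂ : Phase → ℝ} {a b : Phase → ℂ} (ha : HasSymbolBound w₁ a)
    (hb : HasSymbolBound w₂ b) : HasSymbolBound (fun q : Pair => w₁ q.1 * w₂ q.2) (tensor a b) :=
  ⟨_, (ha.choose_spec.comp_clm (ContinuousLinearMap.fst ℝ Phase Phase)).mul
    (hb.choose_spec.comp_clm (ContinuousLinearMap.snd ℝ Phase Phase))⟩

lemma isBiperiodic_tensor {a b : Phase → ℂ} (ha : IsSmoothPeriodic a) (hb : IsSmoothPeriodic b) :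
    IsBiperiodic (tensor a b) := by
  intro l l' q
  have h1 := ha.2 l q.1.1 q.1.2
  have h2 := hb.2 l' q.2.1 q.2.2
  have e1 : (q + ((latticeVec l, 0), (latticeVec l', 0))).1 = (q.1.1 + latticeVec l, q.1.2) :=
    Prod.ext rfl (add_zero _)
  have e2 : (q + ((latticeVec l, 0), (latticeVec l', 0))).2 = (q.2.1 + latticeVec l', q.2.2) :=
    Prod.ext rfl (add_zero _)
  rw [MagneticWeyl.tensor, MagneticWeyl.tensor, e1, e2, h1, h2]

/-- The bisymbol of two symbols, as an element of the space of bisymbols. -/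
noncomputable def tensorBisymbol {m₁ m₂ : ℝ} {a b : Phase → ℂ} (ha : a ∈ symbolClass m₁)
    (hb : b ∈ symbolClass m₂) : bisymbols (pairWeight m₁ m₂) :=
  ⟨tensor a b, (mem_symbolClass_iff.1 ha).2.tensor (mem_symbolClass_iff.1 hb).2,
    isBiperiodic_tensor ha.1 hb.1⟩

/-- The star product `a ⋆ b`. -/
noncomputable def starProduct (β h : ℝ) (a b : Phase → ℂ) : Phase → ℂ := fun z =>
  starSum (fun p => pairCutoff p) β h (tensor a b) (diagCLM z)

section

variable {m₁ m₂ : ℝ} {a b : Phase → ℂ} {β : ℝ}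

theorem starProduct_mem_symbolClass (ha : a ∈ symbolClass m₁) (hb : b ∈ symbolClass m₂) (h : ℝ) :
    starProduct β h a b ∈ symbolClass (m₁ + m₂) := by
  have hw := moderateWeight_pairWeight m₁ m₂
  have hd := contDiff_ofReal_comp isLatticeCutoff_pairCutoff.1
  have hc := hasCompactSupport_ofReal_comp isLatticeCutoff_pairCutoff.2.1
  set F := tensorBisymbol ha hb with hF
  -- The parameter of the general lemma is trivial here, as `h` is fixed.
  have hsm : ∀ (_ : Unit) (F : bisymbols (pairWeight m₁ m₂)), ContDiff ℝ ∞
    (starSum (fun p => pairCutoff p) β h F) := fun _ F => contDiff_starSum hw F.2.1 hd hc β h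
  refine ⟨isSmoothPeriodic_diag (hsm () F) (isBiperiodic_starSum F.2.2 β h), fun α γ => ?_⟩
  obtain ⟨G, hG⟩ := exists_multiDeriv_diag (fun (_ : Unit) (F : bisymbols (pairWeight m₁ m₂)) =>
    starSum (fun p => pairCutoff p) β h F) hsm
    (fun _ F v => dirDeriv_starSum hw F.2.1 hd hc β h v) α γ F
  obtain ⟨C, hC⟩ := exists_norm_starSum_le hw G.2.1 hd hc β |h|
  refine ⟨C, fun x ξ => ?_⟩
  have e := congrFun (hG ()) (x, ξ)
  rw [show multiDeriv α γ (starProduct β h a b) (x, ξ) = _ from e]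
  refine (hC h le_rfl _).trans_eq ?_
  rw [pairWeight_diag]; rfl

theorem isStarIntegral_starProduct (hβ : ∃ n : ℤ, β = 2 * Real.pi * n) (ha : a ∈ symbolClass m₁)
    (hb : b ∈ symbolClass m₂) (h : ℝ) : IsStarIntegral h β a b (starProduct β h a b) := by
  intro χ hχ x ξ
  have hw := moderateWeight_pairWeight m₁ m₂
  have hF := (tensorBisymbol ha hb).2
  have e := starSum_congr_cutoff hβ hw hF.1 hF.2 isLatticeCutoff_pairCutoff hχ h (diagCLM (x, ξ))
  rw [starProduct, show tensor a b = (tensorBisymbol ha hb : Pair → ℂ) from rfl, e]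
  refine (hasSum_starKernel hw hF.1 (contDiff_ofReal_comp hχ.1)
    (hasCompactSupport_ofReal_comp hχ.2.1) β h (diagCLM (x, ξ))).congr_fun fun k => ?_ |> id
  refine integral_congr_ae (Eventually.of_forall fun p => ?_)
  have e1 : diagCLM (x, ξ) + starMap h β p + h • unitShift k =
      ((x - p.1, ξ + (h / 2) • freq k.2 + (h * β) • perp p.1),
        (x - p.2, ξ - (h / 2) • freq k.1 + (h * β) • perp p.2)) := by
    rw [starMap_apply, diagCLM_apply, unitShift]
    refine Prod.ext (Prod.ext ?_ ?_) (Prod.ext ?_ ?_) <;> ext i <;> simp <;> ring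
  simp only [starKernel, e1]
  rw [← mul_assoc (phase _ _), phase_mul_starPhase, starIntegrand]
  simp only [tensorBisymbol, tensor, freqPhase₂_apply, freqPhase_apply]
  ring

/-! ### The asymptotic expansion -/

lemma dirD_eq (v : Pair) (F : Pair → ℂ) : dirD v F = fun q => -Complex.I * dirDeriv v F q := rfl

lemma dirD_dirD {F : Pair → ℂ} (hF : ContDiff ℝ ∞ F) (v v' : Pair) :
    dirD v (dirD v' F) = fun q => -dirDeriv v (dirDeriv v' F) q := by
  rw [dirD_eq, dirD_eq, dirDeriv_const_mul (contDiff_dirDeriv hF v')]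
  funext q
  have := Complex.I_mul_I
  linear_combination dirDeriv v (dirDeriv v' F) q * this

lemma omegaD_eq {F : Pair → ℂ} (hF : ContDiff ℝ ∞ F) (h β : ℝ) (q : Pair) :
    omegaD h β F q = -(∑ j, dirDeriv (dirX' j) (dirDeriv (dirXi j) F) q) +
      (∑ j, dirDeriv (dirX j) (dirDeriv (dirXi' j) F) q) -
      ((h * β : ℝ) : ℂ) * (dirDeriv (dirXi' 0) (dirDeriv (dirXi 1) F) q -
        dirDeriv (dirXi' 1) (dirDeriv (dirXi 0) F) q) := by
  simp only [omegaD, Dx', Dx, Dξ, Dξ', dirD_dirD hF, dirX', dirX, dirXi, dirXi',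
    Finset.sum_neg_distrib]
  ring

lemma coe_omegaD {w : Pair → ℝ} (F : bisymbols w) (h β : ℝ) :
    omegaD h β F = ((symplOp w + (h : ℂ) • wedgeOp w β) F : bisymbols w) := by
  funext q
  rw [omegaD_eq F.2.1.smooth]
  simp only [symplOp, wedgeOp, Fin.sum_univ_two, LinearMap.add_apply, LinearMap.smul_apply,
    Module.End.mul_apply, Submodule.coe_add, Submodule.coe_smul, Pi.add_apply, Pi.smul_apply,
    diffOp_apply, smul_eq_mul]
  push_cast
  ring

lemma coe_omegaD_iterate {w : Pair → ℝ} (F : bisymbols w) (h β : ℝ) (n : ℕ) :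
    (omegaD h β)^[n] F = (((symplOp w + (h : ℂ) • wedgeOp w β) ^ n) F : bisymbols w) := by
  induction n with
  | zero => rfl
  | succ n ih => rw [Function.iterate_succ_apply', ih, coe_omegaD, pow_succ']; rfl

lemma starExponent_eq (w : Pair → ℝ) (β h : ℝ) :
    starExponent w β h = (Complex.I * (h : ℂ) / 2) • (symplOp w + (h : ℂ) • wedgeOp w β) := by
  simp only [starExponent, smul_add, smul_smul]
  congr 2 <;> ring

lemma coe_starExponent_pow {w : Pair → ℝ} (F : bisymbols w) (h β : ℝ) (n : ℕ) (q : Pair) :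
    ((starExponent w β h ^ n) F : Pair → ℂ) q =
      (Complex.I * (h : ℂ) / 2) ^ n * (omegaD h β)^[n] F q := by
  rw [starExponent_eq, smul_pow, coe_omegaD_iterate]; rfl

lemma starProduct_sub_expansion (ha : a ∈ symbolClass m₁) (hb : b ∈ symbolClass m₂) (N : ℕ)
    (h : ℝ) : (fun z => starProduct β h a b z -
      ∑ n ∈ Finset.range N, (1 / (n.factorial : ℂ)) * (Complex.I * (h : ℂ) / 2) ^ n *
        omegaTerm h β n a b z) =
      fun z => starRemainder pairCutoff β N h (tensorBisymbol ha hb) (diagCLM z) := by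
  funext z
  simp only [starRemainder, coe_starExponent_pow, ← mul_assoc]
  rfl

/-- On the diagonal the two weights multiply to `⟨ξ⟩^{m₁ + m₂}`, and each seminorm of the difference
is a sup bound for the remainder of a differentiated bisymbol. -/
theorem isBigOSymbol_starProduct_sub (hβ : ∃ n : ℤ, β = 2 * Real.pi * n) (ha : a ∈ symbolClass m₁)
    (hb : b ∈ symbolClass m₂) (N : ℕ) : IsBigOSymbol (m₁ + m₂) N (fun h z => starProduct β h a b z -
      ∑ n ∈ Finset.range N, (1 / (n.factorial : ℂ)) * (Complex.I * (h : ℂ) / 2) ^ n *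
        omegaTerm h β n a b z) := by
  have hw := moderateWeight_pairWeight m₁ m₂
  set F := tensorBisymbol ha hb with hF
  refine (congrArg (IsBigOSymbol (m₁ + m₂) N)
    (funext fun h => starProduct_sub_expansion ha hb N h)).mpr ?_
  have hsm : ∀ h (F : bisymbols (pairWeight m₁ m₂)), ContDiff ℝ ∞ (starRemainder pairCutoff β N h F) :=
    fun h F => contDiff_starRemainder hw isLatticeCutoff_pairCutoff N h F
  refine ⟨fun h _ => isSmoothPeriodic_diag (hsm h F) (isBiperiodic_starRemainder N h F),
    fun α γ => ?_⟩
  obtain ⟨G, hG⟩ := exists_multiDeriv_diag (fun h (F : bisymbols (pairWeight m₁ m₂)) =>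
    starRemainder pairCutoff β N h F) hsm
    (fun h F v => dirDeriv_starRemainder hw isLatticeCutoff_pairCutoff N h F v) α γ F
  obtain ⟨C, -, hC⟩ := exists_norm_starRemainder_le hβ hw isLatticeCutoff_pairCutoff N G
  refine ⟨C, fun h hh x ξ => ?_⟩
  rw [hG h]
  refine (hC h ⟨hh.1.le, hh.2⟩ _).trans_eq ?_
  rw [pairWeight_diag]; rfl

/-! ### The commutator -/

/-- The exchange of the two points of a pair. -/
noncomputable def swapCLM : Pair →L[ℝ] Pair :=
  (ContinuousLinearMap.snd ℝ Phase Phase).prod (ContinuousLinearMap.fst ℝ Phase Phase)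

lemma swapCLM_apply (q : Pair) : swapCLM q = (q.2, q.1) := rfl

/-- The form `Ω` is antisymmetric, so exchanging the factors changes the sign of the operator. Odd
terms of the expansion are therefore odd, and even terms even, in the order of the product. -/
lemma omegaD_swap {F : Pair → ℂ} (hF : ContDiff ℝ ∞ F) (h β : ℝ) :
    omegaD h β (fun q => F (swapCLM q)) = fun q => -omegaD h β F (swapCLM q) := by
  funext q
  have hs : ContDiff ℝ ∞ fun q => F (swapCLM q) := hF.comp swapCLM.contDiff
  have e : ∀ v v', dirDeriv v (dirDeriv v' fun q => F (swapCLM q)) q =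
      dirDeriv (swapCLM v') (dirDeriv (swapCLM v) F) (swapCLM q) := by
    intro v v'
    rw [dirDeriv_comp_clm hF, dirDeriv_comp_clm (contDiff_dirDeriv hF _), dirDeriv_comm hF]
  have h1 : ∀ j, swapCLM (dirX j) = dirX' j := fun _ => rfl
  have h2 : ∀ j, swapCLM (dirX' j) = dirX j := fun _ => rfl
  have h3 : ∀ j, swapCLM (dirXi j) = dirXi' j := fun _ => rfl
  have h4 : ∀ j, swapCLM (dirXi' j) = dirXi j := fun _ => rfl
  rw [omegaD_eq hs, omegaD_eq hF]
  simp only [e, h1, h2, h3, h4]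
  simp only [dirDeriv_comm hF (dirXi' _) (dirX _), dirDeriv_comm hF (dirXi _) (dirX' _)]
  ring

lemma omegaD_neg {F : Pair → ℂ} (hF : ContDiff ℝ ∞ F) (h β : ℝ) :
    omegaD h β (fun q => -F q) = fun q => -omegaD h β F q := by
  funext q
  have hn : (fun q => -F q) = fun q => (-1 : ℂ) * F q := by funext q; ring
  have hs : ContDiff ℝ ∞ fun q => (-1 : ℂ) * F q := contDiff_const.mul hF
  rw [hn, omegaD_eq hs, omegaD_eq hF]
  have e : ∀ v v', dirDeriv v (dirDeriv v' fun q => (-1 : ℂ) * F q) q =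
      -dirDeriv v (dirDeriv v' F) q := fun v v' => by
    rw [dirDeriv_const_mul hF, dirDeriv_const_mul (contDiff_dirDeriv hF _)]; ring
  simp only [e, Finset.sum_neg_distrib]
  ring

lemma omegaTerm_zero (h β : ℝ) (a b : Phase → ℂ) (z : Phase) :
    omegaTerm h β 0 a b z = a z * b z := rfl

lemma tensor_swap (a b : Phase → ℂ) : tensor b a = fun q => tensor a b (swapCLM q) :=
  funext fun _ => mul_comm _ _

lemma omegaTerm_one_swap (ha : a ∈ symbolClass m₁) (hb : b ∈ symbolClass m₂) (h : ℝ) (z : Phase) :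
    omegaTerm h β 1 b a z = -omegaTerm h β 1 a b z := by
  have h1 : omegaTerm h β 1 b a z = omegaD h β (tensor b a) (z, z) := rfl
  have hF : ContDiff ℝ ∞ (tensor a b) := (tensorBisymbol ha hb).2.1.smooth
  rw [h1, tensor_swap, omegaD_swap hF]
  rfl

lemma omegaTerm_two_swap (ha : a ∈ symbolClass m₁) (hb : b ∈ symbolClass m₂) (h : ℝ) (z : Phase) :
    omegaTerm h β 2 b a z = omegaTerm h β 2 a b z := by
  have hF : ContDiff ℝ ∞ (tensor a b) := (tensorBisymbol ha hb).2.1.smooth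
  have h1 : omegaTerm h β 2 b a z = omegaD h β (omegaD h β (tensor b a)) (z, z) := rfl
  have hF' : ContDiff ℝ ∞ (omegaD h β (tensor a b)) := by
    rw [show tensor a b = (tensorBisymbol ha hb : Pair → ℂ) from rfl, coe_omegaD]
    exact ((symplOp _ + (h : ℂ) • wedgeOp _ β : Module.End ℂ (bisymbols (pairWeight m₁ m₂)))
      (tensorBisymbol ha hb)).2.1.smooth
  have hs : ContDiff ℝ ∞ fun q => omegaD h β (tensor a b) (swapCLM q) := hF'.comp swapCLM.contDiff
  rw [h1, tensor_swap, omegaD_swap hF, omegaD_neg hs, omegaD_swap hF']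
  simp only [neg_neg]
  rfl

lemma dirDeriv_tensor {a b : Phase → ℂ} (ha : ContDiff ℝ ∞ a) (hb : ContDiff ℝ ∞ b) (v : Pair) :
    dirDeriv v (tensor a b) = fun q => dirDeriv v.1 a q.1 * b q.2 + a q.1 * dirDeriv v.2 b q.2 := by
  funext q
  have h1 := dirDeriv_comp_clm ha (ContinuousLinearMap.fst ℝ Phase Phase) v
  have h2 := dirDeriv_comp_clm hb (ContinuousLinearMap.snd ℝ Phase Phase) v
  have h3 := congrFun h1 q
  have h4 := congrFun h2 q
  simp only [dirDeriv] at h3 h4 ⊢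
  have ha' : ContDiff ℝ ∞ fun q : Pair => a q.1 := ha.comp contDiff_fst
  have hb' : ContDiff ℝ ∞ fun q : Pair => b q.2 := hb.comp contDiff_snd
  rw [show tensor a b = fun q => a q.1 * b q.2 from rfl,
    fderiv_fun_mul (ha'.differentiable (by simp) q) (hb'.differentiable (by simp) q)]
  simp only [_root_.add_apply, _root_.smul_apply, smul_eq_mul]
  simp only [ContinuousLinearMap.coe_fst', ContinuousLinearMap.coe_snd'] at h3 h4
  rw [h3, h4]
  ring

lemma dirDeriv_zero_dir {P : Type*} [NormedAddCommGroup P] [NormedSpace ℝ P] (F : P → ℂ) (p : P) :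
    dirDeriv 0 F p = 0 := map_zero _

lemma dirDeriv_inr_inl_tensor {a b : Phase → ℂ} (ha : ContDiff ℝ ∞ a) (hb : ContDiff ℝ ∞ b)
    (v v' : Phase) : dirDeriv ((0, v') : Pair) (dirDeriv ((v, 0) : Pair) (tensor a b)) =
      tensor (dirDeriv v a) (dirDeriv v' b) := by
  have h1 : dirDeriv ((v, 0) : Pair) (tensor a b) = tensor (dirDeriv v a) b := by
    rw [dirDeriv_tensor ha hb]; funext q; simp [dirDeriv_zero_dir, tensor]
  rw [h1, dirDeriv_tensor (contDiff_dirDeriv ha v) hb]; funext q; simp [dirDeriv_zero_dir, tensor]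

lemma omegaTerm_one {a b : Phase → ℂ} (ha : ContDiff ℝ ∞ a) (hb : ContDiff ℝ ∞ b) (h β : ℝ)
    (z : Phase) : omegaTerm h β 1 a b z = -(poisson a b z) -
      ((h * β : ℝ) : ℂ) * (dXi 1 a z * dXi 0 b z - dXi 0 a z * dXi 1 b z) := by
  have hF : ContDiff ℝ ∞ (tensor a b) := (ha.comp contDiff_fst).mul (hb.comp contDiff_snd)
  have h1 : omegaTerm h β 1 a b z = omegaD h β (tensor a b) (z, z) := rfl
  rw [h1, omegaD_eq hF]
  simp only [dirDeriv_comm hF (dirX _) (dirXi' _)]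
  simp only [dirX, dirX', dirXi, dirXi', dirDeriv_inr_inl_tensor ha hb, tensor, poisson, dXi_eq, dX_eq, Finset.sum_sub_distrib]
  ring

lemma multiDeriv_sub {a b : Phase → ℂ} (ha : ContDiff ℝ ∞ a) (hb : ContDiff ℝ ∞ b)
    (α γ : Fin 2 → ℕ) : multiDeriv α γ (fun z => a z - b z) =
      fun z => multiDeriv α γ a z - multiDeriv α γ b z := by
  have it : ∀ (v : Phase) (n : ℕ) {a b : Phase → ℂ}, ContDiff ℝ ∞ a → ContDiff ℝ ∞ b →
      (dirDeriv v)^[n] (fun z => a z - b z) =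
        fun z => (dirDeriv v)^[n] a z - (dirDeriv v)^[n] b z := by
    intro v n a b ha hb
    induction n with
    | zero => rfl
    | succ n ih =>
      simp only [Function.iterate_succ_apply']
      rw [ih, dirDeriv_sub (contDiff_dirDeriv_iterate ha v n) (contDiff_dirDeriv_iterate hb v n)]
  have s := fun (v : Phase) (n : ℕ) {a : Phase → ℂ} (ha : ContDiff ℝ ∞ a) =>
    contDiff_dirDeriv_iterate ha v n
  simp only [multiDeriv, dX_eq, dXi_eq]
  rw [it _ _ ha hb, it _ _ (s _ _ ha) (s _ _ hb), it _ _ (s _ _ (s _ _ ha)) (s _ _ (s _ _ hb)),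
    it _ _ (s _ _ (s _ _ (s _ _ ha))) (s _ _ (s _ _ (s _ _ hb)))]

lemma IsBigOSymbol.sub {m : ℝ} {N : ℕ} {r r' : ℝ → Phase → ℂ} (hr : IsBigOSymbol m N r)
    (hr' : IsBigOSymbol m N r') : IsBigOSymbol m N (fun h z => r h z - r' h z) := by
  refine ⟨fun h hh => ⟨(hr.1 h hh).1.sub (hr'.1 h hh).1, fun k x ξ => ?_⟩, fun α γ => ?_⟩
  · simp only [(hr.1 h hh).2 k x ξ, (hr'.1 h hh).2 k x ξ]
  · obtain ⟨C, hC⟩ := hr.2 α γ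
    obtain ⟨C', hC'⟩ := hr'.2 α γ
    refine ⟨C + C', fun h hh x ξ => ?_⟩
    rw [multiDeriv_sub (hr.1 h hh).1 (hr'.1 h hh).1]
    refine (norm_sub_le _ _).trans ((add_le_add (hC h hh x ξ) (hC' h hh x ξ)).trans_eq ?_)
    ring

theorem isBigOSymbol_starProduct_sub_mul (hβ : ∃ n : ℤ, β = 2 * Real.pi * n)
    (ha : a ∈ symbolClass m₁) (hb : b ∈ symbolClass m₂) :
    IsBigOSymbol (m₁ + m₂) 1 (fun h z => starProduct β h a b z - a z * b z) := by
  simpa [omegaTerm_zero] using isBigOSymbol_starProduct_sub hβ ha hb 1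

/-- Expanding both products to order three, the terms `n = 0, 2` cancel and the term `n = 1`
doubles; `2 · (ih/2) · (-1) = h/i` gives the coefficient. -/
theorem isBigOSymbol_commutator (hβ : ∃ n : ℤ, β = 2 * Real.pi * n)
    (ha : a ∈ symbolClass m₁) (hb : b ∈ symbolClass m₂) :
    IsBigOSymbol (m₁ + m₂) 3 (fun h z => starProduct β h a b z - starProduct β h b a z -
      ((h : ℂ) / Complex.I * poisson a b z + ((β * h ^ 2 : ℝ) : ℂ) / Complex.I *
        (dXi 1 a z * dXi 0 b z - dXi 0 a z * dXi 1 b z))) := by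
  have h1 := isBigOSymbol_starProduct_sub hβ ha hb 3
  have h2 := isBigOSymbol_starProduct_sub hβ hb ha 3
  rw [add_comm m₂ m₁] at h2
  convert h1.sub h2 using 3 with h z
  simp only [Finset.sum_range_succ, Finset.sum_range_zero, omegaTerm_zero,
    omegaTerm_two_swap ha hb, omegaTerm_one_swap ha hb, omegaTerm_one ha.1.1 hb.1.1]
  simp only [div_eq_mul_inv, Complex.inv_I]
  push_cast
  norm_num
  ring

end

/-! ### Sections -/

/-- Quasi-periodicity under the two generators of the lattice. -/
def IsQuasiPeriodic (β : ℝ) (u : Plane → ℂ) : Prop :=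
  ∀ (j : Fin 2) (x : Plane), u (x + basisVec j) =
    Complex.exp (Complex.I * ((β / 2 * wedge (basisVec j) x : ℝ) : ℂ)) * u x

lemma wedge_add_left (x y z : Plane) : wedge (x + y) z = wedge x z + wedge y z := by
  simp only [wedge, PiLp.add_apply]; ring

lemma wedge_add_right (x y z : Plane) : wedge x (y + z) = wedge x y + wedge x z := by
  simp only [wedge, PiLp.add_apply]; ring

lemma wedge_sub_right (x y z : Plane) : wedge x (y - z) = wedge x y - wedge x z := by
  simp only [wedge, PiLp.sub_apply]; ring

lemma wedge_smul_left (c : ℝ) (x y : Plane) : wedge (c • x) y = c * wedge x y := by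
  simp only [wedge, PiLp.smul_apply, smul_eq_mul]; ring

lemma wedge_smul_right (c : ℝ) (x y : Plane) : wedge x (c • y) = c * wedge x y := by
  simp only [wedge, PiLp.smul_apply, smul_eq_mul]; ring

lemma wedge_self (x : Plane) : wedge x x = 0 := by simp only [wedge]; ring

lemma wedge_comm (x y : Plane) : wedge x y = -wedge y x := by simp only [wedge]; ring

lemma magTranslate_eq_iff {β : ℝ} {u : Plane → ℂ} :
    (∀ j : Fin 2, magTranslate β (basisVec j) u = u) ↔ IsQuasiPeriodic β u := by
  constructor
  · intro h j x
    have := congrFun (h j) (x + basisVec j)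
    rw [← this, magTranslate, add_sub_cancel_right, wedge_add_right, wedge_self, add_zero]
  · intro h j
    funext x
    have := h j (x - basisVec j)
    rw [sub_add_cancel, wedge_sub_right, wedge_self, sub_zero] at this
    rw [this, magTranslate]

lemma mem_smoothSections_iff {β : ℝ} {u : Plane → ℂ} :
    u ∈ smoothSections β ↔ ContDiff ℝ ∞ u ∧ IsQuasiPeriodic β u :=
  and_congr_right fun _ => magTranslate_eq_iff

lemma cexp_I_add (a b : ℝ) : Complex.exp (Complex.I * ((a + b : ℝ) : ℂ)) =
    Complex.exp (Complex.I * (a : ℂ)) * Complex.exp (Complex.I * (b : ℂ)) := by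
  rw [← Complex.exp_add]; push_cast; ring_nf

lemma cexp_I_mul (a b : ℝ) : Complex.exp (Complex.I * (a : ℂ)) * Complex.exp (Complex.I * (b : ℂ)) =
    Complex.exp (Complex.I * ((a + b : ℝ) : ℂ)) := (cexp_I_add a b).symm

lemma norm_cexp_I (a : ℝ) : ‖Complex.exp (Complex.I * (a : ℂ))‖ = 1 := by
  rw [mul_comm]; exact Complex.norm_exp_ofReal_mul_I _

/-- Along one generator the phases simply add, because `e_j ∧ e_j = 0`. -/
lemma IsQuasiPeriodic.add_zsmul {β : ℝ} {u : Plane → ℂ} (hu : IsQuasiPeriodic β u) (j : Fin 2)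
    (n : ℤ) (x : Plane) : u (x + (n : ℝ) • basisVec j) =
      Complex.exp (Complex.I * ((β / 2 * (n * wedge (basisVec j) x) : ℝ) : ℂ)) * u x := by
  induction n using Int.induction_on with
  | zero => simp
  | succ n ih =>
    have h1 := hu j (x + (n : ℝ) • basisVec j)
    have e : x + (((n : ℤ) + 1 : ℤ) : ℝ) • basisVec j = x + (n : ℝ) • basisVec j + basisVec j := by
      push_cast; module
    rw [e, h1, wedge_add_right, wedge_smul_right, wedge_self, mul_zero, add_zero]
    rw [Int.cast_natCast] at ih
    rw [ih, ← mul_assoc (Complex.exp _) (Complex.exp _), cexp_I_mul]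
    congr 4
    push_cast; ring
  | pred n ih =>
    have h1 := hu j (x + (((-(n : ℤ) - 1 : ℤ)) : ℝ) • basisVec j)
    have e : x + ((-(n : ℤ) - 1 : ℤ) : ℝ) • basisVec j + basisVec j =
        x + ((-(n : ℤ) : ℤ) : ℝ) • basisVec j := by
      push_cast; module
    rw [e, ih, wedge_add_right, wedge_smul_right, wedge_self, mul_zero, add_zero] at h1
    have h2 : Complex.exp (Complex.I * ((β / 2 * wedge (basisVec j) x : ℝ) : ℂ)) ≠ 0 :=
      Complex.exp_ne_zero _
    refine mul_left_cancel₀ h2 (h1.symm.trans ?_)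
    rw [← mul_assoc (Complex.exp _) (Complex.exp _), cexp_I_mul]
    congr 4
    push_cast; ring

lemma latticeVec_eq_sum (l : Fin 2 → ℤ) :
    latticeVec l = (l 0 : ℝ) • basisVec 0 + (l 1 : ℝ) • basisVec 1 := plane_eq (latticeVec l)

lemma wedge_basisVec_one_zero : wedge (basisVec 1) (basisVec 0) = -1 := by simp [wedge, basisVec]

/-- Composing translations along the two generators creates an extra factor, in general only a sign.
For even translations it is `1`, and only these occur, since `u` enters the quantization as `u (x +
2y)`. -/
lemma IsQuasiPeriodic.add_two_smul {β : ℝ} (hβ : ∃ n : ℤ, β = 2 * Real.pi * n) {u : Plane → ℂ}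
    (hu : IsQuasiPeriodic β u) (l : Fin 2 → ℤ) (x : Plane) : u (x + (2 : ℝ) • latticeVec l) =
      Complex.exp (Complex.I * ((β * wedge (latticeVec l) x : ℝ) : ℂ)) * u x := by
  obtain ⟨n, rfl⟩ := hβ
  have e : x + (2 : ℝ) • latticeVec l =
      x + ((2 * l 0 : ℤ) : ℝ) • basisVec 0 + ((2 * l 1 : ℤ) : ℝ) • basisVec 1 := by
    rw [latticeVec_eq_sum]; push_cast; module
  rw [e, hu.add_zsmul, hu.add_zsmul, ← mul_assoc, cexp_I_mul]
  congr 1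
  refine cexp_I_eq (-(2 * n * l 0 * l 1)) ?_
  rw [latticeVec_eq_sum, wedge_add_left, wedge_smul_left, wedge_smul_left, wedge_add_right,
    wedge_smul_right, wedge_basisVec_one_zero]
  push_cast; ring

lemma contDiff_wedge_comp {V : Type*} [NormedAddCommGroup V] [NormedSpace ℝ V] {f g : V → Plane}
    (hf : ContDiff ℝ ∞ f) (hg : ContDiff ℝ ∞ g) : ContDiff ℝ ∞ fun y => wedge (f y) (g y) :=
  contDiff_wedge.comp (hf.prodMk hg)

/-! ### The quantization as an absolutely convergent oscillatory series -/

/-- The cutoff, with the factors of the integrand that do not depend on the symbol. -/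
noncomputable def opCutoff (β : ℝ) (u : Plane → ℂ) (x y : Plane) : ℂ :=
  (planeCutoff y : ℂ) * (Complex.exp (Complex.I * ((-(β * wedge y x) : ℝ) : ℂ)) * u (x + (2 : ℝ) • y))

/-- The map `y ↦ (y, -hβ y^⊥)`. -/
noncomputable def opMap (h β : ℝ) : Plane →L[ℝ] Phase :=
  (ContinuousLinearMap.id ℝ Plane).prod ((-(h * β)) • perpCLM)

/-- The shift of the momentum. -/
noncomputable def opShift (h : ℝ) (k : Fin 2 → ℤ) : Phase := (0, (-(h / 2)) • freq k)

/-- `Op(a) u (x)` as an absolutely convergent oscillatory series. -/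
noncomputable def opSum (h β : ℝ) (a : Phase → ℂ) (u : Plane → ℂ) (x : Plane) : ℂ :=
  shearSum freqPhase (opCutoff β u x) (opMap h β) (opShift h) a (opMap h β x)

lemma opMap_apply (h β : ℝ) (y : Plane) : opMap h β y = (y, (-(h * β)) • perp y) := rfl

lemma norm_opShift_le (h : ℝ) (k : Fin 2 → ℤ) : ‖opShift h k‖ ≤ (|h| * (2 * Real.pi)) * latSize k := by
  have h1 := norm_freq_le k
  have hp := Real.pi_pos
  have h2 := abs_nonneg h
  have h3 := norm_nonneg k
  refine norm_prod_le_iff.2 ⟨?_, ?_⟩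
  · simp only [opShift, norm_zero, latSize]; positivity
  · simp only [opShift, norm_smul, Real.norm_eq_abs, abs_neg, abs_div, latSize]
    have : |(2 : ℝ)| = 2 := abs_of_pos two_pos
    rw [this]
    calc |h| / 2 * ‖freq k‖ ≤ |h| / 2 * (4 * Real.pi * ‖k‖) := by gcongr
      _ ≤ |h| * (2 * Real.pi) * (1 + ‖k‖) := by
        have : 0 ≤ |h| * Real.pi := by positivity
        nlinarith

/-! ### The oscillatory series of the quantization and its action on characters. -/

section Op

variable {β : ℝ} {u : Plane → ℂ}

lemma contDiff_opCutoff (β : ℝ) (hu : ContDiff ℝ ∞ u) (x : Plane) : ContDiff ℝ ∞ (opCutoff β u x) :=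
  (contDiff_ofReal_comp contDiff_planeCutoff).mul
    ((contDiff_cexp_I (contDiff_const.mul (contDiff_wedge_comp contDiff_id contDiff_const)).neg).mul
      (hu.comp (contDiff_const.add (contDiff_id.const_smul (2 : ℝ)))))

lemma hasCompactSupport_opCutoff (β : ℝ) (u : Plane → ℂ) (x : Plane) :
    HasCompactSupport (opCutoff β u x) :=
  (hasCompactSupport_ofReal_comp hasCompactSupport_planeCutoff).mul_right

variable {w : Phase → ℝ} {A : ℝ} {s : ℕ}

/-- Uniform bounds for the quantization at a fixed point. -/
theorem ModerateWeight.exists_oscBounded_op (hw : ModerateWeight w A s) (h β : ℝ) (u : Plane → ℂ)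
    (x : Plane) : ∃ B, 0 ≤ B ∧ ∀ C (a : Phase → ℂ), SymbolBound w C a →
      OscBounded (opCutoff β u x) latSize s (B * seminormSum s C)
        (fun k y => a (opMap h β x + opMap h β y + opShift h k)) := by
  obtain ⟨B, hB, H⟩ := hw.exists_oscBounded (E := ℂ) (hasCompactSupport_opCutoff β u x)
    (ν := latSize) (K := Fin 2 → ℤ) one_le_latSize ‖opMap h β‖ (|h| * (2 * Real.pi))
  refine ⟨B * w (opMap h β x), mul_nonneg hB (hw.pos _).le, fun C a ha => ?_⟩
  rw [mul_right_comm]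
  exact H _ _ le_rfl (norm_opShift_le h) C a ha _

/-- Convergence of the quantization under bounded pointwise convergence of symbols. -/
theorem tendsto_opSum (hw : ModerateWeight w A s) (h β : ℝ) (hu : ContDiff ℝ ∞ u) (x : Plane)
    {ι : Type*} {l : Filter ι} [l.IsCountablyGenerated] {C : ℕ → ℝ} {a : ι → Phase → ℂ}
    {a₀ : Phase → ℂ} (ha : ∀ᶠ i in l, SymbolBound w C (a i))
    (hlim : ∀ z, Tendsto (fun i => a i z) l (𝓝 (a₀ z))) :
    Tendsto (fun i => opSum h β (a i) u x) l (𝓝 (opSum h β a₀ u x)) := by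
  obtain ⟨B, -, H⟩ := hw.exists_oscBounded_op h β u x
  exact tendsto_oscSum phaseFamily_freqPhase (contDiff_opCutoff β hu x)
    (hasCompactSupport_opCutoff β u x) (ha.mono fun i hi => H C (a i) hi) fun k y _ => hlim _

theorem tendsto_starSum {w : Pair → ℝ} (hw : ModerateWeight w A s) (β h : ℝ)
    {χ : Plane × Plane → ℂ} (hχ : ContDiff ℝ ∞ χ) (hc : HasCompactSupport χ) (z : Pair)
    {ι : Type*} {l : Filter ι} [l.IsCountablyGenerated] {C : ℕ → ℝ} {F : ι → Pair → ℂ}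
    {F₀ : Pair → ℂ} (hF : ∀ᶠ i in l, SymbolBound w C (F i))
    (hlim : ∀ z, Tendsto (fun i => F i z) l (𝓝 (F₀ z))) :
    Tendsto (fun i => starSum χ β h (F i) z) l (𝓝 (starSum χ β h F₀ z)) := by
  obtain ⟨B, hB, H⟩ := hw.exists_oscBounded (E := ℂ) (hasCompactSupport_starCutoff hc β)
    (ν := latSize) (K := Lat₂) one_le_latSize ‖starMap h β‖ (|h| * (2 * Real.pi))
  exact tendsto_oscSum phaseFamily_freqPhase₂ (contDiff_starCutoff hχ β)
    (hasCompactSupport_starCutoff hc β) (hF.mono fun i hi =>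
      H _ _ le_rfl (norm_smul_unitShift_le le_rfl) C _ hi z) fun k y _ => hlim _

/-! ### Characters -/

/-- The character `e^{i(2πk · x + ζ · ξ)}`. -/
noncomputable def character (k : Fin 2 → ℤ) (ζ : Plane) (z : Phase) : ℂ :=
  Complex.exp (Complex.I * ((inner ℝ (freq k) z.1 + inner ℝ ζ z.2 : ℝ) : ℂ))

lemma inner_perp (x y : Plane) : inner ℝ x (perp y) = wedge y x := by
  rw [inner_eq]; simp [perp, wedge]; ring

/-- The quantization of a character is a magnetic Weyl operator. -/
theorem opSum_character (hβ : ∃ n : ℤ, β = 2 * Real.pi * n) (hu : ContDiff ℝ ∞ u)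
    (hq : IsQuasiPeriodic β u) (h : ℝ) (k : Fin 2 → ℤ) (ζ x : Plane) :
    opSum h β (character k ζ) u x = weylOp h β (freq k) ζ u x := by
  set g : Plane → ℂ := fun y => opCutoff β u x y * Complex.exp (Complex.I *
    ((inner ℝ (freq k) (x + y) + inner ℝ ζ ((-(h * β)) • perp (x + y)) : ℝ) : ℂ)) with hg
  have hθ : ContDiff ℝ ∞ fun y : Plane =>
      inner ℝ (freq k) (x + y) + inner ℝ ζ ((-(h * β)) • perp (x + y)) := by
    have h1 : ContDiff ℝ ∞ fun y : Plane => x + y := contDiff_const.add contDiff_id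
    have h2 : ContDiff ℝ ∞ fun y : Plane => perpCLM (x + y) := perpCLM.contDiff.comp h1
    exact (contDiff_const.inner ℝ h1).add (contDiff_const.inner ℝ (h2.const_smul (-(h * β))))
  have hgd : ContDiff ℝ ∞ g := (contDiff_opCutoff β hu x).mul (contDiff_cexp_I hθ)
  have hgc : HasCompactSupport g := (hasCompactSupport_opCutoff β u x).mul_right
  -- The momentum shift `-hη/2`, paired with `ζ`, moves the linear phase to `y - hζ/2`. Poisson
  -- summation therefore samples at `y ∈ ℤ² + hζ/2`, where `u` is evaluated at `x + hζ` up to twice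
  -- a lattice vector.
  have h1 := (poissonFamily_freqPhase.hasSum_sub hgd hgc ((h / 2) • ζ)).tsum_eq
  have h2 : opSum h β (character k ζ) u x =
      ∑' j, ∫ y, phase (freqPhase j) (y - (h / 2) • ζ) * g y := by
    refine tsum_congr fun j => integral_congr_ae (Eventually.of_forall fun y => ?_)
    simp only [hg, character, phase, smul_eq_mul]
    rw [← mul_assoc, mul_comm _ (opCutoff β u x y), mul_assoc, ← mul_assoc _ (opCutoff β u x y),
      mul_comm _ (opCutoff β u x y), mul_assoc, cexp_I_mul, cexp_I_mul]
    congr 3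
    simp only [opMap_apply, opShift, freqPhase_apply, Prod.fst_add, Prod.snd_add, inner_add_right,
      inner_sub_right, inner_smul_right, perp_add, smul_add, add_zero]
    rw [real_inner_comm (freq j) ζ]
    push_cast
    ring
  rw [h2, h1]
  -- Quasi-periodicity cancels the phases of each sample, so all samples carry the same Weyl value
  -- and their weights add up to `1`.
  have h3 : ∀ l, g (latticeVec l + (h / 2) • ζ) =
      ((planeCutoff ((h / 2) • ζ + latticeVec l) : ℝ) : ℂ) * weylOp h β (freq k) ζ u x := by
    intro l
    have e1 : x + (2 : ℝ) • (latticeVec l + (h / 2) • ζ) = x + h • ζ + (2 : ℝ) • latticeVec l := by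
      module
    simp only [hg, opCutoff, weylOp, e1, hq.add_two_smul hβ l]
    rw [add_comm (latticeVec l)]
    simp only [mul_assoc]
    congr 1
    rw [mul_comm (u (x + h • ζ))]
    simp only [← mul_assoc, cexp_I_mul]
    congr 1
    refine cexp_I_eq (k 0 * l 0 + k 1 * l 1) ?_
    have e2 : inner ℝ (freq k) (latticeVec l) = 2 * Real.pi * (k 0 * l 0 + k 1 * l 1 : ℤ) := by
      rw [← freqPhase_apply, freqPhase_eq]; push_cast; rfl
    simp only [inner_add_right, inner_smul_right, inner_perp, wedge_add_left, wedge_add_right,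
      wedge_smul_left, wedge_smul_right, wedge_self, e2, perp_add, perp_smul, smul_add]
    rw [wedge_comm x ζ]
    push_cast
    ring
  simp only [h3]
  rw [tsum_mul_right]
  have h4 := (Complex.hasSum_ofReal (L := SummationFilter.unconditional _)).2
    (hasSum_planeCutoff_add ((h / 2) • ζ))
  rw [h4.tsum_eq, Complex.ofReal_one, one_mul]

/-- The symplectic form that occurs in the product of two characters. -/
noncomputable def charForm (h β : ℝ) (k k' : Fin 2 → ℤ) (ζ ζ' : Plane) : ℝ :=
  h / 2 * (inner ℝ (freq k') ζ - inner ℝ (freq k) ζ' + h * β * wedge ζ' ζ)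

/-- The star product of two characters. -/
theorem starSum_character (hβ : ∃ n : ℤ, β = 2 * Real.pi * n) {χ : Plane × Plane → ℝ}
    (hχ : IsLatticeCutoff χ) (h : ℝ) (k k' : Fin 2 → ℤ) (ζ ζ' : Plane) (z : Phase) :
    starSum (fun p => χ p) β h (tensor (character k ζ) (character k' ζ')) (diagCLM z) =
      Complex.exp (Complex.I * (charForm h β k k' ζ ζ' : ℂ)) * character (k + k') (ζ + ζ') z := by
  obtain ⟨n, rfl⟩ := hβ
  set β := 2 * Real.pi * n with hβ
  set θ : Plane × Plane → ℝ := fun p => 2 * β * wedge p.1 p.2 +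
    (inner ℝ (freq k) (z.1 - p.1) + inner ℝ ζ (z.2 + (h * β) • perp p.1)) +
    (inner ℝ (freq k') (z.1 - p.2) + inner ℝ ζ' (z.2 + (h * β) • perp p.2)) with hθ
  set g : Plane × Plane → ℂ := fun p => (χ p : ℂ) * Complex.exp (Complex.I * (θ p : ℂ)) with hg
  have hθd : ContDiff ℝ ∞ θ := by
    have h1 : ContDiff ℝ ∞ fun p : Plane × Plane => perpCLM p.1 := perpCLM.contDiff.comp contDiff_fst
    have h2 : ContDiff ℝ ∞ fun p : Plane × Plane => perpCLM p.2 := perpCLM.contDiff.comp contDiff_snd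
    have h3 : ContDiff ℝ ∞ fun p : Plane × Plane => inner ℝ (freq k) (z.1 - p.1) :=
      contDiff_const.inner ℝ (contDiff_const.sub contDiff_fst)
    have h4 : ContDiff ℝ ∞ fun p : Plane × Plane => inner ℝ (freq k') (z.1 - p.2) :=
      contDiff_const.inner ℝ (contDiff_const.sub contDiff_snd)
    have h5 : ContDiff ℝ ∞ fun p : Plane × Plane => inner ℝ ζ (z.2 + (h * β) • perpCLM p.1) :=
      contDiff_const.inner ℝ (contDiff_const.add (h1.const_smul (h * β)))
    have h6 : ContDiff ℝ ∞ fun p : Plane × Plane => inner ℝ ζ' (z.2 + (h * β) • perpCLM p.2) :=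
      contDiff_const.inner ℝ (contDiff_const.add (h2.const_smul (h * β)))
    exact ((contDiff_const.mul contDiff_wedge).add (h3.add h5)).add (h4.add h6)
  have hgd : ContDiff ℝ ∞ g := (contDiff_ofReal_comp hχ.1).mul (contDiff_cexp_I hθd)
  have hgc : HasCompactSupport g := (hasCompactSupport_ofReal_comp hχ.2.1).mul_right
  -- The shifts `hη'/2` and `-hη/2`, paired with `ζ` and `ζ'`, translate the linear phase by exactly
  -- this vector.
  set v : Plane × Plane := ((h / 2) • ζ', (-(h / 2)) • ζ) with hv
  have h1 := (poissonFamily_freqPhase₂.hasSum_sub hgd hgc v).tsum_eq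
  have h2 : starSum (fun p => χ p) β h (tensor (character k ζ) (character k' ζ')) (diagCLM z) =
      ∑' j, ∫ p, phase (freqPhase₂ j) (p - v) * g p := by
    rw [starSum_eq_tsum]
    refine tsum_congr fun j => integral_congr_ae (Eventually.of_forall fun p => ?_)
    simp only [hg, starKernel, ← mul_assoc, starPhase, tensor, character, phase]
    rw [mul_comm _ (χ p : ℂ)]
    simp only [mul_assoc, cexp_I_mul]
    congr 3
    simp only [hθ, hv, diagCLM_apply, starMap_apply, unitShift, freqPhase₂_apply, freqPhase_apply,
      Prod.fst_add, Prod.snd_add, Prod.fst_sub, Prod.snd_sub, Prod.smul_mk, inner_add_right,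
      inner_sub_right, inner_smul_right, inner_neg_right, smul_neg, smul_zero, inner_zero_right]
    rw [real_inner_comm (freq j.2) ζ, real_inner_comm (freq j.1) ζ']
    push_cast
    ring
  rw [h2, h1]
  have h3 : ∀ l, g (latticeVec₂ l + v) = (χ (v + latticeVec₂ l) : ℂ) *
      (Complex.exp (Complex.I * (charForm h β k k' ζ ζ' : ℂ)) * character (k + k') (ζ + ζ') z) := by
    intro l
    simp only [hg, character, cexp_I_mul]
    rw [add_comm (latticeVec₂ l)]
    congr 1
    refine cexp_I_eq (2 * n * (l.1 0 * l.2 1 - l.1 1 * l.2 0) - (k 0 * l.1 0 + k 1 * l.1 1) -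
      (k' 0 * l.2 0 + k' 1 * l.2 1)) ?_
    have e2 : ∀ k l : Fin 2 → ℤ,
        inner ℝ (freq k) (latticeVec l) = 2 * Real.pi * (k 0 * l 0 + k 1 * l 1 : ℤ) := fun k l => by
      rw [← freqPhase_apply, freqPhase_eq]; push_cast; rfl
    have e3 : wedge (latticeVec l.1) (latticeVec l.2) = l.1 0 * l.2 1 - l.1 1 * l.2 0 := rfl
    have e4 : freq (k + k') = freq k + freq k' := by rw [freq, latticeVec_add, smul_add]; rfl
    simp only [hθ, hv, latticeVec₂, Prod.fst_add, Prod.snd_add, inner_add_right, inner_sub_right,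
      inner_add_left, inner_smul_right, inner_perp, wedge_add_left, wedge_add_right, wedge_smul_left,
      wedge_smul_right, e2, e3, e4, charForm]
    rw [wedge_comm (latticeVec l.1) ζ, wedge_comm (latticeVec l.2) ζ', wedge_comm ζ' ζ]
    rw [hβ]
    push_cast
    ring
  simp only [h3]
  rw [tsum_mul_right, (hχ.hasSum_add v).tsum_eq, one_mul]

/-- The product of two magnetic Weyl operators. -/
theorem weylOp_weylOp (h β : ℝ) (k k' : Fin 2 → ℤ) (ζ ζ' : Plane) (u : Plane → ℂ) (x : Plane) :
    weylOp h β (freq k) ζ (weylOp h β (freq k') ζ' u) x =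
      Complex.exp (Complex.I * (charForm h β k k' ζ ζ' : ℂ)) *
        weylOp h β (freq (k + k')) (ζ + ζ') u x := by
  have e4 : freq (k + k') = freq k + freq k' := by rw [freq, latticeVec_add, smul_add]; rfl
  have e1 : x + h • ζ + h • ζ' = x + h • (ζ + ζ') := by module
  simp only [weylOp, e1, ← mul_assoc, cexp_I_mul]
  congr 4
  simp only [charForm, e4, inner_add_right, inner_add_left, inner_smul_right, wedge_add_left,
    wedge_add_right, wedge_smul_right]
  ring

end Op

/-! ### The quantization acts on sections -/

lemma ModerateWeight.comp_clm {P Q : Type} [NormedAddCommGroup P] [NormedSpace ℝ P]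
    [NormedAddCommGroup Q] [NormedSpace ℝ Q] {w : P → ℝ} {A : ℝ} {s : ℕ}
    (hw : ModerateWeight w A s) {L : Q →L[ℝ] P} (hL : ‖L‖ ≤ 1) :
    ModerateWeight (fun q => w (L q)) A s where
  pos q := hw.pos _
  const_nonneg := hw.const_nonneg
  le p δ := by
    have h1 : ‖L δ‖ ≤ ‖δ‖ := by simpa using L.le_of_opNorm_le hL δ
    have := hw.const_nonneg
    have := (hw.pos (L p)).le
    rw [map_add]
    exact (hw.le _ _).trans (by gcongr)

/-- The factor of the amplitude that does not depend on the symbol. -/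
noncomputable def opFactor (β : ℝ) (u : Plane → ℂ) (p : Plane × Plane) : ℂ :=
  Complex.exp (Complex.I * ((-(β * wedge p.2 p.1) : ℝ) : ℂ)) * u p.2

/-- The projection of `((r, ξ), s)` to `(r, s)`. -/
noncomputable def opProj : Phase × Plane →L[ℝ] Plane × Plane :=
  ((ContinuousLinearMap.fst ℝ Plane Plane).comp (ContinuousLinearMap.fst ℝ Phase Plane)).prod
    (ContinuousLinearMap.snd ℝ Phase Plane)

lemma opProj_apply (p : Phase × Plane) : opProj p = (p.1.1, p.2) := rfl

/-- The amplitude of the quantization as a function of independent variables. -/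
noncomputable def opAmplitude (β : ℝ) (u : Plane → ℂ) (a : Phase → ℂ) (p : Phase × Plane) : ℂ :=
  a p.1 * opFactor β u (opProj p)

/-- The map `y ↦ ((y, -hβ y^⊥), 2y)`. -/
noncomputable def opShear (h β : ℝ) : Plane →L[ℝ] Phase × Plane :=
  (opMap h β).prod ((2 : ℝ) • ContinuousLinearMap.id ℝ Plane)

/-- The map `x ↦ ((x, -hβ x^⊥), x)`. -/
noncomputable def opBase (h β : ℝ) : Plane →L[ℝ] Phase × Plane :=
  (opMap h β).prod (ContinuousLinearMap.id ℝ Plane)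

/-- In the definition `x` also occurs in the cutoff factor. Treating `x + 2y` as a further
independent variable turns the dependence on `x` into a pure translation, so that the results on
sheared series apply. -/
lemma opSum_eq_shearSum (h β : ℝ) (a : Phase → ℂ) (u : Plane → ℂ) (x : Plane) :
    opSum h β a u x = shearSum freqPhase (fun y => (planeCutoff y : ℂ)) (opShear h β)
      (fun k => (opShift h k, 0)) (opAmplitude β u a) (opBase h β x) := by
  refine tsum_congr fun k => integral_congr_ae (Eventually.of_forall fun y => ?_)
  have e : ∀ k, opBase h β x + opShear h β y + (opShift h k, 0) =
      (opMap h β x + opMap h β y + opShift h k, x + (2 : ℝ) • y) := fun k =>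
    Prod.ext rfl (add_zero _)
  -- This identity expresses the phase `y ∧ x` through the two arguments `x + y` and `x + 2y` alone.
  have e2 : wedge (x + (2 : ℝ) • y) (x + y) = wedge y x := by
    simp only [wedge, PiLp.add_apply, PiLp.smul_apply, smul_eq_mul]; ring
  have e3 : (opMap h β x + opMap h β y + opShift h k).1 = x + y := add_zero _
  simp only [e, opAmplitude, opProj_apply, opFactor, e3, e2, opCutoff, smul_eq_mul]
  ring

/-! ### Smoothness, local bounds and quasi-periodicity of the quantized functions. -/

section Section

variable {β : ℝ} {u : Plane → ℂ} {w : Phase → ℝ} {A : ℝ} {s : ℕ}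

lemma contDiff_opFactor (β : ℝ) (hu : ContDiff ℝ ∞ u) : ContDiff ℝ ∞ (opFactor β u) :=
  (contDiff_cexp_I (contDiff_const.mul (contDiff_wedge_comp contDiff_snd contDiff_fst)).neg).mul
    (hu.comp contDiff_snd)

lemma contDiff_opAmplitude (β : ℝ) (hu : ContDiff ℝ ∞ u) {a : Phase → ℂ} (ha : ContDiff ℝ ∞ a) :
    ContDiff ℝ ∞ (opAmplitude β u a) :=
  (ha.comp contDiff_fst).mul ((contDiff_opFactor β hu).comp opProj.contDiff)

lemma norm_opShift_prod_le (h : ℝ) (k : Fin 2 → ℤ) :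
    ‖((opShift h k, 0) : Phase × Plane)‖ ≤ (|h| * (2 * Real.pi)) * latSize k :=
  norm_prod_le_iff.2 ⟨norm_opShift_le h k, by
    simpa using (norm_nonneg _).trans (norm_opShift_le h k)⟩

/-- The frequency shifts act on the momentum only, so the factor with `u` sees arguments in a
compact set while the symbol contributes the power `ν^s`. The constant depends on the seminorms `C`,
not on the symbol. -/
theorem exists_bound_opAmplitude (hw : ModerateWeight w A s) (hu : ContDiff ℝ ∞ u) (h β : ℝ)
    (C : ℕ → ℝ) (R : ℝ) (n : ℕ) : ∃ B, 0 ≤ B ∧ ∀ a, SymbolBound w C a → ∀ z : Phase × Plane, ‖z‖ ≤ R → ∀ k,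
      ∀ y ∈ tsupport (fun y => (planeCutoff y : ℂ)),
      ‖iteratedFDeriv ℝ n (opAmplitude β u a) (z + opShear h β y + (opShift h k, 0))‖ ≤
        B * latSize k ^ s := by
  have hc := hasCompactSupport_ofReal_comp hasCompactSupport_planeCutoff
  set L := ContinuousLinearMap.fst ℝ Phase Plane with hL
  have hL1 : ‖L‖ ≤ 1 := ContinuousLinearMap.norm_fst_le ..
  have hw' := hw.comp_clm hL1
  obtain ⟨B, hB, H⟩ := hw'.exists_shear_bound (K := Fin 2 → ℤ) (ν := latSize) hc one_le_latSize ‖opShear h β‖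
    (|h| * (2 * Real.pi))
  obtain ⟨R', hR', hy'⟩ := exists_tsupport_norm_le hc
  set ρ := ‖opProj‖ * (|R| + ‖opShear h β‖ * R') with hρ
  have hD : ∀ i, ∃ D, 0 ≤ D ∧ ∀ p, ‖p‖ ≤ ρ → ‖iteratedFDeriv ℝ i (opFactor β u) p‖ ≤ D := by
    intro i
    obtain ⟨D, hD⟩ := (isCompact_closedBall (0 : Plane × Plane) ρ).exists_bound_of_continuousOn
      ((contDiff_opFactor β hu).continuous_iteratedFDeriv (m := i)
        (by exact_mod_cast le_top)).continuousOn
    exact ⟨max D 0, le_max_right _ _, fun p hp =>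
      (hD p (mem_closedBall_zero_iff.2 hp)).trans (le_max_left _ _)⟩
  choose D hD0 hD using hD
  have hA := hw.const_nonneg
  have h0 := hw.pos 0
  set W := B * (A * (1 + |R|) ^ s * w 0) with hW
  have hW0 : 0 ≤ W := by positivity
  refine ⟨∑ i ∈ Finset.range (n + 1), (n.choose i : ℝ) * (|C i| * W) *
    (‖opProj‖ ^ (n - i) * D (n - i)), Finset.sum_nonneg fun i _ => by
      have := hD0 (n - i); positivity, fun a ha z hz k y hy => ?_⟩
  have ha' := ha.comp_clm_of_norm_le_one hL1
  have hk := zero_le_one.trans (one_le_latSize k)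
  have h1 : w (L (z + opShear h β y + (opShift h k, 0))) ≤ W * latSize k ^ s := by
    refine (H _ _ le_rfl (norm_opShift_prod_le h) z k y hy).trans ?_
    have := hw'.le_of_norm_le (hz.trans (le_abs_self R))
    simp only [map_zero] at this
    exact mul_le_mul_of_nonneg_right (mul_le_mul_of_nonneg_left this hB) (pow_nonneg hk s)
  refine (norm_iteratedFDeriv_mul_le ha'.smooth ((contDiff_opFactor β hu).comp opProj.contDiff) _
    (n := n) (by exact_mod_cast le_top)).trans ?_
  rw [Finset.sum_mul]
  refine Finset.sum_le_sum fun i _ => ?_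
  have h2 := (ha'.bound i (z + opShear h β y + (opShift h k, 0))).trans
    ((mul_le_mul_of_nonneg_right (le_abs_self (C i)) (hw.pos _).le).trans
      (mul_le_mul_of_nonneg_left h1 (abs_nonneg _)))
  have h3 := norm_iteratedFDeriv_comp_clm_le (contDiff_opFactor β hu) opProj (n - i)
    (z + opShear h β y + (opShift h k, 0))
  -- The projection forgets the momentum and hence the unbounded shift.
  have h4 : ‖opProj (z + opShear h β y + (opShift h k, 0))‖ ≤ ρ := by
    have : opProj (z + opShear h β y + (opShift h k, 0)) = opProj (z + opShear h β y) := by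
      rw [map_add _ (z + opShear h β y)]
      exact add_zero _
    rw [this]
    refine (opProj.le_opNorm _).trans ?_
    have h5 := norm_add_le z (opShear h β y)
    have h6 := (opShear h β).le_opNorm y
    have h7 := hy' y hy
    have h8 := hz.trans (le_abs_self R)
    rw [hρ]
    gcongr
    exact h5.trans (add_le_add h8 (h6.trans (by gcongr)))
  have h5 := hD (n - i) _ h4
  have h6 := hD0 (n - i)
  calc _ ≤ (n.choose i : ℝ) * (|C i| * (W * latSize k ^ s)) *
        (‖opProj‖ ^ (n - i) * D (n - i)) := by
          gcongr
          exact h3.trans (by gcongr)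
    _ = _ := by ring

lemma shearBounded_opAmplitude (hw : ModerateWeight w A s) (hu : ContDiff ℝ ∞ u) (h β : ℝ)
    {C : ℕ → ℝ} {a : Phase → ℂ} (ha : SymbolBound w C a) :
    ShearBounded (fun y => (planeCutoff y : ℂ)) latSize (opShear h β) (fun k => (opShift h k, 0)) s
      (opAmplitude β u a) := by
  refine ⟨contDiff_opAmplitude β hu ha.smooth, fun R n => ?_⟩
  obtain ⟨B, hB, H⟩ := exists_bound_opAmplitude hw hu h β C R n
  exact ⟨B, hB, H a ha⟩

lemma contDiff_cutoff : ContDiff ℝ ∞ fun y => (planeCutoff y : ℂ) :=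
  contDiff_ofReal_comp contDiff_planeCutoff

lemma hasCompactSupport_cutoff : HasCompactSupport fun y => (planeCutoff y : ℂ) :=
  hasCompactSupport_ofReal_comp hasCompactSupport_planeCutoff

theorem contDiff_opSum (hw : ModerateWeight w A s) (hu : ContDiff ℝ ∞ u) (h β : ℝ)
    {a : Phase → ℂ} (ha : HasSymbolBound w a) : ContDiff ℝ ∞ (opSum h β a u) := by
  obtain ⟨C, ha⟩ := ha
  rw [funext (opSum_eq_shearSum h β a u)]
  exact (contDiff_shearSum phaseFamily_freqPhase contDiff_cutoff hasCompactSupport_cutoff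
    (shearBounded_opAmplitude hw hu h β ha)).comp (opBase h β).contDiff

/-- Uniform local bounds of the quantization for bounded families of symbols. -/
theorem exists_norm_opSum_le_of_norm_le (hw : ModerateWeight w A s) (hu : ContDiff ℝ ∞ u) (h β : ℝ)
    (C : ℕ → ℝ) (R : ℝ) : ∃ B, ∀ a, SymbolBound w C a → ∀ x : Plane, ‖x‖ ≤ R → ‖opSum h β a u x‖ ≤ B := by
  choose b hb H using exists_bound_opAmplitude hw hu h β C (‖opBase h β‖ * R)
  refine ⟨oscConst (fun y => (planeCutoff y : ℂ)) s * (∑ n ∈ Finset.range (s + 9),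
    ‖opShear h β‖ ^ n * b n) * ∑' k : Fin 2 → ℤ, (latSize k ^ 8)⁻¹, fun a ha x hx => ?_⟩
  rw [opSum_eq_shearSum]
  refine norm_oscSum_le phaseFamily_freqPhase contDiff_cutoff hasCompactSupport_cutoff
    (oscBounded_of_bounds (fun k => contDiff_shear (contDiff_opAmplitude β hu ha.smooth) _ _ _)
      (fun n => mul_nonneg (by positivity) (hb n)) one_le_latSize fun n k y hy =>
        (norm_iteratedFDeriv_shear_le (contDiff_opAmplitude β hu ha.smooth) _ _ _ n y).trans ?_)
  rw [mul_assoc]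
  refine mul_le_mul_of_nonneg_left (H n a ha _ ?_ k y hy) (by positivity)
  exact ((opBase h β).le_opNorm x).trans (by gcongr)

lemma perp_latticeVec (l : Fin 2 → ℤ) : perp (latticeVec l) = latticeVec ![-(l 1), l 0] := by
  ext i; fin_cases i <;> simp [perp, latticeVec]

lemma latticeVec_zsmul (n : ℤ) (l : Fin 2 → ℤ) : latticeVec (n • l) = (n : ℝ) • latticeVec l := by
  ext i; fin_cases i <;> simp [latticeVec]

lemma freq_add (k l : Fin 2 → ℤ) : freq (k + l) = freq k + freq l := by
  rw [freq, latticeVec_add, smul_add]; rfl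

lemma basisVec_eq_latticeVec (j : Fin 2) : basisVec j = latticeVec (Pi.single j 1) := by
  ext i; fin_cases j <;> fin_cases i <;> simp [basisVec, latticeVec]

/-- Translating `x` by `l` moves the momentum by `-hβ l^⊥`, which is also the effect of adding `2β
l^⊥ ∈ 2πℤ²` to the frequency. The corresponding change of phase is compensated by the
quasi-periodicity of `u` and by the factor `e^{-iβ y∧x}`. Thus each term at the translated point is
a multiple of another term at `x`, and the series is reindexed. -/
theorem isQuasiPeriodic_opSum (hβ : ∃ n : ℤ, β = 2 * Real.pi * n) (hq : IsQuasiPeriodic β u)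
    (h : ℝ) {a : Phase → ℂ} (hp : ∀ (k : Fin 2 → ℤ) (x ξ : Plane), a (x + latticeVec k, ξ) = a (x, ξ)) :
    IsQuasiPeriodic β (opSum h β a u) := by
  intro j x
  obtain ⟨n, rfl⟩ := hβ
  set l : Fin 2 → ℤ := Pi.single j 1 with hl
  set c : Fin 2 → ℤ := (2 * n) • ![-(l 1), l 0] with hc
  have hfc : ∀ k, freq (k + c) = freq k + (2 * (2 * Real.pi * n)) • perp (latticeVec l) := fun k => by
    rw [freq_add, perp_latticeVec, freq, freq, hc, latticeVec_zsmul]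
    push_cast; module
  have hT : ∀ k, oscTerm (freqPhase k) (opCutoff (2 * Real.pi * n) u (x + basisVec j))
      (fun y => a (opMap h (2 * Real.pi * n) (x + basisVec j) + opMap h (2 * Real.pi * n) y +
        opShift h k)) =
      Complex.exp (Complex.I * ((2 * Real.pi * n / 2 * wedge (basisVec j) x : ℝ) : ℂ)) *
      oscTerm (freqPhase (k + c)) (opCutoff (2 * Real.pi * n) u x)
      (fun y => a (opMap h (2 * Real.pi * n) x + opMap h (2 * Real.pi * n) y +
        opShift h (k + c))) := by
    intro k
    rw [oscTerm, oscTerm, ← integral_const_mul]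
    refine integral_congr_ae (Eventually.of_forall fun y => ?_)
    have e1 : x + basisVec j + (2 : ℝ) • y = x + (2 : ℝ) • y + basisVec j := by module
    have e2 : a (opMap h (2 * Real.pi * n) (x + basisVec j) + opMap h (2 * Real.pi * n) y +
        opShift h k) = a (opMap h (2 * Real.pi * n) x + opMap h (2 * Real.pi * n) y +
        opShift h (k + c)) := by
      have e3 : opMap h (2 * Real.pi * n) (x + basisVec j) + opMap h (2 * Real.pi * n) y +
          opShift h k = ((x + y) + latticeVec l, (opMap h (2 * Real.pi * n) x +
            opMap h (2 * Real.pi * n) y + opShift h (k + c)).2) := by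
        refine Prod.ext ?_ ?_
        · simp only [opMap_apply, opShift, Prod.fst_add, basisVec_eq_latticeVec, add_zero]; abel
        · simp only [opMap_apply, opShift, Prod.snd_add, hfc, perp_add, basisVec_eq_latticeVec]
          module
      rw [e3, hp]
      congr 1
      exact Prod.ext (add_zero _).symm rfl
    simp only [e2, opCutoff, e1, hq j, smul_eq_mul]
    have e4 : ∀ E₁ E₂ E₃ E₄ E₅ E₆ θ U a : ℂ, E₁ * E₂ * E₃ = E₄ * E₅ * E₆ →
        E₁ * (θ * (E₂ * (E₃ * U)) * a) = E₄ * (E₅ * (θ * (E₆ * U) * a)) := by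
      intros E₁ E₂ E₃ E₄ E₅ E₆ θ U a hE
      linear_combination (θ * U * a) * hE
    refine e4 _ _ _ _ _ _ _ _ _ ?_
    simp only [phase, cexp_I_mul]
    congr 3
    rw [freqPhase_apply, freqPhase_apply, hfc, inner_add_left, inner_smul_left, real_inner_comm,
      basisVec_eq_latticeVec, real_inner_comm, real_inner_comm y (perp _), inner_perp]
    simp only [wedge_add_right, wedge_smul_right, ← hl, conj_trivial]
    rw [wedge_comm y (latticeVec l)]
    ring
  calc opSum h (2 * Real.pi * n) a u (x + basisVec j) = _ := tsum_congr hT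
    _ = _ := by
      rw [tsum_mul_left]
      congr 1
      exact (Equiv.addRight c).tsum_eq (fun k => oscTerm (freqPhase k) (opCutoff (2 * Real.pi * n) u x)
        (fun y => a (opMap h (2 * Real.pi * n) x + opMap h (2 * Real.pi * n) y + opShift h k)))

lemma IsQuasiPeriodic.norm_add_latticeVec (hq : IsQuasiPeriodic β u) (l : Fin 2 → ℤ) (x : Plane) :
    ‖u (x + latticeVec l)‖ = ‖u x‖ := by
  rw [latticeVec_eq_sum, ← add_assoc, hq.add_zsmul, hq.add_zsmul, norm_mul, norm_mul, norm_cexp_I,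
    norm_cexp_I, one_mul, one_mul]

lemma exists_norm_add_latticeVec_le (x : Plane) : ∃ l, ‖x + latticeVec l‖ ≤ 2 := by
  refine ⟨fun i => -⌊x i⌋, ?_⟩
  rw [EuclideanSpace.norm_eq, Real.sqrt_le_left zero_le_two]
  have h : ∀ i, ‖(x + latticeVec fun i => -⌊x i⌋) i‖ ^ 2 ≤ 1 := by
    intro i
    have e : (x + latticeVec fun i => -⌊x i⌋) i = x i - ⌊x i⌋ := by
      fin_cases i <;> simp [latticeVec, sub_eq_add_neg]
    rw [e, Real.norm_eq_abs, sq_abs]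
    have h1 := Int.floor_le (x i)
    have h2 := Int.lt_floor_add_one (x i)
    nlinarith
  rw [Fin.sum_univ_two]
  linarith [h 0, h 1]

/-- A quasi-periodic function is bounded by its bound near the unit cell. -/
theorem IsQuasiPeriodic.norm_le (hq : IsQuasiPeriodic β u) {B : ℝ} (hB : ∀ x, ‖x‖ ≤ 2 → ‖u x‖ ≤ B)
    (x : Plane) : ‖u x‖ ≤ B := by
  obtain ⟨l, hl⟩ := exists_norm_add_latticeVec_le x
  rw [← hq.norm_add_latticeVec l]
  exact hB _ hl

end Section

/-! ### Superpositions of characters -/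

section Superposition

variable {V K P : Type} [NormedAddCommGroup V] [NormedSpace ℝ V] [FiniteDimensional ℝ V]
  [MeasureSpace V] [BorelSpace V] [(volume : Measure V).IsAddHaarMeasure]
  [NormedAddCommGroup P] [NormedSpace ℝ P]

lemma phase_add_apply (κ : P →L[ℝ] ℝ) (p q : P) : phase κ (p + q) = phase κ p * phase κ q := by
  simp only [phase, map_add, cexp_I_mul]

lemma norm_iteratedFDeriv_phase_le (κ : P →L[ℝ] ℝ) (n : ℕ) (p : P) :
    ‖iteratedFDeriv ℝ n (phase κ) p‖ ≤ ‖κ‖ ^ n := by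
  induction n with
  | zero => simp [norm_phase]
  | succ n ih =>
    have e : fderiv ℝ (phase κ) = fun y =>
        ContinuousLinearMap.smulRightL ℝ P ℂ κ (Complex.I * phase κ y) := by
      funext y
      rw [(hasFDerivAt_phase κ y).fderiv]
      ext v
      simp; ring
    set L : ℂ →L[ℝ] P →L[ℝ] ℂ := (ContinuousLinearMap.smulRightL ℝ P ℂ κ).comp
      (ContinuousLinearMap.mul ℝ ℂ Complex.I) with hL
    have hn : ‖L‖ ≤ ‖κ‖ := by
      refine ContinuousLinearMap.opNorm_le_bound _ (norm_nonneg _) fun c => ?_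
      have : L c = κ.smulRight (Complex.I * c) := rfl
      rw [this, ContinuousLinearMap.norm_smulRight_apply]
      simp
    rw [← norm_iteratedFDeriv_fderiv, e]
    have h1 := L.norm_iteratedFDeriv_comp_left ((contDiff_phase κ (n := n)).contDiffAt (x := p))
      (n := n) le_rfl
    refine h1.trans ?_
    rw [pow_succ']
    exact mul_le_mul hn ih (norm_nonneg _) (norm_nonneg _)

variable {φ : K → V →L[ℝ] ℝ} {ν : K → ℝ} {g : V → ℂ}

/-- Sheared oscillatory series of a superposition of exponentials. -/
theorem shearSum_superposition (hφ : PhaseFamily φ ν) (hg : ContDiff ℝ ∞ g)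
    (hc : HasCompactSupport g) {Y : Type*} [TopologicalSpace Y] [SecondCountableTopology Y]
    [MeasurableSpace Y] [OpensMeasurableSpace Y] {μ : Measure Y} [SFinite μ] {α : Y → ℂ}
    {κ : Y → P →L[ℝ] ℝ} (hα : Continuous α) (hκ : Continuous κ)
    (hi : Integrable (fun s => ‖α s‖ * (1 + ‖κ s‖) ^ 8) μ) (M : V →L[ℝ] P) (c : K → P) (z : P) :
    Integrable (fun s => α s * shearSum φ g M c (phase (κ s)) z) μ ∧
      ∫ s, α s * shearSum φ g M c (phase (κ s)) z ∂μ =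
        shearSum φ g M c (fun p => ∫ s, α s * phase (κ s) p ∂μ) z := by
  have e : ∀ s, α s * shearSum φ g M c (phase (κ s)) z =
      oscSum φ g (fun k y => α s * phase (κ s) (z + M y + c k)) := fun s => by
    rw [shearSum, oscSum, ← tsum_mul_left]
    refine tsum_congr fun k => ?_
    rw [oscTerm, ← integral_const_mul]
    refine integral_congr_ae (Eventually.of_forall fun y => ?_)
    simp only [smul_eq_mul]; ring
  simp only [e]
  -- The derivatives of an exponential do not grow with the shift, so `q = 0`; the eight derivatives
  -- cost the factor `(1 + ‖κ s‖)^8` in the integrability assumption.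
  refine integral_oscSum (q := 0) hφ hg hc (hi.const_mul ((1 + ‖M‖) ^ 8)) (fun s => ⟨fun k =>
    contDiff_const.mul (contDiff_shear (contDiff_phase _) _ _ _), fun k n hn y _ => ?_⟩) fun k => ?_
  · have h1 := (ContinuousLinearMap.mul ℝ ℂ (α s)).norm_iteratedFDeriv_comp_left
      ((contDiff_shear (contDiff_phase (κ s)) M z (c k)).contDiffAt (x := y)) (n := n)
      (by exact_mod_cast le_top)
    refine h1.trans ?_
    have h2 := norm_iteratedFDeriv_shear_le (contDiff_phase (κ s)) M z (c k) n y
    have h3 := norm_iteratedFDeriv_phase_le (κ s) n (z + M y + c k)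
    have h4 : ‖M‖ ^ n ≤ (1 + ‖M‖) ^ 8 := (pow_le_pow_left₀ (norm_nonneg _) (by linarith) n).trans
      (pow_le_pow_right₀ (by linarith [norm_nonneg M]) hn)
    have h5 : ‖κ s‖ ^ n ≤ (1 + ‖κ s‖) ^ 8 := (pow_le_pow_left₀ (norm_nonneg _) (by linarith) n).trans
      (pow_le_pow_right₀ (by linarith [norm_nonneg (κ s)]) hn)
    rw [ContinuousLinearMap.opNorm_mul_apply, pow_zero, mul_one]
    calc _ ≤ ‖α s‖ * ((1 + ‖M‖) ^ 8 * (1 + ‖κ s‖) ^ 8) := by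
          gcongr
          exact h2.trans (mul_le_mul h4 (h3.trans h5) (norm_nonneg _) (by positivity))
      _ = _ := by ring
  · have h1 : Continuous fun p : Y × V => κ p.1 (z + M p.2 + c k) :=
      (hκ.comp continuous_fst).clm_apply ((continuous_const.add
        (M.continuous.comp continuous_snd)).add continuous_const)
    have : SecondCountableTopology V := inferInstance
    exact ((hα.comp continuous_fst).mul (Complex.continuous_exp.comp
      (continuous_const.mul (Complex.continuous_ofReal.comp h1)))).aestronglyMeasurable

end Superposition

/-! ### Symbols of rapid decay in the momentum -/

/-- Smooth periodic symbols all of whose derivatives decay rapidly in `ξ`. -/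
structure IsRapid (a : Phase → ℂ) : Prop where
  periodic : ∀ (k : Fin 2 → ℤ) (x ξ : Plane), a (x + latticeVec k, ξ) = a (x, ξ)
  bound : ∀ m : ℝ, HasSymbolBound (symbolWeight m) a

lemma HasSymbolBound.of_hasCompactSupport {V : Type*} [NormedAddCommGroup V] [NormedSpace ℝ V]
    {g : V → ℂ} (hg : ContDiff ℝ ∞ g) (hc : HasCompactSupport g) {w : V → ℝ} (hw : Continuous w)
    (hpos : ∀ x, 0 < w x) : HasSymbolBound w g := by
  have key : ∀ n, ∃ C, ∀ x, ‖iteratedFDeriv ℝ n g x‖ ≤ C * w x := by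
    intro n
    have h1 : Continuous fun x => (w x)⁻¹ • iteratedFDeriv ℝ n g x :=
      (hw.inv₀ fun x => (hpos x).ne').smul (hg.continuous_iteratedFDeriv (by exact_mod_cast le_top))
    obtain ⟨C, hC⟩ := ((hc.iteratedFDeriv n).smul_left (f := fun x => (w x)⁻¹)).exists_bound_of_continuous h1
    refine ⟨C, fun x => ?_⟩
    have h2 : ‖(w x)⁻¹ • iteratedFDeriv ℝ n g x‖ ≤ C := hC x
    rw [norm_smul, norm_inv, Real.norm_of_nonneg (hpos x).le] at h2
    exact (inv_mul_le_iff₀' (hpos x)).1 h2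
  choose C hC using key
  exact ⟨C, hg, hC⟩

lemma continuous_japanese : Continuous japanese :=
  (continuous_const.add (continuous_norm.pow 2)).sqrt

lemma continuous_japanese_rpow (m : ℝ) : Continuous fun ξ : Plane => japanese ξ ^ m :=
  continuous_japanese.rpow_const fun ξ => Or.inl (japanese_pos ξ).ne'

lemma integrable_japanese : Integrable fun ξ : Plane => japanese ξ ^ (-4 : ℝ) := by
  have h := integrable_rpow_neg_one_add_norm_sq (E := Plane) (μ := volume) (r := 4) (by simp; norm_num)
  refine h.congr (Eventually.of_forall fun ξ => ?_)
  show (1 + ‖ξ‖ ^ 2) ^ (-4 / 2 : ℝ) = (Real.sqrt (1 + ‖ξ‖ ^ 2)) ^ (-4 : ℝ)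
  rw [Real.sqrt_eq_rpow, ← Real.rpow_mul (by positivity)]
  norm_num

/-- The weight `⟨x⟩^{-4} ⟨ξ⟩^{-4}`. -/
noncomputable def phaseWeight (z : Phase) : ℝ := japanese z.1 ^ (-4 : ℝ) * japanese z.2 ^ (-4 : ℝ)

lemma integrable_phaseWeight : Integrable phaseWeight := integrable_japanese.mul_prod integrable_japanese

/-- A symbol multiplied with the cutoff of a fundamental domain. -/
noncomputable def cutSymbol (a : Phase → ℂ) (z : Phase) : ℂ := (planeCutoff z.1 : ℂ) * a z

variable {a : Phase → ℂ}

lemma IsRapid.hasSymbolBound_cutSymbol (ha : IsRapid a) : HasSymbolBound phaseWeight (cutSymbol a) := by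
  obtain ⟨C, hC⟩ := HasSymbolBound.of_hasCompactSupport contDiff_cutoff hasCompactSupport_cutoff
    (continuous_japanese_rpow (-4)) fun x => Real.rpow_pos_of_pos (japanese_pos x) _
  obtain ⟨C', hC'⟩ := ha.bound (-4)
  exact ⟨_, (hC.comp_clm (ContinuousLinearMap.fst ℝ Plane Plane)).mul hC'⟩

lemma IsRapid.integrable_iteratedFDeriv (ha : IsRapid a) (n : ℕ) :
    Integrable fun z => ‖iteratedFDeriv ℝ n (cutSymbol a) z‖ := by
  obtain ⟨C, hC⟩ := ha.hasSymbolBound_cutSymbol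
  refine (integrable_phaseWeight.const_mul (C n)).mono' (hC.smooth.continuous_iteratedFDeriv
    (by exact_mod_cast le_top)).norm.aestronglyMeasurable (Eventually.of_forall fun z => ?_)
  simpa using hC.bound n z

lemma IsRapid.integrable_cutSymbol (ha : IsRapid a) : Integrable (cutSymbol a) := by
  have := ha.integrable_iteratedFDeriv 0
  simp only [norm_iteratedFDeriv_zero] at this
  exact (integrable_norm_iff ha.hasSymbolBound_cutSymbol.smooth.continuous.aestronglyMeasurable).1 this

/-- The dual space of `𝕋² × ℝ²`. -/
abbrev Dual : Type := (Fin 2 → ℤ) × Plane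

/-- The linear functional `(x, ξ) ↦ 2πk · x + ζ · ξ`. -/
noncomputable def charCLM (s : Dual) : Phase →L[ℝ] ℝ := (freqPhase s.1).coprod (innerSL ℝ s.2)

lemma charCLM_apply (s : Dual) (z : Phase) :
    charCLM s z = inner ℝ (freq s.1) z.1 + inner ℝ s.2 z.2 := rfl

lemma character_eq_phase (k : Fin 2 → ℤ) (ζ : Plane) : character k ζ = phase (charCLM (k, ζ)) := rfl

lemma continuous_charCLM : Continuous charCLM :=
  continuous_prod_of_discrete_left.2 fun k => by
    have h : Continuous fun ζ : Plane => (freqPhase k).comp (ContinuousLinearMap.fst ℝ Plane Plane) +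
      (innerSL ℝ ζ).comp (ContinuousLinearMap.snd ℝ Plane Plane) :=
      continuous_const.add ((innerSL ℝ).continuous.clm_comp continuous_const)
    refine h.congr fun ζ => ?_
    ext z <;> simp [charCLM]

lemma norm_charCLM_le (s : Dual) : ‖charCLM s‖ ≤ 14 * ((1 + ‖s.1‖) * (1 + ‖s.2‖)) := by
  refine ContinuousLinearMap.opNorm_le_bound _ (by positivity) fun z => ?_
  have h1 := norm_freq_le s.1
  have h2 := abs_real_inner_le_norm (freq s.1) z.1
  have h3 := abs_real_inner_le_norm s.2 z.2
  have h4 := norm_fst_le z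
  have h5 := norm_snd_le z
  have h6 : ‖freq s.1‖ ≤ 13 * ‖s.1‖ := h1.trans (by
    have := Real.pi_lt_d2
    gcongr; linarith)
  rw [charCLM_apply, Real.norm_eq_abs]
  calc _ ≤ ‖freq s.1‖ * ‖z.1‖ + ‖s.2‖ * ‖z.2‖ := (abs_add_le _ _).trans (add_le_add h2 h3)
    _ ≤ 13 * ‖s.1‖ * ‖z‖ + ‖s.2‖ * ‖z‖ := by gcongr
    _ ≤ _ := by
      rw [← add_mul]
      gcongr
      nlinarith [norm_nonneg s.1, norm_nonneg s.2, mul_nonneg (norm_nonneg s.1) (norm_nonneg s.2)]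

/-- The Fourier transform of a symbol with the cutoff of a fundamental domain. -/
noncomputable def symbolCoeff (a : Phase → ℂ) (s : Dual) : ℂ :=
  ∫ z, phase (-charCLM s) z * cutSymbol a z

lemma IsRapid.continuous_symbolCoeff (ha : IsRapid a) : Continuous (symbolCoeff a) := by
  refine continuous_of_dominated (bound := fun z => ‖cutSymbol a z‖) (fun s => ?_)
    (fun s => Eventually.of_forall fun z => ?_) ha.integrable_cutSymbol.norm
    (Eventually.of_forall fun z => ?_)
  · exact ((continuous_phase _).mul ha.hasSymbolBound_cutSymbol.smooth.continuous).aestronglyMeasurable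
  · rw [norm_mul, norm_phase, one_mul]
  · exact (Complex.continuous_exp.comp (continuous_const.mul (Complex.continuous_ofReal.comp
      (continuous_charCLM.neg.clm_apply continuous_const)))).mul continuous_const

lemma exists_inner_eq_norm (w : Plane) : ∃ v : Plane, ‖v‖ ≤ 1 ∧ inner ℝ w v = ‖w‖ := by
  rcases eq_or_ne w 0 with rfl | hw
  · exact ⟨0, by simp, by simp⟩
  · have h := norm_ne_zero_iff.2 hw
    refine ⟨‖w‖⁻¹ • w, by rw [norm_smul, norm_inv, norm_norm, inv_mul_cancel₀ h], ?_⟩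
    rw [inner_smul_right, real_inner_self_eq_norm_sq, sq, inv_mul_cancel_left₀ h]

/-- The Fourier coefficients of rapidly decaying symbols decay rapidly. -/
theorem IsRapid.exists_symbolCoeff_le (ha : IsRapid a) (n : ℕ) :
    ∃ C, ∀ s : Dual, ‖symbolCoeff a s‖ * ((1 + ‖s.1‖) * (1 + ‖s.2‖)) ^ n ≤ C := by
  set I : ℕ → ℝ := fun n => ∫ z, ‖iteratedFDeriv ℝ n (cutSymbol a) z‖ with hI
  have hI0 : ∀ n, 0 ≤ I n := fun n => integral_nonneg fun _ => norm_nonneg _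
  -- The product `(1 + |k|)(1 + |ζ|)` is quadratic in the larger of the two sizes, so its `n`-th
  -- power requires `2n` integrations by parts.
  have key : ∀ (s : Dual) (v : Phase), ‖v‖ ≤ 1 →
      |charCLM s v| ^ (2 * n) * ‖symbolCoeff a s‖ ≤ I (2 * n) := by
    intro s v hv
    have h := abs_pow_mul_norm_integral_phase_le (-charCLM s) v (2 * n) (cutSymbol a)
      ha.hasSymbolBound_cutSymbol.smooth fun i _ => ha.integrable_iteratedFDeriv i
    have h1 : |(-charCLM s) v| = |charCLM s v| := abs_neg _
    rw [h1] at h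
    exact h.trans (mul_le_of_le_one_left (hI0 _) (pow_le_one₀ (norm_nonneg _) hv))
  refine ⟨3 ^ (2 * n) * (I 0 + I (2 * n) + I (2 * n)), fun s => ?_⟩
  obtain ⟨v₁, hv₁, h₁⟩ := exists_norm_le_abs_freqPhase s.1
  obtain ⟨v₂, hv₂, h₂⟩ := exists_inner_eq_norm s.2
  have e1 : charCLM s (v₁, 0) = freqPhase s.1 v₁ := by simp [charCLM]
  have e2 : charCLM s (0, v₂) = ‖s.2‖ := by simp [charCLM, h₂]
  have k1 := key s (v₁, 0) (by simpa [Prod.norm_def] using hv₁)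
  have k2 := key s (0, v₂) (by simpa [Prod.norm_def] using hv₂)
  rw [e1] at k1
  rw [e2, abs_norm] at k2
  have k0 : ‖symbolCoeff a s‖ ≤ I 0 := by
    refine (norm_integral_le_integral_norm _).trans_eq ?_
    simp [hI, norm_phase]
  have k3 : ‖s.1‖ ^ (2 * n) * ‖symbolCoeff a s‖ ≤ I (2 * n) := le_trans (by gcongr) k1
  have h3 : ((1 + ‖s.1‖) * (1 + ‖s.2‖)) ^ n ≤
      3 ^ (2 * n) * (1 + ‖s.1‖ ^ (2 * n) + ‖s.2‖ ^ (2 * n)) := by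
    set p := ‖s.1‖
    set q := ‖s.2‖
    have hp : 0 ≤ p := norm_nonneg _
    have hq : 0 ≤ q := norm_nonneg _
    set t := max 1 (max p q)
    have ht1 : 1 ≤ t := le_max_left _ _
    have htp : p ≤ t := (le_max_left _ _).trans (le_max_right _ _)
    have htq : q ≤ t := (le_max_right _ _).trans (le_max_right _ _)
    have h5 : t ^ (2 * n) ≤ 1 + p ^ (2 * n) + q ^ (2 * n) := by
      have a1 : 0 ≤ p ^ (2 * n) := by positivity
      have a2 : 0 ≤ q ^ (2 * n) := by positivity
      rcases max_choice 1 (max p q) with h | h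
      · rw [show t = 1 from h, one_pow]; linarith
      · rcases max_choice p q with h' | h'
        · rw [show t = p from h.trans h']; linarith
        · rw [show t = q from h.trans h']; linarith
    calc ((1 + p) * (1 + q)) ^ n ≤ ((3 * t) * (3 * t)) ^ n := by gcongr <;> linarith
      _ = 3 ^ (2 * n) * t ^ (2 * n) := by rw [← sq, ← pow_mul, mul_pow]
      _ ≤ _ := by gcongr
  calc _ ≤ ‖symbolCoeff a s‖ * (3 ^ (2 * n) * (1 + ‖s.1‖ ^ (2 * n) + ‖s.2‖ ^ (2 * n))) := by gcongr
    _ = 3 ^ (2 * n) * (‖symbolCoeff a s‖ + ‖s.1‖ ^ (2 * n) * ‖symbolCoeff a s‖ +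
        ‖s.2‖ ^ (2 * n) * ‖symbolCoeff a s‖) := by ring
    _ ≤ _ := by gcongr

/-- Counting measure times Lebesgue measure. -/
noncomputable def dualMeasure : Measure Dual := Measure.count.prod volume

instance : SFinite dualMeasure := by unfold dualMeasure; infer_instance

lemma integrable_dualMeasure :
    Integrable (fun s : Dual => (((1 + ‖s.1‖) * (1 + ‖s.2‖)) ^ 4)⁻¹) dualMeasure := by
  have h1 : Integrable (fun k : Fin 2 → ℤ => ((1 + ‖k‖) ^ 4)⁻¹) Measure.count :=
    integrable_count_iff.2 summable_one_add_norm_pow_four.norm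
  have h2 : Integrable fun ζ : Plane => ((1 + ‖ζ‖) ^ 4)⁻¹ := by
    refine (integrable_one_add_norm (E := Plane) (μ := volume) (r := 4)
      (by simp; norm_num)).congr (Eventually.of_forall fun ζ => ?_)
    show (1 + ‖ζ‖) ^ (-4 : ℝ) = _
    rw [Real.rpow_neg (by positivity)]
    norm_cast
  exact (h1.mul_prod h2).congr (Eventually.of_forall fun s => by
    simp only [mul_pow, mul_inv])

theorem IsRapid.integrable_symbolCoeff (ha : IsRapid a) (n : ℕ) :
    Integrable (fun s => ‖symbolCoeff a s‖ * ((1 + ‖s.1‖) * (1 + ‖s.2‖)) ^ n) dualMeasure := by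
  -- Four additional powers are integrable on `ℤ² × ℝ²`.
  obtain ⟨C, hC⟩ := ha.exists_symbolCoeff_le (n + 4)
  refine (integrable_dualMeasure.const_mul C).mono' ?_ (Eventually.of_forall fun s => ?_)
  · exact (ha.continuous_symbolCoeff.norm.mul
      (((continuous_const.add continuous_fst.norm).mul
        (continuous_const.add continuous_snd.norm)).pow n)).aestronglyMeasurable
  · rw [Real.norm_of_nonneg (by positivity), ← div_eq_mul_inv, le_div_iff₀ (by positivity)]
    exact (hC s).trans_eq' (by ring)

/-! ### Fourier inversion on the cotangent bundle of the torus -/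

section Inversion

open scoped FourierTransform

variable {a : Phase → ℂ}

lemma IsRapid.integrable_phase_cutSymbol (ha : IsRapid a) (κ : Phase →L[ℝ] ℝ) :
    Integrable fun z => phase κ z * cutSymbol a z :=
  integrable_phase_smul κ ha.integrable_cutSymbol

lemma isBounded_unitCell : Bornology.IsBounded unitCell := by
  refine (Metric.isBounded_closedBall (x := (0 : Plane)) (r := 2)).subset fun x hx => ?_
  rw [mem_closedBall_zero_iff, EuclideanSpace.norm_eq, Real.sqrt_le_left zero_le_two]
  have h : ∀ i, ‖x i‖ ^ 2 ≤ 1 := by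
    intro i
    obtain ⟨h1, h2⟩ := hx i
    rw [Real.norm_of_nonneg h1]
    nlinarith
  rw [Fin.sum_univ_two]
  linarith [h 0, h 1]

lemma phase_freqPhase_latticeVec (k l : Fin 2 → ℤ) : phase (freqPhase k) (latticeVec l) = 1 := by
  have := cexp_I_eq (a := freqPhase k (latticeVec l)) (b := 0) (k 0 * l 0 + k 1 * l 1) (by
    rw [freqPhase_eq]; push_cast [latticeVec_zero_coord, latticeVec_one_coord]; ring)
  rw [phase, this]; simp

/-- The Fourier transform in terms of the cutoff of a fundamental domain. -/
theorem IsRapid.symbolFourier_eq (ha : IsRapid a) (k : Fin 2 → ℤ) (ζ : Plane) :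
    symbolFourier a (freq k) ζ = symbolCoeff a (k, ζ) := by
  set κ := -charCLM (k, ζ) with hκ
  obtain ⟨C, hC⟩ := ha.bound (-4)
  have e1 : symbolFourier a (freq k) ζ =
      ∫ z in unitCell ×ˢ (Set.univ : Set Plane), phase κ z * a z := by
    refine integral_congr_ae (Eventually.of_forall fun z => ?_)
    have : phase κ z = Complex.exp (-(Complex.I * ((inner ℝ (freq k) z.1 : ℝ) : ℂ))) *
        Complex.exp (-(Complex.I * ((inner ℝ ζ z.2 : ℝ) : ℂ))) := by
      rw [phase, ← Complex.exp_add, hκ, neg_apply, charCLM_apply]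
      push_cast; ring_nf
    simp only [this]; ring
  have hcont : Continuous fun z => phase κ z * a z :=
    (continuous_phase κ).mul (ha.bound 0).smooth.continuous
  have hI : IntegrableOn (fun z => phase κ z * a z) (unitCell ×ˢ (Set.univ : Set Plane))
      (volume.prod volume) := by
    have : Fact (volume unitCell < ⊤) := ⟨isBounded_unitCell.measure_lt_top⟩
    rw [IntegrableOn, ← Measure.prod_restrict, Measure.restrict_univ]
    refine ((integrable_const (C 0)).mul_prod integrable_japanese).mono'
      hcont.aestronglyMeasurable (Eventually.of_forall fun z => ?_)
    rw [norm_mul, norm_phase, one_mul]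
    exact hC.norm_le z
  have hper : ∀ (l : Fin 2 → ℤ) x, (∫ ξ, phase κ (x + latticeVec l, ξ) * a (x + latticeVec l, ξ)) =
      ∫ ξ, phase κ (x, ξ) * a (x, ξ) := by
    intro l x
    refine integral_congr_ae (Eventually.of_forall fun ξ => ?_)
    have : phase κ (x + latticeVec l, ξ) = phase κ (x, ξ) := by
      have e : ((x + latticeVec l, ξ) : Phase) = (x, ξ) + (latticeVec l, 0) := by simp
      have e2 : phase κ (latticeVec l, 0) = phase (freqPhase k) (latticeVec (-l)) := by
        simp [phase, hκ, charCLM_apply, freqPhase_apply, latticeVec_neg]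
      rw [e, phase_add_apply, e2, phase_freqPhase_latticeVec, mul_one]
    simp only [this, ha.periodic]
  have hcut := ha.integrable_phase_cutSymbol κ
  have e2 : ∀ x, (planeCutoff x : ℂ) * ∫ ξ, phase κ (x, ξ) * a (x, ξ) =
      ∫ ξ, phase κ (x, ξ) * cutSymbol a (x, ξ) := fun x => by
    rw [← integral_const_mul]
    refine integral_congr_ae (Eventually.of_forall fun ξ => ?_)
    simp only [cutSymbol]; ring
  rw [e1, Measure.volume_eq_prod, setIntegral_prod _ hI]
  simp only [Measure.restrict_univ]
  rw [setIntegral_unitCell hper]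
  · simp only [e2]
    rw [symbolCoeff, Measure.volume_eq_prod, integral_prod _ hcut]
  · simp only [e2]
    exact hcut.integral_prod_left

/-- The Fourier coefficients of a symbol in the position variable. -/
noncomputable def partialCoeff (a : Phase → ℂ) (k : Fin 2 → ℤ) (ξ : Plane) : ℂ :=
  ∫ x, phase (-freqPhase k) x * cutSymbol a (x, ξ)

/-- Poisson summation for the cut-off symbol at fixed `ξ`, translated by the position: the lattice
side is the symbol times the sum of the translates of the cutoff. -/
lemma IsRapid.hasSum_partialCoeff (ha : IsRapid a) (z : Phase) :
    HasSum (fun k => phase (freqPhase k) z.1 * partialCoeff a k z.2) (a z) := by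
  have hd : ContDiff ℝ ∞ fun x => cutSymbol a (x, z.2) :=
    ha.hasSymbolBound_cutSymbol.smooth.comp (contDiff_id.prodMk contDiff_const)
  have hc : HasCompactSupport fun x => cutSymbol a (x, z.2) := hasCompactSupport_cutoff.mul_right
  have h := poissonFamily_freqPhase.hasSum_sub hd hc z.1
  have e1 : ∑' l, cutSymbol a (latticeVec l + z.1, z.2) = a z := by
    have e2 : ∀ l, cutSymbol a (latticeVec l + z.1, z.2) =
        ((planeCutoff (z.1 + latticeVec l) : ℝ) : ℂ) * a z := fun l => by
      rw [cutSymbol, add_comm (latticeVec l), ha.periodic]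
    simp only [e2]
    rw [tsum_mul_right, ((Complex.hasSum_ofReal (L := SummationFilter.unconditional _)).2
      (hasSum_planeCutoff_add z.1)).tsum_eq, Complex.ofReal_one, one_mul]
  rw [e1] at h
  refine ((Equiv.neg (Fin 2 → ℤ)).hasSum_iff.2 h).congr_fun fun k => ?_
  have e3 : freqPhase (-k) = -freqPhase k := by
    ext y; simp [freqPhase_apply, freq, latticeVec_neg]
  simp only [Function.comp, Equiv.neg_apply, e3, partialCoeff]
  rw [← integral_const_mul]
  refine integral_congr_ae (Eventually.of_forall fun y => ?_)
  have e4 : phase (-freqPhase k) (y - z.1) = phase (freqPhase k) z.1 * phase (-freqPhase k) y := by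
    simp only [phase, cexp_I_mul, map_sub, neg_apply]
    congr 3; ring
  simp only [e4, mul_assoc]

lemma IsRapid.integrable_symbolCoeff_right (ha : IsRapid a) (k : Fin 2 → ℤ) :
    Integrable fun ζ => symbolCoeff a (k, ζ) := by
  obtain ⟨C, hC⟩ := ha.exists_symbolCoeff_le 4
  refine (integrable_one_add_norm (E := Plane) (μ := volume) (r := 4)
    (by simp; norm_num)).const_mul C |>.mono' (ha.continuous_symbolCoeff.comp
      (continuous_const.prodMk continuous_id)).aestronglyMeasurable
      (Eventually.of_forall fun ζ => ?_)
  have h1 : (1 + ‖ζ‖) ^ (-4 : ℝ) = ((1 + ‖ζ‖) ^ 4)⁻¹ := by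
    rw [Real.rpow_neg (by positivity)]; norm_cast
  rw [h1, ← div_eq_mul_inv, le_div_iff₀ (by positivity)]
  refine le_trans ?_ (hC (k, ζ))
  have h2 : (1 + ‖ζ‖) ≤ (1 + ‖k‖) * (1 + ‖ζ‖) :=
    le_mul_of_one_le_left (by positivity) (by linarith [norm_nonneg k])
  gcongr

lemma fourier_partialCoeff (ha : IsRapid a) (k : Fin 2 → ℤ) (w : Plane) :
    𝓕 (partialCoeff a k) w = symbolCoeff a (k, (2 * Real.pi) • w) := by
  have h := ha.integrable_phase_cutSymbol (-charCLM (k, (2 * Real.pi) • w))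
  rw [Real.fourier_eq', symbolCoeff, Measure.volume_eq_prod, integral_prod_symm _ h]
  refine integral_congr_ae (Eventually.of_forall fun ξ => ?_)
  simp only [partialCoeff, smul_eq_mul]
  rw [← integral_const_mul]
  refine integral_congr_ae (Eventually.of_forall fun x => ?_)
  simp only
  rw [← mul_assoc]
  congr 1
  rw [phase, phase, ← Complex.exp_add, neg_apply, neg_apply,
    charCLM_apply, freqPhase_apply, inner_smul_left, real_inner_comm]
  congr 1
  simp only [conj_trivial]
  push_cast; ring

lemma IsRapid.integrable_partialCoeff (ha : IsRapid a) (k : Fin 2 → ℤ) :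
    Integrable (partialCoeff a k) := by
  have h := ha.integrable_phase_cutSymbol ((-freqPhase k).comp (ContinuousLinearMap.fst ℝ Plane Plane))
  exact h.integral_prod_right

lemma IsRapid.continuous_partialCoeff (ha : IsRapid a) (k : Fin 2 → ℤ) :
    Continuous (partialCoeff a k) := by
  obtain ⟨C, hC⟩ := ha.hasSymbolBound_cutSymbol
  have hcut : ∀ ξ, Continuous fun x => cutSymbol a (x, ξ) := fun ξ =>
    hC.smooth.continuous.comp (continuous_id.prodMk continuous_const)
  refine continuous_of_dominated (bound := fun x => |C 0| * japanese x ^ (-4 : ℝ)) (fun ξ =>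
    ((continuous_phase _).mul (hcut ξ)).aestronglyMeasurable) (fun ξ => Eventually.of_forall fun x => ?_)
    (integrable_japanese.const_mul _) (Eventually.of_forall fun x => continuous_const.mul
      (hC.smooth.continuous.comp (continuous_const.prodMk continuous_id)))
  rw [norm_mul, norm_phase, one_mul]
  refine (hC.norm_le _).trans ?_
  have h1 : phaseWeight (x, ξ) ≤ japanese x ^ (-4 : ℝ) :=
    mul_le_of_le_one_right (Real.rpow_pos_of_pos (japanese_pos _) _).le
      (Real.rpow_le_one_of_one_le_of_nonpos (one_le_japanese _) (by norm_num))
  have h2 : 0 ≤ phaseWeight (x, ξ) := (mul_pos (Real.rpow_pos_of_pos (japanese_pos _) _)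
    (Real.rpow_pos_of_pos (japanese_pos _) _)).le
  exact mul_le_mul (le_abs_self _) h1 h2 (abs_nonneg _)

/-- Fourier inversion in the momentum. The substitution `ζ = 2πw` adapts the normalization of the
Fourier transform, and its Jacobian is the factor `(2π)^{-2}`. -/
lemma IsRapid.partialCoeff_eq (ha : IsRapid a) (k : Fin 2 → ℤ) (ξ : Plane) :
    partialCoeff a k ξ = (1 / (2 * (Real.pi : ℂ)) ^ 2) *
      ∫ ζ, symbolCoeff a (k, ζ) * Complex.exp (Complex.I * ((inner ℝ ζ ξ : ℝ) : ℂ)) := by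
  have hF : 𝓕 (partialCoeff a k) = fun w => symbolCoeff a (k, (2 * Real.pi) • w) :=
    funext (fourier_partialCoeff ha k)
  have h2 : Integrable (𝓕 (partialCoeff a k)) := by
    rw [hF]
    exact (ha.integrable_symbolCoeff_right k).comp_smul Real.two_pi_pos.ne'
  have h := (ha.integrable_partialCoeff k).fourierInv_fourier_eq h2
    (ha.continuous_partialCoeff k).continuousAt (v := ξ)
  rw [← h, Real.fourierInv_eq', hF]
  have h3 := Measure.integral_comp_smul (volume : Measure Plane) (fun ζ =>
    symbolCoeff a (k, ζ) * Complex.exp (Complex.I * ((inner ℝ ζ ξ : ℝ) : ℂ))) (2 * Real.pi)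
  have h4 : ∀ w : Plane, Complex.exp ((↑(2 * Real.pi * inner ℝ w ξ) * Complex.I)) •
      symbolCoeff a (k, (2 * Real.pi) • w) = symbolCoeff a (k, (2 * Real.pi) • w) *
        Complex.exp (Complex.I * ((inner ℝ ((2 * Real.pi) • w) ξ : ℝ) : ℂ)) := fun w => by
    rw [inner_smul_left, smul_eq_mul, mul_comm, mul_comm Complex.I]; rfl
  simp only [h4]
  rw [h3]
  have h5 : |((2 * Real.pi) ^ Module.finrank ℝ Plane)⁻¹| = 1 / (2 * Real.pi) ^ 2 := by
    rw [finrank_euclideanSpace, Fintype.card_fin, abs_of_pos (by positivity), one_div]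
  rw [h5, Complex.real_smul]
  push_cast
  rfl

/-- The coefficients of the expansion of a symbol in characters. -/
noncomputable def charCoeff (a : Phase → ℂ) (s : Dual) : ℂ :=
  (1 / (2 * (Real.pi : ℂ)) ^ 2) * symbolCoeff a s

lemma IsRapid.continuous_charCoeff (ha : IsRapid a) : Continuous (charCoeff a) :=
  continuous_const.mul ha.continuous_symbolCoeff

lemma IsRapid.integrable_charCoeff (ha : IsRapid a) (n : ℕ) :
    Integrable (fun s => ‖charCoeff a s‖ * ((1 + ‖s.1‖) * (1 + ‖s.2‖)) ^ n) dualMeasure := by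
  simp only [charCoeff, norm_mul, mul_assoc]
  exact (ha.integrable_symbolCoeff n).const_mul _

lemma IsRapid.integrable_charCoeff_mul (ha : IsRapid a) {f : Dual → ℂ} (hf : Continuous f) {B : ℝ}
    (hB : ∀ s, ‖f s‖ ≤ B) : Integrable (fun s => charCoeff a s * f s) dualMeasure := by
  have h := ha.integrable_charCoeff 0
  simp only [pow_zero, mul_one] at h
  refine (h.mul_const B).mono' (ha.continuous_charCoeff.mul hf).aestronglyMeasurable
    (Eventually.of_forall fun s => ?_)
  rw [norm_mul]
  exact mul_le_mul_of_nonneg_left (hB s) (norm_nonneg _)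

lemma integral_dualMeasure {f : Dual → ℂ} (hf : Integrable f dualMeasure) :
    ∫ s, f s ∂dualMeasure = ∑' k, ∫ ζ, f (k, ζ) := by
  rw [dualMeasure, integral_prod _ hf, integral_countable hf.integral_prod_left]
  simp [Measure.real]

/-- Fourier inversion. -/
theorem IsRapid.eq_integral_charCoeff (ha : IsRapid a) (z : Phase) :
    ∫ s, charCoeff a s * phase (charCLM s) z ∂dualMeasure = a z := by
  have hc : Continuous fun s => phase (charCLM s) z :=
    Complex.continuous_exp.comp (continuous_const.mul (Complex.continuous_ofReal.comp
      (continuous_charCLM.clm_apply continuous_const)))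
  rw [integral_dualMeasure (ha.integrable_charCoeff_mul hc fun s => (norm_phase _ _).le),
    ← (ha.hasSum_partialCoeff z).tsum_eq]
  refine tsum_congr fun k => ?_
  rw [ha.partialCoeff_eq, ← integral_const_mul, ← integral_const_mul]
  refine integral_congr_ae (Eventually.of_forall fun ζ => ?_)
  have : phase (charCLM (k, ζ)) z = phase (freqPhase k) z.1 *
      Complex.exp (Complex.I * ((inner ℝ ζ z.2 : ℝ) : ℂ)) := by
    simp only [phase, charCLM_apply, cexp_I_add, freqPhase_apply]
  simp only [this, charCoeff]
  ring

end Inversion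

/-! ### The quantization of rapidly decaying symbols -/

section Rapid

variable {β : ℝ} {a b : Phase → ℂ} {u : Plane → ℂ}

lemma norm_weylOp (h β : ℝ) (η ζ : Plane) (u : Plane → ℂ) (x : Plane) :
    ‖weylOp h β η ζ u x‖ = ‖u (x + h • ζ)‖ := by
  rw [weylOp, norm_mul, norm_mul, norm_cexp_I, norm_cexp_I, one_mul, one_mul]

lemma continuous_weylOp (h β : ℝ) (hu : Continuous u) (x : Plane) :
    Continuous fun s : Dual => weylOp h β (freq s.1) s.2 u x :=
  continuous_prod_of_discrete_left.2 fun k => by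
    have h1 : Continuous fun ζ : Plane => h * β / 2 * wedge ζ x :=
      continuous_const.mul (contDiff_wedge_comp contDiff_id contDiff_const).continuous
    have h2 : Continuous fun ζ : Plane => inner ℝ (freq k) (x + (h / 2) • ζ) :=
      continuous_const.inner (continuous_const.add (continuous_const_smul _))
    have h3 : Continuous fun ζ : Plane => u (x + h • ζ) :=
      hu.comp (continuous_const.add (continuous_const_smul _))
    exact ((Complex.continuous_exp.comp (continuous_const.mul
      (Complex.continuous_ofReal.comp h1))).mul (Complex.continuous_exp.comp
        (continuous_const.mul (Complex.continuous_ofReal.comp h2)))).mul h3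

lemma IsRapid.weylSum_eq_integral (ha : IsRapid a) (h β : ℝ) (hu : Continuous u) {B : ℝ}
    (hB : ∀ x, ‖u x‖ ≤ B) (x : Plane) : weylSum h β a u x =
      ∫ s, charCoeff a s * weylOp h β (freq s.1) s.2 u x ∂dualMeasure := by
  rw [integral_dualMeasure (ha.integrable_charCoeff_mul (continuous_weylOp h β hu x)
    fun s => (norm_weylOp ..).trans_le (hB _)), weylSum, ← tsum_mul_left]
  refine tsum_congr fun k => ?_
  rw [← integral_const_mul]
  refine integral_congr_ae (Eventually.of_forall fun ζ => ?_)
  simp only [ha.symbolFourier_eq, charCoeff, mul_assoc]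

/-- The size of a point of the dual space. -/
noncomputable def dualSize (s : Dual) : ℝ := (1 + ‖s.1‖) * (1 + ‖s.2‖)

lemma one_le_dualSize (s : Dual) : 1 ≤ dualSize s :=
  one_le_mul_of_one_le_of_one_le (by linarith [norm_nonneg s.1]) (by linarith [norm_nonneg s.2])

lemma charCLM_add (s t : Dual) : charCLM (s + t) = charCLM s + charCLM t := by
  refine ContinuousLinearMap.ext fun z => ?_
  simp only [charCLM_apply, add_apply, Prod.fst_add, Prod.snd_add, freq_add, inner_add_left]
  ring

lemma IsRapid.integrable_superposition (ha : IsRapid a) :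
    Integrable (fun s => ‖charCoeff a s‖ * (1 + ‖charCLM s‖) ^ 8) dualMeasure := by
  refine ((ha.integrable_charCoeff 8).const_mul (15 ^ 8)).mono' ?_ (Eventually.of_forall fun s => ?_)
  · exact (ha.continuous_charCoeff.norm.mul
      ((continuous_const.add continuous_charCLM.norm).pow 8)).aestronglyMeasurable
  · have h1 := norm_charCLM_le s
    have h2 := one_le_dualSize s
    rw [dualSize] at h2
    rw [Real.norm_of_nonneg (by positivity)]
    calc ‖charCoeff a s‖ * (1 + ‖charCLM s‖) ^ 8
        ≤ ‖charCoeff a s‖ * (15 * ((1 + ‖s.1‖) * (1 + ‖s.2‖))) ^ 8 := by gcongr; linarith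
      _ = _ := by ring

/-- The symbol is a superposition of characters, the series commutes with superpositions, and each
character becomes its Weyl operator. -/
theorem IsRapid.opSum_eq_integral (ha : IsRapid a) (hβ : ∃ n : ℤ, β = 2 * Real.pi * n)
    (hu : ContDiff ℝ ∞ u) (hq : IsQuasiPeriodic β u) (h : ℝ) (x : Plane) :
    opSum h β a u x = ∫ s, charCoeff a s * weylOp h β (freq s.1) s.2 u x ∂dualMeasure := by
  have h1 := (shearSum_superposition phaseFamily_freqPhase (contDiff_opCutoff β hu x)
    (hasCompactSupport_opCutoff β u x) ha.continuous_charCoeff continuous_charCLM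
    ha.integrable_superposition (opMap h β) (opShift h) (opMap h β x)).2
  rw [funext ha.eq_integral_charCoeff] at h1
  rw [opSum, ← h1]
  refine integral_congr_ae (Eventually.of_forall fun s => ?_)
  simp only [← opSum_character hβ hu hq]
  rfl

lemma exists_norm_le_of_isQuasiPeriodic (hu : Continuous u) (hq : IsQuasiPeriodic β u) :
    ∃ B, ∀ x, ‖u x‖ ≤ B := by
  obtain ⟨B, hB⟩ := (isCompact_closedBall (0 : Plane) 2).exists_bound_of_continuousOn hu.continuousOn
  exact ⟨B, hq.norm_le fun x hx => hB x (mem_closedBall_zero_iff.2 hx)⟩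

/-- Both sides are the same superposition of Weyl operators; boundedness of quasi-periodic functions
makes the defining formula absolutely convergent. -/
theorem IsRapid.weylSum_eq_opSum (ha : IsRapid a) (hβ : ∃ n : ℤ, β = 2 * Real.pi * n)
    (hu : ContDiff ℝ ∞ u) (hq : IsQuasiPeriodic β u) (h : ℝ) (x : Plane) :
    weylSum h β a u x = opSum h β a u x := by
  obtain ⟨B, hB⟩ := exists_norm_le_of_isQuasiPeriodic hu.continuous hq
  rw [ha.opSum_eq_integral hβ hu hq, ha.weylSum_eq_integral h β hu.continuous hB]

/-! ### Composition for rapidly decaying symbols -/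

lemma IsRapid.integrable_double (ha : IsRapid a) (hb : IsRapid b) {α : Dual × Dual → ℂ}
    (hα : Continuous α) (hle : ∀ p, ‖α p‖ ≤ ‖charCoeff a p.1‖ * ‖charCoeff b p.2‖) {P : Type}
    [NormedAddCommGroup P] [NormedSpace ℝ P] {κ : Dual × Dual → P →L[ℝ] ℝ} (hκ : Continuous κ)
    (hκle : ∀ p, ‖κ p‖ ≤ 28 * (dualSize p.1 * dualSize p.2)) :
    Integrable (fun p => ‖α p‖ * (1 + ‖κ p‖) ^ 8) (dualMeasure.prod dualMeasure) := by
  refine (((ha.integrable_charCoeff 8).mul_prod (hb.integrable_charCoeff 8)).const_mul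
    (29 ^ 8)).mono' ?_ (Eventually.of_forall fun p => ?_)
  · exact (hα.norm.mul ((continuous_const.add hκ.norm).pow 8)).aestronglyMeasurable
  · have h2 := one_le_mul_of_one_le_of_one_le (one_le_dualSize p.1) (one_le_dualSize p.2)
    have h3 := hκle p
    have h4 := hle p
    rw [Real.norm_of_nonneg (by positivity)]
    calc ‖α p‖ * (1 + ‖κ p‖) ^ 8
        ≤ (‖charCoeff a p.1‖ * ‖charCoeff b p.2‖) * (29 * (dualSize p.1 * dualSize p.2)) ^ 8 := by
          gcongr; linarith
      _ = 29 ^ 8 * (‖charCoeff a p.1‖ * dualSize p.1 ^ 8 * (‖charCoeff b p.2‖ * dualSize p.2 ^ 8)) := by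
        rw [mul_pow, mul_pow]
        generalize dualSize p.1 ^ 8 = c
        generalize dualSize p.2 ^ 8 = d
        ring

lemma norm_charCLM_add_le (s t : Dual) :
    ‖charCLM s‖ + ‖charCLM t‖ ≤ 28 * (dualSize s * dualSize t) := by
  have h1 := norm_charCLM_le s
  have h2 := norm_charCLM_le t
  have h3 := one_le_dualSize s
  have h4 := one_le_dualSize t
  rw [← dualSize] at h1 h2
  nlinarith

/-- The linear functional on pairs that belongs to a pair of points of the dual space. -/
noncomputable def pairCLM (p : Dual × Dual) : Pair →L[ℝ] ℝ :=
  (charCLM p.1).comp (ContinuousLinearMap.fst ℝ Phase Phase) +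
    (charCLM p.2).comp (ContinuousLinearMap.snd ℝ Phase Phase)

lemma continuous_pairCLM : Continuous pairCLM :=
  ((continuous_charCLM.comp continuous_fst).clm_comp continuous_const).add
    ((continuous_charCLM.comp continuous_snd).clm_comp continuous_const)

lemma norm_pairCLM_le (p : Dual × Dual) : ‖pairCLM p‖ ≤ 28 * (dualSize p.1 * dualSize p.2) := by
  refine le_trans ?_ (norm_charCLM_add_le p.1 p.2)
  refine (norm_add_le _ _).trans (add_le_add ?_ ?_)
  · exact (ContinuousLinearMap.opNorm_comp_le _ _).trans
      (mul_le_of_le_one_right (norm_nonneg _) (ContinuousLinearMap.norm_fst_le ..))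
  · exact (ContinuousLinearMap.opNorm_comp_le _ _).trans
      (mul_le_of_le_one_right (norm_nonneg _) (ContinuousLinearMap.norm_snd_le ..))

lemma phase_pairCLM (p : Dual × Dual) : phase (pairCLM p) =
    tensor (character p.1.1 p.1.2) (character p.2.1 p.2.2) := by
  funext q
  simp only [character_eq_phase, tensor, phase, cexp_I_mul]
  rfl

/-- The coefficients of the product of two symbols. -/
noncomputable def pairCoeff (h β : ℝ) (a b : Phase → ℂ) (p : Dual × Dual) : ℂ :=
  charCoeff a p.1 * charCoeff b p.2 *
    Complex.exp (Complex.I * (charForm h β p.1.1 p.2.1 p.1.2 p.2.2 : ℂ))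

lemma continuous_charForm (h β : ℝ) :
    Continuous fun p : Dual × Dual => charForm h β p.1.1 p.2.1 p.1.2 p.2.2 := by
  have hf : Continuous freq := continuous_of_discreteTopology
  have h1 : Continuous fun p : Dual × Dual => inner ℝ (freq p.2.1) p.1.2 :=
    (hf.comp (continuous_fst.comp continuous_snd)).inner (continuous_snd.comp continuous_fst)
  have h2 : Continuous fun p : Dual × Dual => inner ℝ (freq p.1.1) p.2.2 :=
    (hf.comp (continuous_fst.comp continuous_fst)).inner (continuous_snd.comp continuous_snd)
  have h3 : Continuous fun p : Dual × Dual => wedge p.2.2 p.1.2 :=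
    contDiff_wedge.continuous.comp ((continuous_snd.comp continuous_snd).prodMk
      (continuous_snd.comp continuous_fst))
  exact continuous_const.mul ((h1.sub h2).add (continuous_const.mul h3))

lemma IsRapid.continuous_mul_charCoeff (ha : IsRapid a) (hb : IsRapid b) :
    Continuous fun p : Dual × Dual => charCoeff a p.1 * charCoeff b p.2 :=
  (ha.continuous_charCoeff.comp continuous_fst).mul (hb.continuous_charCoeff.comp continuous_snd)

lemma IsRapid.continuous_pairCoeff (ha : IsRapid a) (hb : IsRapid b) (h β : ℝ) :
    Continuous (pairCoeff h β a b) :=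
  (ha.continuous_mul_charCoeff hb).mul (Complex.continuous_exp.comp (continuous_const.mul
    (Complex.continuous_ofReal.comp (continuous_charForm h β))))

lemma IsRapid.tensor_eq_integral (ha : IsRapid a) (hb : IsRapid b) (q : Pair) :
    ∫ p : Dual × Dual, charCoeff a p.1 * charCoeff b p.2 * phase (pairCLM p) q
      ∂(dualMeasure.prod dualMeasure) = tensor a b q := by
  rw [tensor, ← ha.eq_integral_charCoeff, ← hb.eq_integral_charCoeff, ← integral_prod_mul]
  refine integral_congr_ae (Eventually.of_forall fun p => ?_)
  have : phase (pairCLM p) q = phase (charCLM p.1) q.1 * phase (charCLM p.2) q.2 := by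
    simp only [phase, cexp_I_mul]; rfl
  simp only [this]; ring

/-- The star product of rapidly decaying symbols as a superposition of characters. -/
theorem IsRapid.starProduct_eq_integral (ha : IsRapid a) (hb : IsRapid b)
    (hβ : ∃ n : ℤ, β = 2 * Real.pi * n) (h : ℝ) (z : Phase) :
    ∫ p, pairCoeff h β a b p * phase (charCLM (p.1 + p.2)) z ∂(dualMeasure.prod dualMeasure) =
      starProduct β h a b z := by
  have h1 := (shearSum_superposition phaseFamily_freqPhase₂
    (contDiff_starCutoff (contDiff_ofReal_comp isLatticeCutoff_pairCutoff.1) β)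
    (hasCompactSupport_starCutoff (hasCompactSupport_ofReal_comp isLatticeCutoff_pairCutoff.2.1) β)
    (ha.continuous_mul_charCoeff hb) continuous_pairCLM
    (ha.integrable_double hb (ha.continuous_mul_charCoeff hb) (fun p => (norm_mul _ _).le)
      continuous_pairCLM norm_pairCLM_le) (starMap h β) (fun k => h • unitShift k) (diagCLM z)).2
  rw [funext (ha.tensor_eq_integral hb)] at h1
  refine Eq.trans ?_ h1
  refine integral_congr_ae (Eventually.of_forall fun p => ?_)
  have h2 := starSum_character hβ isLatticeCutoff_pairCutoff h p.1.1 p.2.1 p.1.2 p.2.2 z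
  rw [← phase_pairCLM] at h2
  simp only [pairCoeff, mul_assoc]
  congr 2
  exact h2.symm

/-- The star product is the superposition of the characters of sums `s + t`, with coefficients
twisted by the factor that appears when Weyl operators are multiplied. Quantizing gives a double
integral of products of Weyl operators, and Fubini recovers the inner operator and then the outer
one. -/
theorem IsRapid.opSum_opSum (ha : IsRapid a) (hb : IsRapid b)
    (hβ : ∃ n : ℤ, β = 2 * Real.pi * n) (hu : ContDiff ℝ ∞ u) (hq : IsQuasiPeriodic β u) (h : ℝ)
    (x : Plane) : opSum h β a (opSum h β b u) x = opSum h β (starProduct β h a b) u x := by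
  have hw := moderateWeight_symbolWeight 0
  have hcl : Continuous fun p : Dual × Dual => charCLM (p.1 + p.2) :=
    continuous_charCLM.comp (continuous_fst.add continuous_snd)
  have h1 := shearSum_superposition phaseFamily_freqPhase (contDiff_opCutoff β hu x)
    (hasCompactSupport_opCutoff β u x) (ha.continuous_pairCoeff hb h β) hcl
    (ha.integrable_double hb (ha.continuous_pairCoeff hb h β) (fun p => by
      rw [pairCoeff, norm_mul, norm_mul, norm_cexp_I, mul_one]) hcl fun p => by
        rw [charCLM_add]
        exact (norm_add_le _ _).trans (norm_charCLM_add_le p.1 p.2))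
    (opMap h β) (opShift h) (opMap h β x)
  rw [funext (ha.starProduct_eq_integral hb hβ h)] at h1
  have e : ∀ p : Dual × Dual, pairCoeff h β a b p * shearSum freqPhase (opCutoff β u x) (opMap h β)
      (opShift h) (phase (charCLM (p.1 + p.2))) (opMap h β x) =
      charCoeff a p.1 * (charCoeff b p.2 *
        weylOp h β (freq p.1.1) p.1.2 (weylOp h β (freq p.2.1) p.2.2 u) x) := fun p => by
    have e1 := opSum_character hβ hu hq h (p.1.1 + p.2.1) (p.1.2 + p.2.2) x
    have e2 : shearSum freqPhase (opCutoff β u x) (opMap h β) (opShift h)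
      (phase (charCLM (p.1 + p.2))) (opMap h β x) = _ := e1
    rw [e2, weylOp_weylOp, pairCoeff]
    ring
  simp only [e] at h1
  have h2 : opSum h β (starProduct β h a b) u x = _ := h1.2.symm
  rw [h2, integral_prod _ h1.1, ha.opSum_eq_integral hβ (contDiff_opSum hw hu h β (hb.bound 0))
    (isQuasiPeriodic_opSum hβ hq h hb.periodic)]
  refine integral_congr_ae (Eventually.of_forall fun s => ?_)
  simp only
  rw [integral_const_mul]
  congr 1
  rw [weylOp, hb.opSum_eq_integral hβ hu hq, ← integral_const_mul]
  refine integral_congr_ae (Eventually.of_forall fun t => ?_)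
  show _ = charCoeff b t * (_ * _ * weylOp h β (freq t.1) t.2 u (x + h • s.2))
  ring

end Rapid

/-! ### Regularization of symbols -/

section Regularization

variable {β : ℝ} {a b : Phase → ℂ} {u : Plane → ℂ} {m m₁ m₂ : ℝ}

lemma hasSymbolBound_schwartz (χ : 𝓢(Plane, ℂ)) (m : ℝ) :
    HasSymbolBound (fun ξ => japanese ξ ^ m) χ := by
  set k := ⌈|m|⌉₊ with hk
  refine ⟨fun n => 2 ^ k * (Finset.Iic (k, n)).sup (fun m => SchwartzMap.seminorm ℝ m.1 m.2) χ,
    χ.smooth ⊤, fun n ξ => ?_⟩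
  have h1 := SchwartzMap.one_add_le_sup_seminorm_apply (𝕜 := ℝ) (m := (k, n)) le_rfl le_rfl χ ξ
  have h2 : japanese ξ ^ (-m) ≤ (1 + ‖ξ‖) ^ k := by
    -- The weight has to be inverted, so the number of powers of `1 + ‖ξ‖` must dominate `-m`
    -- whatever the sign of `m`.
    have hm : -m ≤ k := (neg_le_abs m).trans (Nat.le_ceil _)
    refine (Real.rpow_le_rpow_of_exponent_le (one_le_japanese ξ) hm).trans ?_
    rw [Real.rpow_natCast]
    exact pow_le_pow_left₀ (japanese_pos ξ).le (japanese_le ξ) k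
  have h3 := Real.rpow_pos_of_pos (japanese_pos ξ) m
  rw [Real.rpow_neg (japanese_pos ξ).le] at h2
  rw [← div_le_iff₀ h3, div_eq_inv_mul]
  exact (mul_le_mul_of_nonneg_right h2 (norm_nonneg _)).trans h1

/-- The regularization `χ(εξ) a(x, ξ)`. -/
def regularize (χ : Plane → ℂ) (a : Phase → ℂ) (ε : ℝ) (z : Phase) : ℂ := χ (ε • z.2) * a z

lemma isRapid_regularize (ha : a ∈ symbolClass m) (χ : 𝓢(Plane, ℂ)) {ε : ℝ} (hε : ε ≠ 0) :
    IsRapid (regularize χ a ε) := by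
  refine ⟨fun k x ξ => by simp only [regularize, ha.1.2], fun n => ?_⟩
  set χ' : 𝓢(Plane, ℂ) := SchwartzMap.compCLMOfContinuousLinearEquiv ℝ
    (ContinuousLinearEquiv.smulLeft (Units.mk0 ε hε) : Plane ≃L[ℝ] Plane) χ
  obtain ⟨C, hC⟩ := hasSymbolBound_schwartz χ' (n - m)
  obtain ⟨C', hC'⟩ := (mem_symbolClass_iff.1 ha).2
  have key := (hC.comp_clm (ContinuousLinearMap.snd ℝ Plane Plane)).mul hC'
  have e : (fun z : Phase => japanese (ContinuousLinearMap.snd ℝ Plane Plane z) ^ (n - m) *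
      symbolWeight m z) = symbolWeight n := funext fun z => by
    show japanese z.2 ^ (n - m) * japanese z.2 ^ m = japanese z.2 ^ n
    rw [← Real.rpow_add (japanese_pos _), sub_add_cancel]
  rw [e] at key
  exact ⟨_, key⟩

/-- For `0 < ε ≤ 1` the dilation is a linear map of norm at most one, so derivatives of `χ(εξ)` are
bounded independently of `ε`. -/
lemma exists_symbolBound_regularize (ha : a ∈ symbolClass m) (χ : 𝓢(Plane, ℂ)) :
    ∃ C, ∀ᶠ ε in 𝓝[>] (0 : ℝ), SymbolBound (symbolWeight m) C (regularize χ a ε) := by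
  obtain ⟨C, hC⟩ := hasSymbolBound_schwartz χ 0
  obtain ⟨C', hC'⟩ := (mem_symbolClass_iff.1 ha).2
  refine ⟨leibnizConst C C', ?_⟩
  filter_upwards [Ioc_mem_nhdsGT (zero_lt_one (α := ℝ))] with ε hε
  set L : Phase →L[ℝ] Plane := ε • ContinuousLinearMap.snd ℝ Plane Plane with hL
  have hL1 : ‖L‖ ≤ 1 := by
    rw [hL, norm_smul, Real.norm_of_nonneg hε.1.le]
    exact mul_le_one₀ hε.2 (norm_nonneg _) (ContinuousLinearMap.norm_snd_le ..)
  have h := (hC.comp_clm_of_norm_le_one hL1).mul hC'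
  simp only [Real.rpow_zero, one_mul] at h
  exact h

lemma tendsto_regularize (a : Phase → ℂ) {χ : 𝓢(Plane, ℂ)} (hχ : χ 0 = 1) (z : Phase) :
    Tendsto (fun ε : ℝ => regularize χ a ε z) (𝓝[>] 0) (𝓝 (a z)) := by
  have h : Continuous fun ε : ℝ => regularize χ a ε z :=
    (χ.continuous.comp (continuous_id.smul continuous_const)).mul continuous_const
  have h2 := h.tendsto 0
  simp only [regularize, zero_smul, hχ, one_mul] at h2
  exact h2.mono_left nhdsWithin_le_nhds

lemma exists_schwartz_apply_zero : ∃ χ : 𝓢(Plane, ℂ), χ 0 = 1 := by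
  let f : ContDiffBump (0 : Plane) := default
  have h1 : HasCompactSupport fun x => (f x : ℂ) := hasCompactSupport_ofReal_comp f.hasCompactSupport
  have h2 : ContDiff ℝ ∞ fun x => (f x : ℂ) := contDiff_ofReal_comp f.contDiff
  refine ⟨h1.toSchwartzMap h2, ?_⟩
  show ((f 0 : ℝ) : ℂ) = 1
  rw [f.one_of_mem_closedBall (Metric.mem_closedBall_self f.rIn_pos.le), Complex.ofReal_one]

/-- The oscillatory series computes the quantization. -/
theorem isOp_opSum (hβ : ∃ n : ℤ, β = 2 * Real.pi * n) (ha : a ∈ symbolClass m)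
    (hu : u ∈ smoothSections β) (h : ℝ) : IsOp h β a u (opSum h β a u) := by
  intro χ hχ x
  obtain ⟨hu, hq⟩ := mem_smoothSections_iff.1 hu
  obtain ⟨C, hC⟩ := exists_symbolBound_regularize ha χ
  refine (tendsto_opSum (moderateWeight_symbolWeight m) h β hu x hC
    (tendsto_regularize a hχ)).congr' ?_
  filter_upwards [self_mem_nhdsWithin] with ε hε
  exact ((isRapid_regularize ha χ (Set.mem_Ioi.1 hε).ne').weylSum_eq_opSum hβ hu hq h x).symm

theorem opSum_mem_smoothSections (hβ : ∃ n : ℤ, β = 2 * Real.pi * n) (ha : a ∈ symbolClass m)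
    (hu : u ∈ smoothSections β) (h : ℝ) : opSum h β a u ∈ smoothSections β := by
  obtain ⟨hu, hq⟩ := mem_smoothSections_iff.1 hu
  obtain ⟨h1, h2⟩ := mem_symbolClass_iff.1 ha
  exact mem_smoothSections_iff.2 ⟨contDiff_opSum (moderateWeight_symbolWeight m) hu h β h2,
    isQuasiPeriodic_opSum hβ hq h h1.2⟩

/-! ### Composition -/

lemma SymbolBound.tensor {w₁ w₂ : Phase → ℝ} {C₁ C₂ : ℕ → ℝ} (ha : SymbolBound w₁ C₁ a)
    (hb : SymbolBound w₂ C₂ b) : SymbolBound (fun q : Pair => w₁ q.1 * w₂ q.2)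
      (leibnizConst C₁ C₂) (tensor a b) :=
  (ha.comp_clm_of_norm_le_one (ContinuousLinearMap.norm_fst_le ℝ Phase Phase)).mul
    (hb.comp_clm_of_norm_le_one (ContinuousLinearMap.norm_snd_le ℝ Phase Phase))

/-- Common seminorm bounds for the factors give common bounds for their star products in `S^{m₁ +
m₂}`, and the star products converge pointwise; these are the two hypotheses for convergence of the
quantization. -/
theorem tendsto_opSum_starProduct (h β : ℝ) (hu : ContDiff ℝ ∞ u) (x : Plane) {ι : Type*}
    {l : Filter ι} [l.IsCountablyGenerated] {C₁ C₂ : ℕ → ℝ} {a' b' : ι → Phase → ℂ}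
    (ha : ∀ᶠ i in l, SymbolBound (symbolWeight m₁) C₁ (a' i))
    (hb : ∀ᶠ i in l, SymbolBound (symbolWeight m₂) C₂ (b' i))
    (hla : ∀ z, Tendsto (fun i => a' i z) l (𝓝 (a z)))
    (hlb : ∀ z, Tendsto (fun i => b' i z) l (𝓝 (b z))) :
    Tendsto (fun i => opSum h β (starProduct β h (a' i) (b' i)) u x) l
      (𝓝 (opSum h β (starProduct β h a b) u x)) := by
  have hw := moderateWeight_pairWeight m₁ m₂
  have hd := contDiff_ofReal_comp isLatticeCutoff_pairCutoff.1
  have hc := hasCompactSupport_ofReal_comp isLatticeCutoff_pairCutoff.2.1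
  obtain ⟨C, hC⟩ := hw.exists_symbolBound_shearSum (E := ℂ) phaseFamily_freqPhase₂
    (contDiff_starCutoff hd β) (hasCompactSupport_starCutoff hc β) (starMap h β)
    (norm_smul_unitShift_le (h := h) le_rfl) (leibnizConst C₁ C₂)
  refine tendsto_opSum (moderateWeight_symbolWeight (m₁ + m₂)) h β hu x
    (C := fun n => ‖diagCLM‖ ^ n * C n) ?_ fun z => ?_
  · filter_upwards [ha, hb] with i hai hbi
    have h1 := (hC _ (hai.tensor hbi)).comp_clm diagCLM
    simp only [pairWeight_diag] at h1
    exact h1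
  · refine tendsto_starSum hw β h hd hc (diagCLM z) (C := leibnizConst C₁ C₂) ?_ fun q => ?_
    · filter_upwards [ha, hb] with i hai hbi
      exact hai.tensor hbi
    · exact (hla q.1).mul (hlb q.2)

/-- The second symbol is regularized while the first stays rapidly decaying. The outer operator is
then an integral of Weyl operators against an integrable coefficient, so dominated convergence
applies once the inner functions are bounded uniformly. -/
theorem IsRapid.opSum_opSum_of_mem (ha : IsRapid a) (hb : b ∈ symbolClass m)
    (hβ : ∃ n : ℤ, β = 2 * Real.pi * n) (hu : ContDiff ℝ ∞ u) (hq : IsQuasiPeriodic β u) (h : ℝ)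
    (x : Plane) : opSum h β a (opSum h β b u) x = opSum h β (starProduct β h a b) u x := by
  obtain ⟨χ, hχ⟩ := exists_schwartz_apply_zero
  obtain ⟨C, hC⟩ := exists_symbolBound_regularize hb χ
  obtain ⟨C', hC'⟩ := ha.bound 0
  have hw := moderateWeight_symbolWeight m
  have hlim := tendsto_regularize b hχ
  have hb' := mem_symbolClass_iff.1 hb
  have hr : ∀ᶠ ε in 𝓝[>] (0 : ℝ), IsRapid (regularize χ b ε) := by
    filter_upwards [self_mem_nhdsWithin] with ε hε
    exact isRapid_regularize hb χ (Set.mem_Ioi.1 hε).ne'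
  have h1 := tendsto_opSum_starProduct h β hu x (Eventually.of_forall fun _ => hC') hC
    (fun z => tendsto_const_nhds) hlim
  refine tendsto_nhds_unique ?_ h1
  -- A bound on the ball of radius `2` suffices, since it meets every lattice orbit and
  -- quasi-periodic functions have periodic modulus.
  obtain ⟨B, hB⟩ := exists_norm_opSum_le_of_norm_le hw hu h β C 2
  rw [ha.opSum_eq_integral hβ (contDiff_opSum hw hu h β hb'.2)
    (isQuasiPeriodic_opSum hβ hq h hb'.1.2)]
  have h2 : Tendsto (fun ε => ∫ s, charCoeff a s *
      weylOp h β (freq s.1) s.2 (opSum h β (regularize χ b ε) u) x ∂dualMeasure) (𝓝[>] 0)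
      (𝓝 (∫ s, charCoeff a s * weylOp h β (freq s.1) s.2 (opSum h β b u) x ∂dualMeasure)) := by
    have hI := ha.integrable_charCoeff 0
    simp only [pow_zero, mul_one] at hI
    refine tendsto_integral_filter_of_dominated_convergence (fun s => ‖charCoeff a s‖ * B) ?_ ?_
      (hI.mul_const B) (Eventually.of_forall fun s => ?_)
    · filter_upwards [hC] with ε hε
      exact (ha.continuous_charCoeff.mul (continuous_weylOp h β
        (contDiff_opSum hw hu h β ⟨C, hε⟩).continuous x)).aestronglyMeasurable
    · filter_upwards [hC, hr] with ε hε hrε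
      refine Eventually.of_forall fun s => ?_
      rw [norm_mul, norm_weylOp]
      exact mul_le_mul_of_nonneg_left ((isQuasiPeriodic_opSum hβ hq h hrε.periodic).norm_le
        (hB _ hε) _) (norm_nonneg _)
    · exact ((tendsto_opSum hw h β hu _ hC hlim).const_mul _).const_mul _
  refine h2.congr' ?_
  filter_upwards [hr] with ε hε
  rw [← ha.opSum_opSum hε hβ hu hq, ha.opSum_eq_integral hβ
    (contDiff_opSum (moderateWeight_symbolWeight 0) hu h β (hε.bound 0))
    (isQuasiPeriodic_opSum hβ hq h hε.periodic)]

/-- The quantization of the star product is the composition of the quantizations. -/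
theorem opSum_opSum (hβ : ∃ n : ℤ, β = 2 * Real.pi * n) (ha : a ∈ symbolClass m₁)
    (hb : b ∈ symbolClass m₂) (hu : u ∈ smoothSections β) (h : ℝ) :
    opSum h β a (opSum h β b u) = opSum h β (starProduct β h a b) u := by
  funext x
  obtain ⟨hv, -⟩ := mem_smoothSections_iff.1 (opSum_mem_smoothSections hβ hb hu h)
  obtain ⟨hu, hq⟩ := mem_smoothSections_iff.1 hu
  obtain ⟨χ, hχ⟩ := exists_schwartz_apply_zero
  obtain ⟨C, hC⟩ := exists_symbolBound_regularize ha χ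
  obtain ⟨C', hC'⟩ := (mem_symbolClass_iff.1 hb).2
  have hlim := tendsto_regularize a hχ
  -- Here the inner function is a fixed section, so only the outer symbol is regularized.
  have h1 := tendsto_opSum (moderateWeight_symbolWeight m₁) h β hv x hC hlim
  have h2 := tendsto_opSum_starProduct h β hu x hC (Eventually.of_forall fun _ => hC') hlim
    fun z => tendsto_const_nhds
  refine tendsto_nhds_unique h1 (h2.congr' ?_)
  filter_upwards [self_mem_nhdsWithin] with ε hε
  exact ((isRapid_regularize ha χ (Set.mem_Ioi.1 hε).ne').opSum_opSum_of_mem hb hβ hu hq h x).symm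

end Regularization

end MagneticWeyl

theorem mainTheorem5 (B : Plane → ℝ) (hB : ContDiff ℝ ∞ B)
    (hper : ∀ (k : Fin 2 → ℤ) (x : Plane), B (x + latticeVec k) = B x)
    (hflux : ∃ φ : ℤ, flux B = 2 * Real.pi * φ) :
    ∃ star : ℝ → (Phase → ℂ) → (Phase → ℂ) → (Phase → ℂ),
      ∀ (m₁ m₂ : ℝ) (a b : Phase → ℂ), a ∈ symbolClass m₁ → b ∈ symbolClass m₂ →
        -- composition: `Op(a) ∘ Op(b) = Op(a ⋆ b)` on `C^∞(𝕋², L)`, with `a ⋆ b ∈ S^{m₁ + m₂}`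
        (∀ h : ℝ, 0 < h → star h a b ∈ symbolClass (m₁ + m₂) ∧
          ∀ u ∈ smoothSections (flux B),
            ∃ v ∈ smoothSections (flux B), ∃ w ∈ smoothSections (flux B),
              IsOp h (flux B) b u v ∧ IsOp h (flux B) a v w ∧
                IsOp h (flux B) (star h a b) u w) ∧
        -- explicit formula
        (∀ h : ℝ, 0 < h → IsStarIntegral h (flux B) a b (star h a b)) ∧
        -- asymptotic expansion
        (∀ N : ℕ, 1 ≤ N → IsBigOSymbol (m₁ + m₂) N (fun h z => star h a b z -
          ∑ n ∈ Finset.range N, (1 / (n.factorial : ℂ)) * (Complex.I * (h : ℂ) / 2) ^ n *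
            omegaTerm h (flux B) n a b z)) ∧
        -- leading term
        IsBigOSymbol (m₁ + m₂) 1 (fun h z => star h a b z - a z * b z) ∧
        -- commutator
        IsBigOSymbol (m₁ + m₂) 3 (fun h z => star h a b z - star h b a z -
          ((h : ℂ) / Complex.I * poisson a b z +
            ((flux B * h ^ 2 : ℝ) : ℂ) / Complex.I *
              (dXi 1 a z * dXi 0 b z - dXi 0 a z * dXi 1 b z))) := by
  have hβ : ∃ n : ℤ, flux B = 2 * Real.pi * n := hflux
  refine ⟨fun h a b => starProduct (flux B) h a b, fun m₁ m₂ a b ha hb => ⟨fun h _ =>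
    ⟨starProduct_mem_symbolClass ha hb h, fun u hu => ?_⟩,
    fun h _ => isStarIntegral_starProduct hβ ha hb h,
    fun N _ => isBigOSymbol_starProduct_sub hβ ha hb N,
    isBigOSymbol_starProduct_sub_mul hβ ha hb, isBigOSymbol_commutator hβ ha hb⟩⟩
  have hv := opSum_mem_smoothSections hβ hb hu h
  refine ⟨opSum h (flux B) b u, hv, opSum h (flux B) a (opSum h (flux B) b u),
    opSum_mem_smoothSections hβ ha hv h, isOp_opSum hβ hb hu h, isOp_opSum hβ ha hv h, ?_⟩
  -- The composition formula identifies the iterated image with the series for the star product, so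
  -- its regularization limit is the required one.
  rw [opSum_opSum hβ ha hb hu h]
  exact isOp_opSum hβ (starProduct_mem_symbolClass ha hb h) hu h
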